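/- Let $(R,\mathfrak m)$ be a Noetherian local ring with infinite residue field $k$, let $I$ be an ideal of $R$ minimally generated by $f_1,\dots,f_n$ (so $n=\mu(I)$), let $\mathcal R=\bigoplus_{j\ge 0}I^j$ be its Rees algebra and $\mathcal F=\mathcal R/\mathfrak m\mathcal R$ its special fiber ring, and let $\ell=\dim\mathcal F$ be the analytic spread of $I$. An ideal $J\subset I$ is a reduction of $I$ if $I^{s+1}=JI^s$ for some $s\ge 0$; the least such $s$ is $r_J(I)$. Let $r$ be the reduction number of $I$, i.e. the least value of $r_J(I)$ as $J$ varies over the reductions of $I$ that are minimal with respect to inclusion, and let $t$ be a positive integer with $t\ge r$. Let $K$ be an $\mathfrak m$-primary ideal of $R$. Let $Q$ be the image in $(R/K)[T_1,\dots,T_n]$ of the kernel of the $R$-algebra map $R[T_1,\dots,T_n]\to\mathcal R$ sending $T_i$ to $f_i\in I=[\mathcal R]_1$, so that $\mathcal R/K\mathcal R\cong (R/K)[T_1,\dots,T_n]/Q$. We say that $\mathcal R/K\mathcal R$ has at most $N$ homogeneous generating relations in degrees $\le t$ if at most $N$ elements of a homogeneous minimal generating set of $Q$ have degree $\le t$ (their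 number does not depend on the chosen set), and that it has no homogeneous relations in degrees $\le t$ if $Q$ contains no nonzero form of degree $\le t$. A property holds for general elements $a_1,\dots,a_\ell$ of $I$ if there is a nonempty Zariski-open subset $U$ of $k^{\ell\times n}$ such that it holds for $a_i=\sum_{j=1}^n c_{ij}f_j$ $(1\le i\le \ell)$ whenever $c_{ij}\in R$ and the matrix of residue classes $(\overline{c_{ij}})$ lies in $U$. Theorem. Assume that (b)(i) if $K=\mathfrak m$ and $n\ge \ell+2$, then $\mathcal R/K\mathcal R=\mathcal F$ has at most two homogeneous generating relations in degrees $\le t$; (b)(ii) if $K=\mathfrak m$ and $n=\ell+1$, then $\mathcal R/K\mathcal R=\mathcal F$ has at most one homogeneous generating relation in degrees $\le t$; (b)(iii) if $K\ne\mathfrak m$, then $\mathcal R/K\mathcal R$ has no homogeneous relations in degrees $\le t$. Then for general elements $a_1,\dots,a_\ell$ of $I$ the following holds: if, with $\mathfrak a_i=(a_1,\dots,a_i)$, (a) $(\mathfrak a_iI^{t-1}:a_{i+1})\cap I^t=\mathfrak a_iI^{t-1}$ for all $0\le i\le \ell-1$, then $\mathcal R/K\mathcal R$ is Cohen-Macaulay,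 i.e. it is Noetherian and all its localizations at maximal ideals are Cohen-Macaulay local rings. -/

import Mathlib

open IsLocalRing

universe u

noncomputable section

/-! ### Cohen-Macaulay rings -/

/-- A (Noetherian) local ring `A` is Cohen-Macaulay if `depth A = dim A`, that is, if the maximal
ideal contains an `A`-regular sequence whose length is the Krull dimension of `A`. -/
def IsCohenMacaulayLocal (A : Type u) [CommRing A] [IsLocalRing A] : Prop :=
  ∃ rs : List A, (∀ x ∈ rs, x ∈ maximalIdeal A) ∧ RingTheory.Sequence.IsRegular A rs ∧
    ringKrullDim A = (rs.length : WithBot ℕ∞)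

/-- A ring is Cohen-Macaulay if it is Noetherian and all its localizations at maximal ideals are
Cohen-Macaulay local rings. -/
def IsCohenMacaulay (A : Type u) [CommRing A] : Prop :=
  IsNoetherianRing A ∧
    ∀ (M : Ideal A) [M.IsMaximal], IsCohenMacaulayLocal (Localization.AtPrime M)

/-! ### The Rees algebra modulo an ideal of the base ring, and the analytic spread -/

/-- The ring `ℛ / Kℛ`, where `ℛ = R[It]` is the Rees algebra of `I`. -/
abbrev ReesQuotient {R : Type u} [CommRing R] (I K : Ideal R) : Type u :=
  reesAlgebra I ⧸ K.map (algebraMap R (reesAlgebra I))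

/-- The special fiber ring `ℱ = ℛ / 𝔪ℛ`. -/
abbrev SpecialFiberRing {R : Type u} [CommRing R] [IsLocalRing R] (I : Ideal R) : Type u :=
  ReesQuotient I (maximalIdeal R)

/-- `I` has analytic spread `l`: the special fiber ring has Krull dimension `l`. -/
def HasAnalyticSpread {R : Type u} [CommRing R] [IsLocalRing R] (I : Ideal R) (l : ℕ) : Prop :=
  ringKrullDim (SpecialFiberRing I) = (l : WithBot ℕ∞)

/-! ### Reductions -/

/-- `J` is a reduction of `I`. -/
def IsReductionOf {R : Type u} [CommRing R] (J I : Ideal R) : Prop :=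
  J ≤ I ∧ ∃ r : ℕ, I ^ (r + 1) = J * I ^ r

/-- `J` is a minimal reduction of `I`: minimal for inclusion among the reductions of `I`. -/
def IsMinimalReductionOf {R : Type u} [CommRing R] (J I : Ideal R) : Prop :=
  Minimal (fun J' : Ideal R => IsReductionOf J' I) J

/-- The reduction number `r_J(I)` of `I` with respect to a reduction `J`. -/
def reductionNumberWrt {R : Type u} [CommRing R] (J I : Ideal R) : ℕ :=
  sInf {r : ℕ | I ^ (r + 1) = J * I ^ r}

/-- The reduction number of `I`: the least `r_J(I)`, where `J` varies over all minimal
reductions of `I`. -/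
def reductionNumber {R : Type u} [CommRing R] (I : Ideal R) : ℕ :=
  sInf {r : ℕ | ∃ J : Ideal R, IsMinimalReductionOf J I ∧ reductionNumberWrt J I = r}

/-! ### Generating relations of `ℛ / Kℛ` -/

/-- The ideal of `R[T₁, …, Tₙ]` of relations of the Rees algebra: the kernel of the `R`-algebra map
`Tᵢ ↦ fᵢ t` into `R[t]`, whose image is the Rees algebra of the ideal generated by the `fᵢ`. -/
def reesRelations {R : Type u} [CommRing R] {n : ℕ} (f : Fin n → R) :
    Ideal (MvPolynomial (Fin n) R) :=
  RingHom.ker (MvPolynomial.aeval (R := R) fun i => Polynomial.monomial 1 (f i))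

/-- The ideal `Q` of `(R/K)[T₁, …, Tₙ]` with `ℛ / Kℛ ≅ (R/K)[T₁, …, Tₙ] / Q`, namely the image of
the ideal of relations of the Rees algebra. -/
def relationIdeal {R : Type u} [CommRing R] {n : ℕ} (f : Fin n → R) (K : Ideal R) :
    Ideal (MvPolynomial (Fin n) (R ⧸ K)) :=
  (reesRelations f).map (MvPolynomial.map (Ideal.Quotient.mk K))

/-- `G` is a homogeneous minimal generating set of the ideal `Q` of a polynomial ring. -/
def IsMinimalHomogeneousGeneratingSet {A : Type u} [CommRing A] {n : ℕ}
    (G : Set (MvPolynomial (Fin n) A)) (Q : Ideal (MvPolynomial (Fin n) A)) : Prop :=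
  Minimal (fun G' : Set (MvPolynomial (Fin n) A) =>
    (∀ g ∈ G', ∃ d : ℕ, g.IsHomogeneous d) ∧ Ideal.span G' = Q) G

/-- `ℛ / Kℛ` has at most `N` homogeneous generating relations in degrees `≤ t`: at most `N`
elements of a homogeneous minimal generating set of `Q` have degree `≤ t`. (Over a local ring `R`
and for a proper ideal `K` the number of such elements does not depend on the generating set.) -/
def HasAtMostGeneratingRelations {R : Type u} [CommRing R] {n : ℕ} (f : Fin n → R) (K : Ideal R)
    (t N : ℕ) : Prop :=
  ∃ G : Set (MvPolynomial (Fin n) (R ⧸ K)),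
    IsMinimalHomogeneousGeneratingSet G (relationIdeal f K) ∧
      {g ∈ G | g.totalDegree ≤ t}.encard ≤ N

/-- `ℛ / Kℛ` has no homogeneous relations in degrees `≤ t`: the ideal `Q` contains no nonzero form
of degree `≤ t`. -/
def HasNoRelations {R : Type u} [CommRing R] {n : ℕ} (f : Fin n → R) (K : Ideal R)
    (t : ℕ) : Prop :=
  ∀ q ∈ relationIdeal f K, ∀ d ≤ t, q.IsHomogeneous d → q = 0

/-! ### General elements -/

/-- The property `P` holds for general elements `a₁, …, a_l` of the ideal generated by
`f₁, …, fₙ`: there is a nonempty Zariski-open subset of `k^(l × n)`, where `k` is the residue field,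
such that `P` holds for all `aᵢ = ∑ⱼ cᵢⱼ fⱼ` for which the tuple of residue classes of the
coefficients `cᵢⱼ ∈ R` lies in that open set. As `k` is infinite wherever this is used, the open
set can be taken to be the set where some nonzero polynomial `p` does not vanish. -/
def HoldsForGeneralElements {R : Type u} [CommRing R] [IsLocalRing R] {n : ℕ} (f : Fin n → R)
    (l : ℕ) (P : (Fin l → R) → Prop) : Prop :=
  ∃ p : MvPolynomial (Fin l × Fin n) (ResidueField R), p ≠ 0 ∧
    ∀ c : Fin l → Fin n → R,
      MvPolynomial.eval (fun x : Fin l × Fin n => residue R (c x.1 x.2)) p ≠ 0 →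
        P (fun i => ∑ j, c i j * f j)

/-- The ideal `𝔞ᵢ = (a₁, …, aᵢ)` generated by the first `i` members of a family (which is indexed
from `0` here). -/
def initialIdeal {R : Type u} [CommRing R] {l : ℕ} (a : Fin l → R) (i : ℕ) : Ideal R :=
  Ideal.span {x : R | ∃ j : Fin l, (j : ℕ) < i ∧ x = a j}

end

/-! Let `x_i` be the class of `a_i` in degree one of `ℛ/Kℛ`. The point is that `x_1, …, x_ℓ` is a
regular sequence and that `ℛ/Kℛ` is integral over the `R`-subalgebra generated by it. As `K` is
`𝔪`-primary, every localization at a maximal ideal is then Cohen-Macaulay of dimension `ℓ`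
(`isCohenMacaulay_of_isRegularUpTo`). Since a maximal ideal need not contain the `x_i`, each `x_i`
is replaced there by a monic polynomial in it.

Integrality comes from `I^(t+1) = (a_1, …, a_ℓ) I^t`, which holds for general elements
(`exists_ne_zero_pow_succ_eq`). By Nakayama the equation says that the relations of `ℱ` and the
linear forms belonging to the `a_i` contain all forms of degree `t + 1` in `S = k[T_1, …, T_n]`.
This is implied by the nonvanishing of a determinant in the coefficients. The determinant is not
identically zero, because a minimal reduction `J` with `I^(t+1) = J I^t` is generated by `ℓ`
elements: Noether normalization by linear forms coming from `J` yields `ℓ` elements of `J` that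
already generate a reduction.

Regularity is tested degree by degree (`IsRegularInDegree`). In degrees below `t` only relations of
degree at most `t` matter. If `K ≠ 𝔪` there are none, and linear forms that are part of a coordinate
system are regular. If `K = 𝔪` and `n ≥ ℓ + 2`, these relations are the forms of small degree in an
ideal `(dg, dh)` with `g, h` coprime. Modulo general linear forms `d` stays nonzero and `g, h` stay
coprime, because the dimension of `S/(g, h)` leaves room for `ℓ` forms. Hence every syzygy of `dg,
dh` modulo the linear forms is a Koszul syzygy; it lifts to `S`, which gives regularity
(`mem_of_rowForm_mul_mem`). For `n = ℓ + 1` there is one relation, and for `n = ℓ` the dimension of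
`ℱ` excludes relations altogether.

From degree `t` on, induction takes over (`isRegularInDegree_succ`). Condition (a) and the reduction
equation give `𝔞_i I^(t-1) ∩ I^j ⊆ 𝔞_i I^(j-1)` for all `j ≥ t`; regularity in one degree gives `𝔞_i
I^j ∩ K I^(j+1) ⊆ 𝔞_i K I^j`. Together these remove the error terms from `K` one generator at a
time. -/

namespace RingTheory.Sequence

open Function Pointwise

/-! ### Powers of regular sequences -/

/-- Weakly regular sequences on the outer terms of a short exact sequence are weakly regular on
the middle term. -/
theorem IsWeaklyRegular.of_exact {R : Type*} {M' M M'' : Type*} [CommRing R] [AddCommGroup M'] [AddCommGroup M]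
    [AddCommGroup M''] [Module R M'] [Module R M] [Module R M''] {f : M' →ₗ[R] M}
    {g : M →ₗ[R] M''} (hf : Injective f) (hfg : Exact f g) (hg : Surjective g) {rs : List R}
    (h' : IsWeaklyRegular M' rs) (h'' : IsWeaklyRegular M'' rs) : IsWeaklyRegular M rs := by
  induction rs generalizing M' M M'' with
  | nil => exact .nil R M
  | cons r rs ih =>
    rw [isWeaklyRegular_cons_iff] at h' h'' ⊢
    refine ⟨isSMulRegular_of_range_eq_ker hf (LinearMap.exact_iff.mp hfg).symm h'.1 h''.1, ?_⟩
    refine ih (f := QuotSMulTop.map r f) (g := QuotSMulTop.map r g) ?_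
      (QuotSMulTop.map_exact r hfg hg) (QuotSMulTop.map_surjective r hg) h'.2 h''.2
    -- Reduction modulo `r` keeps `f` injective because `r` is regular on the cokernel `M''`.
    have h0 : Exact (0 : M' →ₗ[R] M') f := by
      rw [LinearMap.exact_iff, LinearMap.ker_eq_bot.mpr hf, LinearMap.range_zero]
    have := QuotSMulTop.map_first_exact_on_four_term_exact_of_isSMulRegular_last h0 hfg h''.1
    rw [LinearMap.exact_iff, map_zero, LinearMap.range_zero] at this
    exact LinearMap.ker_eq_bot.mp this

/-- Induction on `d` along `0 → M/x^d M → M/x^(d+1) M → M/xM → 0`. The first map is multiplication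
by `x`, injective because `x` is regular on `M`. -/
theorem IsWeaklyRegular.quotSMulTop_pow {R M : Type*} [CommRing R] [AddCommGroup M] [Module R M]
    {x : R} (hx : IsSMulRegular M x) {rs : List R} (h : IsWeaklyRegular (QuotSMulTop x M) rs)
    (d : ℕ) : IsWeaklyRegular (QuotSMulTop (x ^ d) M) rs := by
  induction d with
  | zero =>
    have : Subsingleton (QuotSMulTop (x ^ 0) M) := by
      rw [QuotSMulTop, Submodule.Quotient.subsingleton_iff, pow_zero, one_smul]
    refine ⟨fun i hi a b _ => ?_⟩
    obtain ⟨a, rfl⟩ := Submodule.mkQ_surjective _ a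
    obtain ⟨b, rfl⟩ := Submodule.mkQ_surjective _ b
    rw [Subsingleton.elim a b]
  | succ d ih =>
    have key : ∀ m : M, x ^ d • (x • m) = x ^ (d + 1) • m := fun m => by rw [smul_smul, pow_succ]
    let f : QuotSMulTop (x ^ d) M →ₗ[R] QuotSMulTop (x ^ (d + 1)) M :=
      Submodule.mapQ _ _ (LinearMap.lsmul R M x) (by
        rintro _ ⟨m, -, rfl⟩
        exact ⟨m, trivial, by
          simp only [DistribSMul.toLinearMap_apply, LinearMap.lsmul_apply]
          rw [← key, smul_comm]⟩)
    let g : QuotSMulTop (x ^ (d + 1)) M →ₗ[R] QuotSMulTop x M :=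
      Submodule.mapQ _ _ LinearMap.id (by
        rintro _ ⟨m, -, rfl⟩
        exact ⟨x ^ d • m, trivial, by
          simp only [DistribSMul.toLinearMap_apply, LinearMap.id_apply]
          rw [← key, smul_comm]⟩)
    refine IsWeaklyRegular.of_exact (f := f) (g := g) ?_ ?_ ?_ ih h
    · rw [← LinearMap.ker_eq_bot, eq_bot_iff]
      intro q hq
      obtain ⟨m, rfl⟩ := Submodule.mkQ_surjective _ q
      rw [LinearMap.mem_ker] at hq
      simp only [f, Submodule.mkQ_apply, Submodule.mapQ_apply, LinearMap.lsmul_apply] at hq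
      rw [Submodule.Quotient.mk_eq_zero] at hq
      obtain ⟨m', -, hm'⟩ := hq
      simp only [DistribSMul.toLinearMap_apply] at hm'
      rw [Submodule.mem_bot, Submodule.mkQ_apply, Submodule.Quotient.mk_eq_zero]
      refine ⟨m', trivial, hx ?_⟩
      simp only [DistribSMul.toLinearMap_apply]
      rw [← hm', ← key, smul_comm]
    · intro q
      obtain ⟨m, rfl⟩ := Submodule.mkQ_surjective _ q
      simp only [g, Submodule.mkQ_apply, Submodule.mapQ_apply, LinearMap.id_apply]
      rw [Submodule.Quotient.mk_eq_zero]
      constructor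
      · rintro ⟨m', -, rfl⟩
        exact ⟨Submodule.Quotient.mk m', rfl⟩
      · rintro ⟨q', hq'⟩
        obtain ⟨m', rfl⟩ := Submodule.mkQ_surjective _ q'
        simp only [f, Submodule.mkQ_apply, Submodule.mapQ_apply, LinearMap.lsmul_apply] at hq'
        rw [Submodule.Quotient.eq] at hq'
        obtain ⟨m'', -, h''⟩ := hq'
        refine ⟨m' - x ^ d • m'', trivial, ?_⟩
        simp only [DistribSMul.toLinearMap_apply] at h'' ⊢
        rw [smul_sub, smul_comm, key, h'']
        abel
    · intro q
      obtain ⟨m, rfl⟩ := Submodule.mkQ_surjective _ q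
      exact ⟨Submodule.Quotient.mk m, rfl⟩

/-- Powers of the members of a weakly regular sequence form a weakly regular sequence. -/
theorem IsWeaklyRegular.zipWith_pow {R : Type*} {M : Type*} [CommRing R] [AddCommGroup M] [Module R M]
    {ps : List (R × ℕ)} (h : IsWeaklyRegular M (ps.map Prod.fst)) :
    IsWeaklyRegular M (ps.map fun p => p.1 ^ p.2) := by
  induction ps generalizing M with
  | nil => exact .nil R M
  | cons p ps ih =>
    rw [List.map_cons, isWeaklyRegular_cons_iff] at h ⊢
    exact ⟨h.1.pow _, quotSMulTop_pow h.1 (ih h.2) _⟩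

end RingTheory.Sequence

/-- The members `x₀, …, x_{l-1}` of the sequence form a weakly regular sequence. -/
def IsRegularUpTo {A : Type*} [CommRing A] (x : ℕ → A) (l : ℕ) : Prop :=
  ∀ i < l, ∀ u : A, x i * u ∈ Ideal.span (x '' Set.Iio i) → u ∈ Ideal.span (x '' Set.Iio i)

theorem Ideal.ofList_map_range {A : Type*} [CommRing A] (x : ℕ → A) (i : ℕ) :
    Ideal.ofList ((List.range i).map x) = Ideal.span (x '' Set.Iio i) := by
  unfold Ideal.ofList
  congr 1
  ext a
  simp

theorem isRegularUpTo_iff {A : Type*} [CommRing A] {x : ℕ → A} {l : ℕ} :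
    IsRegularUpTo x l ↔ RingTheory.Sequence.IsWeaklyRegular A ((List.range l).map x) := by
  rw [RingTheory.Sequence.isWeaklyRegular_iff]
  have aux : ∀ i (hi : i < ((List.range l).map x).length),
      (IsSMulRegular (A ⧸ (Ideal.ofList (((List.range l).map x).take i) • ⊤ : Submodule A A))
        ((List.range l).map x)[i] ↔
        ∀ u : A, x i * u ∈ Ideal.span (x '' Set.Iio i) → u ∈ Ideal.span (x '' Set.Iio i)) := by
    intro i hi
    have hi' : i < l := by simpa using hi
    rw [isSMulRegular_quotient_iff_mem_of_smul_mem]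
    simp only [← List.map_take, List.take_range, min_eq_left hi'.le, Ideal.ofList_map_range,
      smul_eq_mul, Ideal.mul_top, List.getElem_map, List.getElem_range]
  constructor
  · intro h i hi
    exact (aux i hi).mpr (h i (by simpa using hi))
  · intro h i hi
    exact (aux i (by simpa using hi)).mp (h i (by simpa using hi))

theorem IsRegularUpTo.pow {A : Type*} [CommRing A] {x : ℕ → A} {l : ℕ} (h : IsRegularUpTo x l)
    (d : ℕ → ℕ) : IsRegularUpTo (fun s => x s ^ d s) l := by
  rw [isRegularUpTo_iff] at h ⊢
  have := RingTheory.Sequence.IsWeaklyRegular.zipWith_pow (M := A)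
    (ps := (List.range l).map fun s => (x s, d s)) (by simpa [Function.comp_def] using h)
  simpa [Function.comp_def] using this

theorem Ideal.span_image_Iio_succ {A : Type*} [CommRing A] (x : ℕ → A) (i : ℕ) :
    Ideal.span (x '' Set.Iio (i + 1)) = Ideal.span (x '' Set.Iio i) ⊔ Ideal.span {x i} := by
  have : Set.Iio (i + 1) = insert i (Set.Iio i) := by ext; simp
  rw [this, Set.image_insert_eq, Ideal.span_insert, sup_comm]

/-! ### Gradings and leading forms -/

/-- The additive maps `comp j` are the projections onto the homogeneous components of a grading of
the ring by the natural numbers. -/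
structure IsGradingByComponents {A : Type*} [CommRing A] (comp : ℕ → A →+ A) : Prop where
  eq_zero : ∀ u, (∀ j, comp j u = 0) → u = 0
  bounded : ∀ u, ∃ D, ∀ j, D ≤ j → comp j u = 0
  comp_one : comp 0 1 = 1
  comp_self : ∀ j u, comp j (comp j u) = comp j u
  comp_of_ne : ∀ i j u, i ≠ j → comp i (comp j u) = 0
  comp_mul : ∀ n u v, comp n (u * v) =
    ∑ p ∈ Finset.HasAntidiagonal.antidiagonal n, comp p.1 u * comp p.2 v

namespace IsGradingByComponents

variable {A : Type*} [CommRing A] {comp : ℕ → A →+ A}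

theorem comp_mul_of_homogeneous (h : IsGradingByComponents comp) {y : A} {d : ℕ}
    (hy : comp d y = y) (n : ℕ) (u : A) : comp (n + d) (y * u) = y * comp n u := by
  rw [h.comp_mul, Finset.sum_eq_single (d, n)]
  · simp only [hy]
  · rintro ⟨a, b⟩ hab hne
    simp only [Finset.HasAntidiagonal.mem_antidiagonal] at hab
    have : a ≠ d := by rintro rfl; exact hne (by ext <;> simp; omega)
    simp only
    rw [← hy, h.comp_of_ne _ _ _ this, zero_mul]
  · intro hn
    exact absurd (Finset.HasAntidiagonal.mem_antidiagonal.mpr (by simp; omega)) hn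

theorem comp_mul_of_lt (h : IsGradingByComponents comp) {y : A} {d : ℕ}
    (hy : comp d y = y) {n : ℕ} (hn : n < d) (u : A) : comp n (y * u) = 0 := by
  rw [h.comp_mul]
  refine Finset.sum_eq_zero ?_
  rintro ⟨a, b⟩ hab
  simp only [Finset.HasAntidiagonal.mem_antidiagonal] at hab
  simp only
  rw [← hy, h.comp_of_ne _ _ _ (by omega), zero_mul]

/-- Top components are multiplicative. -/
theorem comp_mul_top (h : IsGradingByComponents comp) {u v : A} {m n : ℕ}
    (hu : ∀ j, m < j → comp j u = 0) (hv : ∀ j, n < j → comp j v = 0) :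
    comp (m + n) (u * v) = comp m u * comp n v := by
  rw [h.comp_mul, Finset.sum_eq_single (m, n)]
  · rintro ⟨a, b⟩ hab hne
    simp only [Finset.HasAntidiagonal.mem_antidiagonal] at hab
    simp only
    rcases lt_trichotomy a m with h1 | h1 | h1
    · rw [hv b (by omega), mul_zero]
    · exact absurd (by ext <;> simp <;> omega) hne
    · rw [hu a h1, zero_mul]
  · intro hn
    exact absurd (Finset.HasAntidiagonal.mem_antidiagonal.mpr (by simp)) hn

theorem comp_mul_eq_zero (h : IsGradingByComponents comp) {u v : A} {m n j : ℕ}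
    (hu : ∀ j, m < j → comp j u = 0) (hv : ∀ j, n < j → comp j v = 0) (hj : m + n < j) :
    comp j (u * v) = 0 := by
  rw [h.comp_mul]
  refine Finset.sum_eq_zero ?_
  rintro ⟨a, b⟩ hab
  simp only [Finset.HasAntidiagonal.mem_antidiagonal] at hab
  simp only
  rcases lt_or_ge m a with h1 | h1
  · rw [hu a h1, zero_mul]
  · rw [hv b (by omega), mul_zero]

theorem comp_mul_comp_self (h : IsGradingByComponents comp) {y z : A} {d e : ℕ}
    (hy : comp d y = y) (hz : comp e z = z) : comp (d + e) (y * z) = y * z := by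
  rw [add_comm, h.comp_mul_of_homogeneous hy, hz]

section Leading

variable {y g : ℕ → A} {d : ℕ → ℕ}

/-- A homogeneous element of degree `D` of `(y₀, …, y_{i-1})` is the top component of an element
of `(g₀, …, g_{i-1})`, if the `y_s` are the top components of the `g_s`. -/
theorem exists_lift_top (h : IsGradingByComponents comp)
    (hy : ∀ s, comp (d s) (y s) = y s) (hg : ∀ s, comp (d s) (g s) = y s)
    (hg' : ∀ s j, d s < j → comp j (g s) = 0) (i D : ℕ) {v : A} (hv : comp D v = v)
    (hvm : v ∈ Ideal.span (y '' Set.Iio i)) :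
    ∃ w ∈ Ideal.span (g '' Set.Iio i), (∀ j, D < j → comp j w = 0) ∧ comp D w = v := by
  suffices H : ∀ v ∈ Ideal.span (y '' Set.Iio i), ∃ w ∈ Ideal.span (g '' Set.Iio i),
      (∀ j, D < j → comp j w = 0) ∧ comp D w = comp D v by
    obtain ⟨w, h1, h2, h3⟩ := H v hvm
    exact ⟨w, h1, h2, h3.trans hv⟩
  clear hvm hv v
  induction i with
  | zero => exact fun v hv => ⟨0, zero_mem _, by simp, by
      have : v = 0 := by simpa using hv
      rw [this]⟩
  | succ i ih =>
    intro v hv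
    rw [Ideal.span_image_Iio_succ] at hv ⊢
    obtain ⟨a, ha, b, hb, rfl⟩ := Submodule.mem_sup.mp hv
    obtain ⟨b, rfl⟩ := Ideal.mem_span_singleton'.mp hb
    obtain ⟨w, h1, h2, h3⟩ := ih a ha
    rw [mul_comm b]
    rcases lt_or_ge D (d i) with hD | hD
    · exact ⟨w, Ideal.mem_sup_left h1, h2, by
        rw [h3, map_add, h.comp_mul_of_lt (hy i) hD, add_zero]⟩
    · obtain ⟨e, rfl⟩ := Nat.exists_eq_add_of_le' hD
      have he : ∀ j, e < j → comp j (comp e b) = 0 := fun j hj => h.comp_of_ne _ _ _ (by omega)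
      refine ⟨w + g i * comp e b, Ideal.add_mem _ (Ideal.mem_sup_left h1)
        (Ideal.mem_sup_right (Ideal.mul_mem_right _ _ (Ideal.mem_span_singleton_self _))), ?_, ?_⟩
      · intro j hj
        rw [map_add, h2 j hj, h.comp_mul_eq_zero (hg' i) he (by omega), add_zero]
      · rw [map_add, map_add, h3, h.comp_mul_of_homogeneous (hy i), add_comm e,
          h.comp_mul_top (hg' i) he, hg, h.comp_self]

/-- Top components of elements of `(g₀, …, g_{i-1})` lie in the ideal of the leading forms. -/
theorem comp_mem_of_mem (h : IsGradingByComponents comp)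
    (hy : ∀ s, comp (d s) (y s) = y s) (hg : ∀ s, comp (d s) (g s) = y s)
    (hg' : ∀ s j, d s < j → comp j (g s) = 0) {i : ℕ} (hreg : IsRegularUpTo y i) (D : ℕ) {w : A}
    (hw : w ∈ Ideal.span (g '' Set.Iio i)) (hwD : ∀ j, D < j → comp j w = 0) :
    comp D w ∈ Ideal.span (y '' Set.Iio i) := by
  induction i generalizing D w with
  | zero =>
    have : w = 0 := by simpa using hw
    rw [this, map_zero]; exact zero_mem _
  | succ i ih =>
    have hreg' : IsRegularUpTo y i := fun s hs => hreg s (by omega)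
    rw [Ideal.span_image_Iio_succ] at hw ⊢
    obtain ⟨a, ha, b, hb, rfl⟩ := Submodule.mem_sup.mp hw
    obtain ⟨b, rfl⟩ := Ideal.mem_span_singleton'.mp hb
    rw [mul_comm b] at hwD ⊢
    clear hw hb
    -- Inner induction on a degree bound for the coefficient `b` of `g i`.
    obtain ⟨E, hE⟩ := h.bounded b
    induction E generalizing a b with
    | zero =>
      have hb0 : b = 0 := h.eq_zero b fun j => hE j (Nat.zero_le _)
      subst hb0
      rw [mul_zero, add_zero] at hwD ⊢
      exact Ideal.mem_sup_left (ih hreg' D ha hwD)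
    | succ E ihE =>
      have hE' : ∀ j, E < j → comp j b = 0 := fun j hj => hE j hj
      -- If `g i * b` reaches beyond degree `D`, its top part cancels against that of `a`.
      -- Regularity of the leading forms then puts the top part of `b` into the ideal of the earlier
      -- `y s`, and a lift `w'` of it can be shifted from `b` into `a`, which lowers the degree of
      -- `b`. Otherwise no cancellation occurs and the components of degree `D` can be read off.
      rcases lt_or_ge D (d i + E) with hD | hD
      · have ha' : ∀ j, d i + E < j → comp j a = 0 := fun j hj => by
          have := hwD j (by omega)
          rwa [map_add, h.comp_mul_eq_zero (hg' i) hE' hj, add_zero] at this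
        have htop := hwD _ hD
        rw [map_add, h.comp_mul_top (hg' i) hE', hg] at htop
        have hmem : comp E b ∈ Ideal.span (y '' Set.Iio i) := by
          refine hreg i (by omega) _ ?_
          rw [← neg_eq_of_add_eq_zero_right htop]
          exact neg_mem (ih hreg' _ ha ha')
        obtain ⟨w', hw1, hw2, hw3⟩ := h.exists_lift_top hy hg hg' i E (h.comp_self E b) hmem
        have heq : a + g i * b = (a + g i * w') + g i * (b - w') := by ring
        rw [heq] at hwD ⊢
        refine ihE (a + g i * w') (add_mem ha (Ideal.mul_mem_left _ _ hw1)) (b - w') hwD ?_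
        intro j hj
        rcases eq_or_lt_of_le hj with rfl | hj
        · rw [map_sub, hw3, sub_self]
        · rw [map_sub, hE' j hj, hw2 j hj, sub_zero]
      · obtain ⟨e, rfl⟩ := Nat.exists_eq_add_of_le hD
        have hb' : ∀ j, E + e < j → comp j b = 0 := fun j hj => hE' j (by omega)
        have ha' : ∀ j, d i + E + e < j → comp j a = 0 := fun j hj => by
          have := hwD j hj
          rwa [map_add, h.comp_mul_eq_zero (hg' i) hb' (by omega), add_zero] at this
        rw [map_add, add_assoc, h.comp_mul_top (hg' i) hb', hg, ← add_assoc]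
        exact add_mem (Ideal.mem_sup_left (ih hreg' _ ha ha'))
          (Ideal.mem_sup_right (Ideal.mul_mem_right _ _ (Ideal.mem_span_singleton_self _)))

/-- Elements whose leading forms are a regular sequence form a regular sequence. -/
theorem isRegularUpTo_of_leading (h : IsGradingByComponents comp)
    (hy : ∀ s, comp (d s) (y s) = y s) (hg : ∀ s, comp (d s) (g s) = y s)
    (hg' : ∀ s j, d s < j → comp j (g s) = 0) {l : ℕ} (hreg : IsRegularUpTo y l) :
    IsRegularUpTo g l := by
  intro i hi u hu
  have hreg' : IsRegularUpTo y i := fun s hs => hreg s (by omega)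
  obtain ⟨E, hE⟩ := h.bounded u
  induction E generalizing u with
  | zero =>
    rw [h.eq_zero u fun j => hE j (Nat.zero_le _)]
    exact zero_mem _
  | succ E ih =>
    have hE' : ∀ j, E < j → comp j u = 0 := fun j hj => hE j hj
    have htop := h.comp_mem_of_mem hy hg hg' hreg' (d i + E) hu
      (fun j hj => h.comp_mul_eq_zero (hg' i) hE' hj)
    rw [h.comp_mul_top (hg' i) hE', hg] at htop
    obtain ⟨w', hw1, hw2, hw3⟩ :=
      h.exists_lift_top hy hg hg' i E (h.comp_self E u) (hreg i hi _ htop)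
    have := ih (u - w') (by rw [mul_sub]; exact sub_mem hu (Ideal.mul_mem_left _ _ hw1)) (by
      intro j hj
      rcases eq_or_lt_of_le hj with rfl | hj
      · rw [map_sub, hw3, sub_self]
      · rw [map_sub, hE' j hj, hw2 j hj, sub_zero])
    rw [← sub_add_cancel u w']
    exact add_mem this hw1

end Leading

end IsGradingByComponents

namespace IsGradingByComponents

open Polynomial

variable {A : Type*} [CommRing A] {comp : ℕ → A →+ A}

theorem comp_pow (h : IsGradingByComponents comp) {x : A} (hx : comp 1 x = x) (d : ℕ) :
    comp d (x ^ d) = x ^ d := by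
  induction d with
  | zero => simpa using h.comp_one
  | succ d ih => rw [pow_succ, h.comp_mul_comp_self ih hx]

theorem comp_pow_of_ne (h : IsGradingByComponents comp) {x : A} (hx : comp 1 x = x) {d j : ℕ}
    (hj : j ≠ d) : comp j (x ^ d) = 0 := by
  rw [← h.comp_pow hx, h.comp_of_ne _ _ _ hj]

theorem comp_aeval {R : Type*} [CommRing R] [Algebra R A] (h : IsGradingByComponents comp)
    (hR : ∀ r, comp 0 (algebraMap R A r) = algebraMap R A r) {x : A} (hx : comp 1 x = x)
    (p : R[X]) (j : ℕ) : comp j (aeval x p) = p.coeff j • x ^ j := by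
  induction p using Polynomial.induction_on' with
  | add p q hp hq => rw [map_add, map_add, hp, hq, coeff_add, add_smul]
  | monomial n a =>
    have := h.comp_mul_of_homogeneous (hR a) j (x ^ n)
    rw [add_zero] at this
    rw [aeval_monomial, this, coeff_monomial]
    split_ifs with hn
    · rw [hn, h.comp_pow hx, Algebra.smul_def]
    · rw [h.comp_pow_of_ne hx (Ne.symm hn), mul_zero, zero_smul]

/-- A grading descends to the quotient by an ideal that is stable under the projections. -/
theorem quotient (h : IsGradingByComponents comp) {N : Ideal A} {comp' : ℕ → A ⧸ N →+ A ⧸ N}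
    (hN : ∀ j u, comp' j (Ideal.Quotient.mk N u) = Ideal.Quotient.mk N (comp j u))
    (hsum : ∀ u, (∀ j, comp j u ∈ N) → u ∈ N) : IsGradingByComponents comp' where
  eq_zero u hu := by
    obtain ⟨p, rfl⟩ := Ideal.Quotient.mk_surjective u
    rw [Ideal.Quotient.eq_zero_iff_mem]
    exact hsum p fun j => by rw [← Ideal.Quotient.eq_zero_iff_mem, ← hN, hu]
  bounded u := by
    obtain ⟨p, rfl⟩ := Ideal.Quotient.mk_surjective u
    obtain ⟨D, hD⟩ := h.bounded p
    exact ⟨D, fun j hj => by rw [hN, hD j hj, map_zero]⟩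
  comp_one := by rw [← map_one (Ideal.Quotient.mk N), hN, h.comp_one]
  comp_self j u := by
    obtain ⟨p, rfl⟩ := Ideal.Quotient.mk_surjective u
    rw [hN, hN, h.comp_self]
  comp_of_ne i j u hij := by
    obtain ⟨p, rfl⟩ := Ideal.Quotient.mk_surjective u
    rw [hN, hN, h.comp_of_ne i j p hij, map_zero]
  comp_mul n u v := by
    obtain ⟨p, rfl⟩ := Ideal.Quotient.mk_surjective u
    obtain ⟨q, rfl⟩ := Ideal.Quotient.mk_surjective v
    simp only [← map_mul, hN, h.comp_mul, map_sum]

/-- The additive map induced on the quotient by a stable ideal. -/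
def quotientMap (N : Ideal A) (φ : A →+ A) (hφ : ∀ u ∈ N, φ u ∈ N) : A ⧸ N →+ A ⧸ N :=
  AddMonoidHom.mk' (Quotient.map' φ fun a b hab => by
      rw [Submodule.quotientRel_def] at hab ⊢
      rw [← map_sub]; exact hφ _ hab) (by
    intro u v
    obtain ⟨u, rfl⟩ := Ideal.Quotient.mk_surjective u
    obtain ⟨v, rfl⟩ := Ideal.Quotient.mk_surjective v
    rw [← map_add]
    change Ideal.Quotient.mk N (φ (u + v)) = Ideal.Quotient.mk N (φ u) + Ideal.Quotient.mk N (φ v)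
    rw [map_add, map_add])

end IsGradingByComponents

/-! ### Integrality and the Cohen-Macaulay property of graded algebras -/

/-- Nullstellensatz over a local ring. -/
theorem isIntegral_quotient_of_isMaximal {R A : Type*} [CommRing R] [IsLocalRing R] [CommRing A]
    [Algebra R A] [Algebra.FiniteType R A] (M : Ideal A) [hM : M.IsMaximal]
    (hm : maximalIdeal R ≤ M.comap (algebraMap R A)) : Algebra.IsIntegral R (A ⧸ M) := by
  let : Field (A ⧸ M) := Ideal.Quotient.field M
  have hker : ∀ r ∈ maximalIdeal R, algebraMap R (A ⧸ M) r = 0 := fun r hr => by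
    rw [IsScalarTower.algebraMap_apply R A (A ⧸ M)]
    exact Ideal.Quotient.eq_zero_iff_mem.mpr (hm hr)
  obtain ⟨n, φ, hφ⟩ := Algebra.FiniteType.iff_quotient_mvPolynomial''.mp
    (inferInstance : Algebra.FiniteType R (A ⧸ M))
  -- Since `maximalIdeal R` dies in `A ⧸ M`, the presentation factors through a polynomial ring over
  -- a field, where the Nullstellensatz for Jacobson rings applies.
  let ι : ResidueField R →+* A ⧸ M := Ideal.Quotient.lift _ (algebraMap R (A ⧸ M)) hker
  let ψ : MvPolynomial (Fin n) (ResidueField R) →+* A ⧸ M :=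
    MvPolynomial.eval₂Hom ι fun i => φ (MvPolynomial.X i)
  have hcomp : ψ.comp (MvPolynomial.map (residue R)) = φ.toRingHom := by
    refine MvPolynomial.ringHom_ext (fun r => ?_) (fun i => ?_)
    · simp only [ψ, RingHom.comp_apply, MvPolynomial.map_C, MvPolynomial.eval₂Hom_C]
      exact (φ.commutes r).symm
    · simp [ψ]
  have hψ : Function.Surjective ψ := fun z => by
    obtain ⟨p, rfl⟩ := hφ z
    exact ⟨MvPolynomial.map (residue R) p, RingHom.congr_fun hcomp p⟩
  have hι : (ψ.comp MvPolynomial.C).IsIntegral :=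
    MvPolynomial.comp_C_integral_of_surjective_of_isJacobsonRing ψ hψ
  have : ((ψ.comp MvPolynomial.C).comp (residue R)).IsIntegral :=
    RingHom.IsIntegral.trans _ _ (RingHom.isIntegral_of_surjective _ residue_surjective) hι
  have heq : (ψ.comp MvPolynomial.C).comp (residue R) = algebraMap R (A ⧸ M) := by
    ext r
    simp only [ψ, RingHom.comp_apply, MvPolynomial.eval₂Hom_C]
    rfl
  rw [heq] at this
  exact ⟨this⟩

/-- The ring `A` is integral over the `R`-subalgebra generated by `X`. -/
def IsIntegralOverAdjoin (R : Type*) {A : Type*} [CommRing R] [CommRing A] [Algebra R A]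
    (X : Set A) : Prop :=
  ∀ u : A, IsIntegral (Algebra.adjoin R X) u

/-- A prime ideal is maximal if it contains a monic polynomial expression over the local ring `R`
in each of finitely many elements over which the ring is integral. -/
theorem Ideal.IsPrime.isMaximal_of_monic_aeval_mem {R A : Type*} [CommRing R] [IsLocalRing R]
    [CommRing A] [Algebra R A] {X : Set A}
    (hint : IsIntegralOverAdjoin R X) (p : Ideal A) [hp : p.IsPrime]
    (hm : maximalIdeal R ≤ p.comap (algebraMap R A))
    (hX : ∀ x ∈ X, ∃ P : Polynomial R, P.Monic ∧ Polynomial.aeval x P ∈ p) : p.IsMaximal := by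
  have hsub : ∀ z : Algebra.adjoin R X,
      Ideal.Quotient.mkₐ R p z ∈ integralClosure R (A ⧸ p) := by
    have : Algebra.adjoin R X ≤ (integralClosure R (A ⧸ p)).comap (Ideal.Quotient.mkₐ R p) := by
      refine Algebra.adjoin_le fun x hx => ?_
      obtain ⟨P, hP, hPx⟩ := hX x hx
      refine ⟨P, hP, ?_⟩
      rw [← Polynomial.aeval_def]
      exact (Polynomial.aeval_algHom_apply (Ideal.Quotient.mkₐ R p) x P).trans
        (Ideal.Quotient.eq_zero_iff_mem.mpr hPx)
    exact fun z => this z.2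
  have hI : Algebra.IsIntegral R (A ⧸ p) := by
    refine ⟨fun z => ?_⟩
    obtain ⟨u, rfl⟩ := Ideal.Quotient.mk_surjective z
    have h1 : IsIntegral (integralClosure R (A ⧸ p)) (Ideal.Quotient.mk p u) :=
      (hint u).map_of_comp_eq
        (φ := (((Ideal.Quotient.mkₐ R p).comp (Algebra.adjoin R X).val).codRestrict
          (integralClosure R (A ⧸ p)) hsub).toRingHom)
        (ψ := Ideal.Quotient.mk p) (by ext z; rfl)
    exact isIntegral_trans _ h1
  have hbot : (⊥ : Ideal (A ⧸ p)).IsMaximal := by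
    refine Ideal.isMaximal_of_isIntegral_of_isMaximal_comap (R := R) ⊥ ?_
    have : (⊥ : Ideal (A ⧸ p)).comap (algebraMap R (A ⧸ p)) = maximalIdeal R := by
      refine le_antisymm (le_maximalIdeal ?_) fun r hr => ?_
      · exact Ideal.comap_ne_top _ (bot_ne_top)
      · rw [Ideal.mem_comap, Ideal.mem_bot, IsScalarTower.algebraMap_apply R A (A ⧸ p)]
        exact Ideal.Quotient.eq_zero_iff_mem.mpr (hm hr)
    rw [this]
    infer_instance
  exact Ideal.bot_quotient_isMaximal_iff p |>.mp hbot

/-- Since `A ⧸ M` is integral over `R`, each `x s` satisfies a monic polynomial `P s` modulo `M`.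
The elements `P s (x s)` of `M` have leading forms `x s ^ natDegree`, hence are again a regular
sequence. By integrality every prime containing them and `maximalIdeal R` is maximal, so dividing by
them brings the dimension of the localization down to zero. -/
theorem isCohenMacaulay_of_isRegularUpTo {R : Type*} {A : Type u} [CommRing R] [IsLocalRing R]
    [CommRing A] [Algebra R A] [Algebra.FiniteType R A] [IsNoetherianRing A]
    {comp : ℕ → A →+ A} (h : IsGradingByComponents comp)
    (hR : ∀ r, comp 0 (algebraMap R A r) = algebraMap R A r) {x : ℕ → A} {l : ℕ}
    (hx : ∀ s, comp 1 (x s) = x s) (hreg : IsRegularUpTo x l)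
    (hint : IsIntegralOverAdjoin R (x '' Set.Iio l))
    (hm : ∀ r ∈ maximalIdeal R, IsNilpotent (algebraMap R A r)) : IsCohenMacaulay A := by
  have hm' : ∀ p : Ideal A, p.IsPrime → maximalIdeal R ≤ p.comap (algebraMap R A) := by
    intro p hp r hr
    obtain ⟨N, hN⟩ := hm r hr
    exact hp.mem_of_pow_mem N (by rw [hN]; exact zero_mem _)
  refine ⟨inferInstance, fun M hM => ?_⟩
  have hMp := hM.isPrime
  have hMI := isIntegral_quotient_of_isMaximal M (hm' M hMp)
  have hP : ∀ s, ∃ P : Polynomial R, P.Monic ∧ Polynomial.aeval (x s) P ∈ M := by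
    intro s
    obtain ⟨P, hP, hP0⟩ := hMI.isIntegral (Ideal.Quotient.mk M (x s))
    refine ⟨P, hP, ?_⟩
    rw [← Ideal.Quotient.eq_zero_iff_mem, ← hP0, ← Polynomial.aeval_def]
    exact (Polynomial.aeval_algHom_apply (Ideal.Quotient.mkₐ R M) (x s) P).symm
  choose P hP hPM using hP
  let g : ℕ → A := fun s => Polynomial.aeval (x s) (P s)
  have hg : IsRegularUpTo g l := by
    refine h.isRegularUpTo_of_leading (y := fun s => x s ^ (P s).natDegree)
      (d := fun s => (P s).natDegree) (fun s => h.comp_pow (hx s) _) (fun s => ?_) (fun s j hj => ?_)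
      (hreg.pow _)
    · rw [h.comp_aeval hR (hx s), (hP s).coeff_natDegree, one_smul]
    · rw [h.comp_aeval hR (hx s), Polynomial.coeff_eq_zero_of_natDegree_lt hj, zero_smul]
  let gs := (List.range l).map g
  have hgs : ∀ a ∈ gs, a ∈ M := by
    intro a ha
    obtain ⟨s, -, rfl⟩ := List.mem_map.mp ha
    exact hPM s
  have hgreg := (isRegularUpTo_iff.mp hg).isRegular_of_isLocalization_of_mem
    (Localization.AtPrime M) M hgs
  refine ⟨gs.map (algebraMap A (Localization.AtPrime M)), ?_, hgreg, ?_⟩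
  · intro a ha
    obtain ⟨b, hb, rfl⟩ := List.mem_map.mp ha
    exact (IsLocalization.AtPrime.to_map_mem_maximal_iff _ M b).mpr (hgs b hb)
  · rw [← ringKrullDim_add_length_eq_ringKrullDim_of_isRegular _ hgreg]
    set 𝔮 := Ideal.ofList (gs.map (algebraMap A (Localization.AtPrime M))) with h𝔮
    have hne : 𝔮 ≠ ⊤ := by
      intro h0
      exact hgreg.top_ne_smul (by rw [← h𝔮, h0]; simp)
    have : Nontrivial (Localization.AtPrime M ⧸ 𝔮) := Ideal.Quotient.nontrivial_iff.mpr hne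
    -- A prime over `𝔮` contracts to a maximal ideal of `A` contained in `M`, hence to `M` itself.
    have hdim : Ring.KrullDimLE 0 (Localization.AtPrime M ⧸ 𝔮) := by
      rw [Ideal.krullDimLE_zero_quotient_iff_forall_minimalPrimes_isMaximal]
      intro p hp
      have hpp : p.IsPrime := hp.1.1
      have hp' : (p.comap (algebraMap A (Localization.AtPrime M))).IsMaximal := by
        refine Ideal.IsPrime.isMaximal_of_monic_aeval_mem hint _ (hm' _ inferInstance) ?_
        rintro _ ⟨s, hs, rfl⟩
        refine ⟨P s, hP s, hp.1.2 ?_⟩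
        exact Ideal.subset_span (List.mem_map.mpr ⟨g s, List.mem_map.mpr ⟨s, by simpa using hs, rfl⟩, rfl⟩)
      have hle : p.comap (algebraMap A (Localization.AtPrime M)) ≤ M := by
        intro a ha
        exact (IsLocalization.AtPrime.to_map_mem_maximal_iff (Localization.AtPrime M) M a).mp
          (le_maximalIdeal hpp.ne_top ha)
      rw [Localization.AtPrime.eq_maximalIdeal_iff_under_eq.mp (hp'.eq_of_le hM.ne_top hle)]
      infer_instance
    rw [ringKrullDimZero_iff_ringKrullDim_eq_zero.mp hdim, zero_add]

/-- A ring is integral over the subalgebra generated by elements such that multiplication by them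
maps each of the finite submodules `N j`, for large `j`, onto the next one. -/
theorem isIntegral_adjoin_of_graded {R A : Type*} [CommRing R] [CommRing A] [Algebra R A]
    {N : ℕ → Submodule R A} (hfg : ∀ j, (N j).FG) (hN : ⨆ j, N j = ⊤) {X : Set A} {t : ℕ}
    (hX : ∀ j, t ≤ j → ∀ z ∈ N (j + 1), z ∈ Submodule.span R {y | ∃ x ∈ X, ∃ w ∈ N j, y = x * w}) :
    IsIntegralOverAdjoin R X := by
  intro u
  classical
  choose S hS using hfg
  let T : Finset A := (Finset.range (t + 1)).biUnion S
  let W : Submodule (Algebra.adjoin R X) A := Submodule.span _ (T : Set A)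
  have hle : ∀ j, N j ≤ W.restrictScalars R := by
    intro j
    induction j with
    | zero =>
      rw [← hS 0, Submodule.span_le]
      refine (Set.Subset.trans ?_ Submodule.subset_span)
      exact_mod_cast Finset.subset_biUnion_of_mem S (Finset.mem_range.mpr (by omega))
    | succ j ih =>
      rcases lt_or_ge j t with hj | hj
      · rw [← hS (j + 1), Submodule.span_le]
        refine (Set.Subset.trans ?_ Submodule.subset_span)
        exact_mod_cast Finset.subset_biUnion_of_mem S (Finset.mem_range.mpr (by omega))
      · intro z hz
        refine Submodule.span_le.mpr ?_ (hX j hj z hz)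
        rintro _ ⟨x, hx, w, hw, rfl⟩
        exact W.smul_mem (⟨x, Algebra.subset_adjoin hx⟩ : Algebra.adjoin R X) (ih hw)
  have htop : W = ⊤ := by
    have h1 : (⊤ : Submodule R A) ≤ W.restrictScalars R := hN ▸ iSup_le hle
    exact eq_top_iff.mpr fun z _ => h1 trivial
  have : Module.Finite (Algebra.adjoin R X) A := ⟨⟨T, htop⟩⟩
  exact Algebra.IsIntegral.isIntegral u

/-! ### Regularity modulo `K`, degree by degree -/

section Filtration

variable {R : Type*} [CommRing R]

/-- The ideal `(a₀, …, a_{i-1}) I^(j-1)`, which is zero for `j = 0`. -/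
def initialMulPow (a : ℕ → R) (I : Ideal R) (i : ℕ) : ℕ → Ideal R
  | 0 => ⊥
  | j + 1 => Ideal.span (a '' Set.Iio i) * I ^ j

/-- The image of `a_i` in degree one of `ℛ/Kℛ` is regular modulo the images of the preceding
elements on components of degree `j`. -/
def IsRegularInDegree (a : ℕ → R) (I K : Ideal R) (i j : ℕ) : Prop :=
  ∀ u ∈ I ^ j, a i * u ∈ Ideal.span (a '' Set.Iio i) * I ^ j ⊔ K * I ^ (j + 1) →
    u ∈ initialMulPow a I i j ⊔ K * I ^ j

variable {a : ℕ → R} {I K : Ideal R}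

theorem mem_span_Iio_succ_mul {i : ℕ} {X : Ideal R} {u : R}
    (hu : u ∈ Ideal.span (a '' Set.Iio (i + 1)) * X) :
    ∃ v ∈ Ideal.span (a '' Set.Iio i) * X, ∃ w ∈ X, u = v + a i * w := by
  rw [Ideal.span_image_Iio_succ, Ideal.sup_mul] at hu
  obtain ⟨v, hv, w, hw, rfl⟩ := Submodule.mem_sup.mp hu
  obtain ⟨w, hw', rfl⟩ := Ideal.mem_span_singleton_mul.mp hw
  exact ⟨v, hv, w, hw', rfl⟩

theorem span_Iio_mono (a : ℕ → R) {i j : ℕ} (hij : i ≤ j) :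
    Ideal.span (a '' Set.Iio i) ≤ Ideal.span (a '' Set.Iio j) :=
  Ideal.span_mono (Set.image_mono (Set.Iio_subset_Iio hij))

theorem mul_mem_span_Iio_mul {i m : ℕ} (him : i < m) {X : Ideal R} {u : R} (hu : u ∈ X) :
    a i * u ∈ Ideal.span (a '' Set.Iio m) * X :=
  Ideal.mul_mem_mul (Ideal.subset_span ⟨i, him, rfl⟩) hu

theorem mul_mem_mul_pow_succ (X : Ideal R) {b v : R} {j : ℕ} (hb : b ∈ I) (hv : v ∈ X * I ^ j) :
    b * v ∈ X * I ^ (j + 1) := by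
  rw [pow_succ', ← mul_assoc, mul_comm X I, mul_assoc]
  exact Ideal.mul_mem_mul hb hv

/-- By regularity the coefficient of the last generator splits as `v + k` with `k ∈ K * I ^ j`. The
product of that generator with `v` is absorbed by the earlier generators, to which the induction
applies. -/
theorem span_Iio_mul_inf_le (ha : ∀ s, a s ∈ I) {m j : ℕ}
    (hreg : ∀ i < m, IsRegularInDegree a I K i j) :
    Ideal.span (a '' Set.Iio m) * I ^ j ⊓ K * I ^ (j + 1) ≤
      Ideal.span (a '' Set.Iio m) * (K * I ^ j) := by
  induction m with
  | zero => simp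
  | succ m ih =>
    rintro x ⟨hx1, hx2⟩
    obtain ⟨w, hw, u, hu, rfl⟩ := mem_span_Iio_succ_mul hx1
    have hau : a m * u ∈ Ideal.span (a '' Set.Iio m) * I ^ j ⊔ K * I ^ (j + 1) := by
      have : a m * u = -w + (w + a m * u) := by ring
      rw [this]
      exact add_mem (Ideal.mem_sup_left (neg_mem hw)) (Ideal.mem_sup_right hx2)
    obtain ⟨v, hv, k, hk, rfl⟩ := Submodule.mem_sup.mp (hreg m (by omega) u hu hau)
    have hav : a m * v ∈ Ideal.span (a '' Set.Iio m) * I ^ j := by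
      cases j with
      | zero => rw [show v = 0 from hv, mul_zero]; exact zero_mem _
      | succ j => exact mul_mem_mul_pow_succ _ (ha m) hv
    have hak : a m * k ∈ K * I ^ (j + 1) := mul_mem_mul_pow_succ _ (ha m) hk
    have h1 : w + a m * v ∈ Ideal.span (a '' Set.Iio m) * (K * I ^ j) := by
      refine ih (fun i hi => hreg i (by omega)) ⟨add_mem hw hav, ?_⟩
      have : w + a m * v = w + a m * (v + k) - a m * k := by ring
      rw [this]
      exact sub_mem hx2 hak
    have : w + a m * (v + k) = (w + a m * v) + a m * k := by ring
    rw [this]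
    exact add_mem (Ideal.mul_mono_left (span_Iio_mono a (Nat.le_succ m)) h1)
      (mul_mem_span_Iio_mul (Nat.lt_succ_self m) hk)

variable {l τ : ℕ}

theorem pow_eq_span_mul_pow (hJ : I ^ (τ + 2) = Ideal.span (a '' Set.Iio l) * I ^ (τ + 1)) (e : ℕ) :
    I ^ (τ + e + 2) = Ideal.span (a '' Set.Iio l) * I ^ (τ + e + 1) := by
  rw [show τ + e + 2 = (τ + 2) + e by ring, show τ + e + 1 = (τ + 1) + e by ring, pow_add, hJ,
    mul_assoc, ← pow_add]

/-- Induction on `e`, and for fixed `e` downwards in `i`, starting at `i = l` with the reduction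
equation. In the step, `hC` puts the coefficient `w` of `a i` into `(a_0, …, a_{i-1}) I^τ`, and the
outer induction raises the exponent. -/
theorem span_Iio_mul_pow_inf_pow_le (ha : ∀ s, a s ∈ I)
    (hJ : I ^ (τ + 2) = Ideal.span (a '' Set.Iio l) * I ^ (τ + 1))
    (hC : ∀ i < l, ∀ u ∈ I ^ (τ + 1), a i * u ∈ Ideal.span (a '' Set.Iio i) * I ^ τ →
      u ∈ Ideal.span (a '' Set.Iio i) * I ^ τ) (e : ℕ) {i : ℕ} (hi : i ≤ l) :
    Ideal.span (a '' Set.Iio i) * I ^ τ ⊓ I ^ (τ + e + 1) ≤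
      Ideal.span (a '' Set.Iio i) * I ^ (τ + e) := by
  induction e generalizing i with
  | zero => exact inf_le_left
  | succ e ihe =>
    induction hi using Nat.decreasingInduction with
    | self => exact inf_le_right.trans (pow_eq_span_mul_pow hJ e).le
    | of_succ i hi ih =>
      rintro u ⟨hu1, hu2⟩
      have := ih ⟨Ideal.mul_mono_left (span_Iio_mono a (Nat.le_succ i)) hu1, hu2⟩
      obtain ⟨v, hv, w, hw, rfl⟩ := mem_span_Iio_succ_mul this
      have haw : a i * w ∈ Ideal.span (a '' Set.Iio i) * I ^ τ := by
        rw [← add_sub_cancel_left v (a i * w)]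
        exact sub_mem hu1 (Ideal.mul_mono_right (Ideal.pow_le_pow_right (by omega)) hv)
      have hw' := ihe (i := i) hi.le
        ⟨hC i hi w (Ideal.pow_le_pow_right (by omega) hw) haw, hw⟩
      exact add_mem hv (mul_mem_mul_pow_succ _ (ha i) hw')

/-- Condition (a), given in degree `t = τ + 1`, persists in all higher degrees. -/
theorem mem_span_Iio_mul_pow_of_mul_mem (ha : ∀ s, a s ∈ I)
    (hJ : I ^ (τ + 2) = Ideal.span (a '' Set.Iio l) * I ^ (τ + 1))
    (hC : ∀ i < l, ∀ u ∈ I ^ (τ + 1), a i * u ∈ Ideal.span (a '' Set.Iio i) * I ^ τ →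
      u ∈ Ideal.span (a '' Set.Iio i) * I ^ τ) (e : ℕ) {i : ℕ} (hi : i < l) {u : R}
    (hu : u ∈ I ^ (τ + e + 1)) (hau : a i * u ∈ Ideal.span (a '' Set.Iio i) * I ^ (τ + e + 1)) :
    u ∈ Ideal.span (a '' Set.Iio i) * I ^ (τ + e) :=
  span_Iio_mul_pow_inf_pow_le ha hJ hC e hi.le
    ⟨hC i hi u (Ideal.pow_le_pow_right (by omega) hu)
      (Ideal.mul_mono_right (Ideal.pow_le_pow_right (by omega)) hau), hu⟩

/-- The reduction equation turns the error term in `K * I ^ (τ + e + 2)` into a combination of `a_0,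
…, a_{l-1}` with coefficients in `K * I ^ (τ + e + 1)`. The generators of index above `i` are
removed from the top (`key`). What remains of index `i` is subtracted from `u`, so that condition
(a) applies to the difference. -/
theorem isRegularInDegree_succ (ha : ∀ s, a s ∈ I)
    (hJ : I ^ (τ + 2) = Ideal.span (a '' Set.Iio l) * I ^ (τ + 1))
    (hC : ∀ i < l, ∀ u ∈ I ^ (τ + 1), a i * u ∈ Ideal.span (a '' Set.Iio i) * I ^ τ →
      u ∈ Ideal.span (a '' Set.Iio i) * I ^ τ) (e : ℕ)
    (hreg : ∀ i < l, IsRegularInDegree a I K i (τ + e)) {i : ℕ} (hi : i < l) :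
    IsRegularInDegree a I K i (τ + e + 1) := by
  intro u hu hau
  have key : ∀ m, m ≤ l → i + 1 ≤ m → a i * u ∈ Ideal.span (a '' Set.Iio i) * I ^ (τ + e + 1) ⊔
      Ideal.span (a '' Set.Iio m) * (K * I ^ (τ + e + 1)) := by
    intro m hm
    induction hm using Nat.decreasingInduction with
    | self =>
      intro _
      rwa [pow_eq_span_mul_pow hJ e, ← mul_assoc, mul_comm K, mul_assoc] at hau
    | of_succ m hm ih =>
      intro him
      obtain ⟨v, hv, w, hw, hvw⟩ := Submodule.mem_sup.mp (ih (by omega))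
      obtain ⟨w, hw', z, hz, rfl⟩ := mem_span_Iio_succ_mul hw
      have hKI : K * I ^ (τ + e + 1) ≤ I ^ (τ + e + 1) := Ideal.mul_le_right
      have haz : a m * z ∈ Ideal.span (a '' Set.Iio m) * I ^ (τ + e + 1) := by
        have : a m * z = a i * u - v - w := by rw [← hvw]; ring
        rw [this]
        exact sub_mem (sub_mem (mul_mem_span_Iio_mul (by omega) hu)
          (Ideal.mul_mono_left (span_Iio_mono a (by omega)) hv)) (Ideal.mul_mono_right hKI hw')
      -- Condition (a) rewrites `z` by earlier generators; the intersection lemma, which uses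
      -- regularity one degree lower, keeps the coefficients in `K`.
      have hz1 := mem_span_Iio_mul_pow_of_mul_mem ha hJ hC e hm (hKI hz) haz
      have hz2 := span_Iio_mul_inf_le ha (m := m) (fun i hi => hreg i (by omega)) ⟨hz1, hz⟩
      rw [← mul_assoc] at hz2
      have hz3 := mul_mem_mul_pow_succ _ (ha m) hz2
      rw [mul_assoc] at hz3
      rw [← hvw]
      exact add_mem (Ideal.mem_sup_left hv) (Ideal.mem_sup_right (add_mem hw' hz3))
  obtain ⟨v, hv, w, hw, hvw⟩ := Submodule.mem_sup.mp (key (i + 1) hi le_rfl)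
  obtain ⟨w, hw', z, hz, rfl⟩ := mem_span_Iio_succ_mul hw
  have hKI : K * I ^ (τ + e + 1) ≤ I ^ (τ + e + 1) := Ideal.mul_le_right
  have hmem : a i * (u - z) ∈ Ideal.span (a '' Set.Iio i) * I ^ (τ + e + 1) := by
    have : a i * (u - z) = v + w := by rw [mul_sub, ← hvw]; ring
    rw [this]
    exact add_mem hv (Ideal.mul_mono_right hKI hw')
  have := mem_span_Iio_mul_pow_of_mul_mem ha hJ hC e hi (sub_mem hu (hKI hz)) hmem
  rw [← sub_add_cancel u z]
  exact add_mem (Ideal.mem_sup_left this) (Ideal.mem_sup_right hz)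

theorem isRegularInDegree_of_le (ha : ∀ s, a s ∈ I)
    (hJ : I ^ (τ + 2) = Ideal.span (a '' Set.Iio l) * I ^ (τ + 1))
    (hC : ∀ i < l, ∀ u ∈ I ^ (τ + 1), a i * u ∈ Ideal.span (a '' Set.Iio i) * I ^ τ →
      u ∈ Ideal.span (a '' Set.Iio i) * I ^ τ)
    (hreg : ∀ i < l, ∀ j ≤ τ, IsRegularInDegree a I K i j) (j : ℕ) :
    ∀ i < l, IsRegularInDegree a I K i j := by
  rcases le_total j τ with hj | hj
  · exact fun i hi => hreg i hi j hj
  · obtain ⟨e, rfl⟩ := Nat.exists_eq_add_of_le hj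
    clear hj
    induction e with
    | zero => exact fun i hi => hreg i hi _ le_rfl
    | succ e ih => exact fun i hi => isRegularInDegree_succ ha hJ hC e ih hi

end Filtration

/-! ### The graded ring `ℛ/Kℛ` -/

section Rees

open Polynomial

variable {R : Type u} [CommRing R] (I K : Ideal R)

/-- The inclusion of `I ^ j` into the Rees algebra as its component of degree `j`. -/
noncomputable def reesMonomial (j : ℕ) : (I ^ j : Ideal R) →ₗ[R] reesAlgebra I where
  toFun c := ⟨monomial j (c : R), reesAlgebra.monomial_mem.mpr c.2⟩
  map_add' c d := Subtype.ext (map_add (monomial j) (c : R) (d : R))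
  map_smul' r c := Subtype.ext (map_smul (monomial j) r (c : R))

theorem coe_reesMonomial (j : ℕ) (c : (I ^ j : Ideal R)) :
    (reesMonomial I j c : R[X]) = monomial j (c : R) := rfl

theorem coeff_reesMonomial (j i : ℕ) (c : (I ^ j : Ideal R)) :
    (reesMonomial I j c : R[X]).coeff i = if j = i then (c : R) else 0 := by
  rw [coe_reesMonomial, coeff_monomial]

/-- The projection of the Rees algebra to its homogeneous component of degree `j`. -/
noncomputable def reesComponent (j : ℕ) : reesAlgebra I →+ reesAlgebra I where
  toFun p := reesMonomial I j ⟨(p : R[X]).coeff j, p.2 j⟩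
  map_zero' := Subtype.ext (by rw [coe_reesMonomial]; exact map_zero (monomial j))
  map_add' p q := Subtype.ext (by
    rw [coe_reesMonomial]
    exact (congrArg (monomial j) (coeff_add (p : R[X]) (q : R[X]) j)).trans (map_add _ _ _))

theorem reesComponent_apply (j : ℕ) (p : reesAlgebra I) :
    reesComponent I j p = reesMonomial I j ⟨(p : R[X]).coeff j, p.2 j⟩ := rfl

theorem coeff_reesComponent (j i : ℕ) (p : reesAlgebra I) :
    (reesComponent I j p : R[X]).coeff i = if j = i then (p : R[X]).coeff j else 0 :=
  coeff_reesMonomial I j i _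

theorem sum_reesComponent (p : reesAlgebra I) :
    p = ∑ j ∈ (p : R[X]).support, reesComponent I j p := by
  apply Subtype.ext
  rw [AddSubmonoidClass.coe_finsetSum]
  exact (p : R[X]).as_sum_support

theorem reesAlgebra_ext {p q : reesAlgebra I} (h : ∀ j, (p : R[X]).coeff j = (q : R[X]).coeff j) :
    p = q := Subtype.ext (Polynomial.ext h)

theorem isGradingByComponents_reesComponent : IsGradingByComponents (reesComponent I) where
  eq_zero p hp := by
    rw [sum_reesComponent I p]
    exact Finset.sum_eq_zero fun j _ => hp j
  bounded p := by
    refine ⟨(p : R[X]).natDegree + 1, fun j hj => reesAlgebra_ext I fun i => ?_⟩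
    rw [coeff_reesComponent, coeff_eq_zero_of_natDegree_lt (Nat.lt_of_succ_le hj), ite_self]
    rfl
  comp_one := reesAlgebra_ext I fun i => by
    rw [coeff_reesComponent]
    change (if 0 = i then (1 : R[X]).coeff 0 else 0) = (1 : R[X]).coeff i
    rw [coeff_one, coeff_one]
    by_cases h : i = 0 <;> simp [h, eq_comm]
  comp_self j p := reesAlgebra_ext I fun i => by
    simp only [coeff_reesComponent, if_true]
  comp_of_ne i j p hij := reesAlgebra_ext I fun n => by
    rw [coeff_reesComponent, coeff_reesComponent, if_neg (Ne.symm hij), ite_self]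
    rfl
  comp_mul n p q := by
    apply Subtype.ext
    rw [AddSubmonoidClass.coe_finsetSum]
    change monomial n (((p : R[X]) * (q : R[X])).coeff n) = _
    rw [coeff_mul, map_sum]
    refine Finset.sum_congr rfl fun x hx => ?_
    change _ = monomial x.1 ((p : R[X]).coeff x.1) * monomial x.2 ((q : R[X]).coeff x.2)
    rw [monomial_mul_monomial, Finset.HasAntidiagonal.mem_antidiagonal.mp hx]

theorem mem_map_algebraMap_reesAlgebra_iff (p : reesAlgebra I) :
    p ∈ K.map (algebraMap R (reesAlgebra I)) ↔ ∀ j, (p : R[X]).coeff j ∈ K * I ^ j := by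
  constructor
  · intro hp
    refine Submodule.span_induction (R := reesAlgebra I)
      (p := fun (p : reesAlgebra I) _ => ∀ j, (p : R[X]).coeff j ∈ K * I ^ j) ?_ ?_ ?_ ?_ hp
    · rintro _ ⟨k, hk, rfl⟩ j
      change (algebraMap R R[X] k).coeff j ∈ _
      rw [Polynomial.algebraMap_apply, Algebra.algebraMap_self_apply, coeff_C]
      split_ifs with hj
      · subst hj; simpa using hk
      · exact zero_mem _
    · intro j; exact zero_mem _
    · intro p q _ _ hp hq j
      change ((p : R[X]) + (q : R[X])).coeff j ∈ _
      rw [coeff_add]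
      exact add_mem (hp j) (hq j)
    · intro b p _ hp j
      change ((b : R[X]) * (p : R[X])).coeff j ∈ _
      rw [coeff_mul]
      refine sum_mem ?_
      rintro ⟨m, n⟩ hmn
      rw [Finset.HasAntidiagonal.mem_antidiagonal] at hmn
      simp only at hmn
      rw [← hmn, pow_add, mul_left_comm]
      exact Ideal.mul_mem_mul (b.2 m) (hp n)
  · intro hp
    have key : ∀ j, ∀ c ∈ K * I ^ j, ∀ h : c ∈ I ^ j,
        reesMonomial I j ⟨c, h⟩ ∈ K.map (algebraMap R (reesAlgebra I)) := by
      intro j c hc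
      refine (Submodule.mul_induction_on (C := fun c => c ∈ I ^ j ∧ ∀ h : c ∈ I ^ j,
        reesMonomial I j ⟨c, h⟩ ∈ K.map (algebraMap R (reesAlgebra I))) hc ?_ ?_).2
      · intro k hk b hb
        refine ⟨Ideal.mul_mem_left _ _ hb, fun h => ?_⟩
        have : reesMonomial I j ⟨k • b, h⟩ =
            algebraMap R (reesAlgebra I) k * reesMonomial I j ⟨b, hb⟩ := by
          rw [← Algebra.smul_def, ← map_smul]; rfl
        exact this ▸ Ideal.mul_mem_right _ _ (Ideal.mem_map_of_mem _ hk)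
      · rintro c c' ⟨h, hc⟩ ⟨h', hc'⟩
        refine ⟨add_mem h h', fun _ => ?_⟩
        exact (map_add (reesMonomial I j) ⟨c, h⟩ ⟨c', h'⟩) ▸ add_mem (hc h) (hc' h')
    rw [sum_reesComponent I p]
    exact sum_mem fun j _ => key j _ (hp j) _

/-- The projection of `ℛ/Kℛ` to its homogeneous component of degree `j`. -/
noncomputable def reesQuotientComponent (j : ℕ) :=
  IsGradingByComponents.quotientMap (K.map (algebraMap R (reesAlgebra I))) (reesComponent I j) (by
    intro p hp
    rw [mem_map_algebraMap_reesAlgebra_iff] at hp ⊢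
    intro i
    rw [coeff_reesComponent]
    split_ifs with hij
    · subst hij; exact hp _
    · exact zero_mem _)

theorem reesQuotientComponent_mk (j : ℕ) (p : reesAlgebra I) :
    reesQuotientComponent I K j (Ideal.Quotient.mk _ p) =
      Ideal.Quotient.mk _ (reesComponent I j p) := rfl

theorem isGradingByComponents_reesQuotientComponent :
    IsGradingByComponents (reesQuotientComponent I K) := by
  refine (isGradingByComponents_reesComponent I).quotient
    (fun j u => reesQuotientComponent_mk I K j u) fun p hp => ?_
  rw [sum_reesComponent I p]
  exact sum_mem fun j _ => hp j

variable {I}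

/-- The element of degree one of the Rees algebra given by an element of the ideal. -/
noncomputable def reesDegreeOne (b : R) (hb : b ∈ I) : reesAlgebra I :=
  reesMonomial I 1 ⟨b, by rwa [pow_one]⟩

theorem coe_reesDegreeOne (b : R) (hb : b ∈ I) :
    (reesDegreeOne b hb : R[X]) = monomial 1 b := rfl

theorem coeff_reesDegreeOne_mul (b : R) (hb : b ∈ I) (p : reesAlgebra I) (j : ℕ) :
    (reesDegreeOne b hb * p : reesAlgebra I).1.coeff (j + 1) = b * (p : R[X]).coeff j := by
  change (monomial 1 b * (p : R[X])).coeff (j + 1) = _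
  rw [← C_mul_X_pow_eq_monomial, mul_assoc, coeff_C_mul, pow_one, coeff_X_mul]

theorem reesDegreeOne_mul_reesMonomial (b : R) (hb : b ∈ I) (j : ℕ) (c : (I ^ j : Ideal R))
    (h : b * c ∈ I ^ (j + 1)) :
    reesDegreeOne b hb * reesMonomial I j c = reesMonomial I (j + 1) ⟨b * c, h⟩ := by
  apply Subtype.ext
  change monomial 1 b * monomial j (c : R) = monomial (j + 1) (b * (c : R))
  rw [monomial_mul_monomial, add_comm]

variable {a : ℕ → R} (ha : ∀ s, a s ∈ I)

theorem initialMulPow_le {a : ℕ → R} (ha : ∀ s, a s ∈ I) (i j : ℕ) : initialMulPow a I i j ≤ I ^ j := by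
  cases j with
  | zero => exact bot_le
  | succ j =>
    change Ideal.span (a '' Set.Iio i) * I ^ j ≤ _
    rw [pow_succ']
    exact Ideal.mul_mono_left (Ideal.span_le.mpr (by rintro _ ⟨s, -, rfl⟩; exact ha s))

theorem coeff_mem_initialMulPow (i : ℕ) {q : reesAlgebra I}
    (hq : q ∈ Ideal.span ((fun s => reesDegreeOne (a s) (ha s)) '' Set.Iio i)) (j : ℕ) :
    (q : R[X]).coeff j ∈ initialMulPow a I i j := by
  refine Submodule.span_induction (R := reesAlgebra I)
    (p := fun (q : reesAlgebra I) _ => ∀ j, (q : R[X]).coeff j ∈ initialMulPow a I i j)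
    ?_ (fun j => zero_mem _) ?_ ?_ hq j
  · rintro _ ⟨s, hs, rfl⟩ j
    simp only [coe_reesDegreeOne, coeff_monomial]
    split_ifs with hj
    · subst hj
      simpa [initialMulPow] using Ideal.subset_span (Set.mem_image_of_mem a hs)
    · exact zero_mem _
  · intro p q _ _ hp hq j
    change ((p : R[X]) + (q : R[X])).coeff j ∈ _
    rw [coeff_add]
    exact add_mem (hp j) (hq j)
  · intro b q _ hq j
    change ((b : R[X]) * (q : R[X])).coeff j ∈ _
    rw [coeff_mul]
    refine sum_mem ?_
    rintro ⟨m, n⟩ hmn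
    rw [Finset.HasAntidiagonal.mem_antidiagonal] at hmn
    simp only at hmn ⊢
    subst hmn
    have hn := hq n
    cases n with
    | zero => rw [show (q : R[X]).coeff 0 = 0 from hn, mul_zero]; exact zero_mem _
    | succ n =>
      change _ ∈ Ideal.span (a '' Set.Iio i) * I ^ (m + n)
      rw [pow_add, mul_left_comm]
      exact Ideal.mul_mem_mul (b.2 m) hn

theorem reesMonomial_mem_span (i : ℕ) {j : ℕ} {c : R} (hc : c ∈ initialMulPow a I i j)
    (h : c ∈ I ^ j) : reesMonomial I j ⟨c, h⟩ ∈
      Ideal.span ((fun s => reesDegreeOne (a s) (ha s)) '' Set.Iio i) := by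
  have h0 : ∀ h0 : (0 : R) ∈ I ^ j, reesMonomial I j ⟨0, h0⟩ = 0 := fun h0 =>
    map_zero (reesMonomial I j)
  cases j with
  | zero =>
    have : c = 0 := hc
    subst this
    rw [h0]; exact zero_mem _
  | succ j =>
    change c ∈ Ideal.span (a '' Set.Iio i) * I ^ j at hc
    induction i generalizing c with
    | zero =>
      have : c = 0 := by simpa using hc
      subst this
      rw [h0]; exact zero_mem _
    | succ i ih =>
      obtain ⟨v, hv, w, hw, rfl⟩ := mem_span_Iio_succ_mul hc
      have hv' : v ∈ I ^ (j + 1) := initialMulPow_le ha i (j + 1) hv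
      have hw' : a i * w ∈ I ^ (j + 1) := by
        rw [pow_succ']; exact Ideal.mul_mem_mul (ha i) hw
      have heq : reesMonomial I (j + 1) ⟨v + a i * w, h⟩ =
          reesMonomial I (j + 1) ⟨v, hv'⟩ +
          reesDegreeOne (a i) (ha i) * reesMonomial I j ⟨w, hw⟩ := by
        rw [reesDegreeOne_mul_reesMonomial (a i) (ha i) j ⟨w, hw⟩ hw', ← map_add]
        rfl
      rw [Ideal.span_image_Iio_succ, heq]
      exact Ideal.add_mem _ (Ideal.mem_sup_left (ih hv' hv)) (Ideal.mem_sup_right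
        (Ideal.mul_mem_right _ _ (Ideal.mem_span_singleton_self _)))

theorem mem_span_sup_map_iff (i : ℕ) (q : reesAlgebra I) :
    q ∈ Ideal.span ((fun s => reesDegreeOne (a s) (ha s)) '' Set.Iio i) ⊔
        K.map (algebraMap R (reesAlgebra I)) ↔
      ∀ j, (q : R[X]).coeff j ∈ initialMulPow a I i j ⊔ K * I ^ j := by
  constructor
  · intro hq j
    obtain ⟨q₁, h₁, q₂, h₂, rfl⟩ := Submodule.mem_sup.mp hq
    change ((q₁ : R[X]) + (q₂ : R[X])).coeff j ∈ _
    rw [coeff_add]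
    exact add_mem (Ideal.mem_sup_left (coeff_mem_initialMulPow ha i h₁ j))
      (Ideal.mem_sup_right ((mem_map_algebraMap_reesAlgebra_iff I K q₂).mp h₂ j))
  · intro hq
    rw [sum_reesComponent I q]
    refine sum_mem fun j _ => ?_
    obtain ⟨c, hc, k, hk, hck⟩ := Submodule.mem_sup.mp (hq j)
    have hk' : k ∈ I ^ j := Ideal.mul_le_right hk
    have hc' : c ∈ I ^ j := initialMulPow_le ha i j hc
    have heq : reesComponent I j q = reesMonomial I j ⟨c, hc'⟩ + reesMonomial I j ⟨k, hk'⟩ := by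
      rw [reesComponent_apply, ← map_add]
      congr 1
      exact Subtype.ext hck.symm
    rw [heq]
    refine add_mem (Ideal.mem_sup_left (reesMonomial_mem_span ha i hc hc'))
      (Ideal.mem_sup_right ?_)
    rw [mem_map_algebraMap_reesAlgebra_iff]
    intro i
    rw [coeff_reesMonomial]
    split_ifs with hij
    · subst hij; exact hk
    · exact zero_mem _

theorem Ideal.Quotient.mk_mem_span_image_iff {A ι : Type*} [CommRing A] (N : Ideal A) (x : ι → A)
    (S : Set ι) (q : A) :
    Ideal.Quotient.mk N q ∈ Ideal.span ((fun s => Ideal.Quotient.mk N (x s)) '' S) ↔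
      q ∈ Ideal.span (x '' S) ⊔ N := by
  have : (fun s => Ideal.Quotient.mk N (x s)) '' S = Ideal.Quotient.mk N '' (x '' S) := by
    rw [Set.image_image]
  rw [this, ← Ideal.map_span, ← Ideal.mem_comap,
    Ideal.comap_map_of_surjective _ Ideal.Quotient.mk_surjective, ← RingHom.ker_eq_comap_bot,
    Ideal.mk_ker]

/-- The ideals involved are homogeneous, so membership is tested on coefficients, and multiplication
by a degree-one element only shifts them. -/
theorem isRegularUpTo_reesQuotient {l : ℕ}
    (hreg : ∀ j, ∀ i < l, IsRegularInDegree a I K i j) :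
    IsRegularUpTo (fun s => (Ideal.Quotient.mk _ (reesDegreeOne (a s) (ha s)) :
      ReesQuotient I K)) l := by
  intro i hi u hu
  obtain ⟨p, rfl⟩ := Ideal.Quotient.mk_surjective u
  rw [← map_mul, Ideal.Quotient.mk_mem_span_image_iff, mem_span_sup_map_iff] at hu
  rw [Ideal.Quotient.mk_mem_span_image_iff, mem_span_sup_map_iff]
  intro j
  have := hu (j + 1)
  rw [coeff_reesDegreeOne_mul] at this
  exact hreg j i hi _ (p.2 j) this

/-- From degree `t` on, each component is obtained from the preceding one by multiplying with the
classes of the `a s`; this is the reduction equation multiplied by powers of `I`. -/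
theorem isIntegral_reesQuotient [IsNoetherianRing R] {l t : ℕ}
    (hJ : I ^ (t + 1) = Ideal.span (a '' Set.Iio l) * I ^ t) :
    IsIntegralOverAdjoin R ((fun s => (Ideal.Quotient.mk _ (reesDegreeOne (a s) (ha s)) :
      ReesQuotient I K)) '' Set.Iio l) := by
  have hpow : ∀ e, I ^ (t + e + 1) = Ideal.span (a '' Set.Iio l) * I ^ (t + e) := fun e => by
    rw [show t + e + 1 = (t + 1) + e by ring, pow_add, hJ, mul_assoc, ← pow_add]
  let π := Ideal.Quotient.mkₐ R (K.map (algebraMap R (reesAlgebra I)))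
  have key : ∀ e, ∀ m ≤ l, ∀ c, c ∈ Ideal.span (a '' Set.Iio m) * I ^ (t + e) →
      ∀ h : c ∈ I ^ (t + e + 1), π (reesMonomial I (t + e + 1) ⟨c, h⟩) ∈
        Submodule.span R {y | ∃ x ∈ ((fun s => (Ideal.Quotient.mk _ (reesDegreeOne (a s) (ha s)) :
          ReesQuotient I K)) '' Set.Iio l),
          ∃ w ∈ LinearMap.range (π.toLinearMap ∘ₗ reesMonomial I (t + e)), y = x * w} := by
    intro e m
    induction m with
    | zero =>
      intro _ c hc h
      have : c = 0 := by simpa using hc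
      subst this
      have h0 : reesMonomial I (t + e + 1) ⟨0, h⟩ = 0 := map_zero (reesMonomial I (t + e + 1))
      rw [h0, map_zero]; exact zero_mem _
    | succ m ihm =>
      intro hm c hc h
      obtain ⟨v, hv, w, hw, rfl⟩ := mem_span_Iio_succ_mul hc
      have hv' : v ∈ I ^ (t + e + 1) := initialMulPow_le ha m (t + e + 1) hv
      have hw' : a m * w ∈ I ^ (t + e + 1) := by
        rw [pow_succ']; exact Ideal.mul_mem_mul (ha m) hw
      have heq : reesMonomial I (t + e + 1) ⟨v + a m * w, h⟩ =
          reesMonomial I (t + e + 1) ⟨v, hv'⟩ +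
          reesDegreeOne (a m) (ha m) * reesMonomial I (t + e) ⟨w, hw⟩ := by
        rw [reesDegreeOne_mul_reesMonomial (a m) (ha m) (t + e) ⟨w, hw⟩ hw', ← map_add]
        rfl
      rw [heq, map_add, map_mul]
      exact add_mem (ihm (by omega) v hv hv') (Submodule.subset_span
        ⟨_, ⟨m, by simpa using hm, rfl⟩, _, ⟨⟨w, hw⟩, rfl⟩, rfl⟩)
  refine isIntegral_adjoin_of_graded (t := t)
    (N := fun j => LinearMap.range (π.toLinearMap ∘ₗ reesMonomial I j)) (fun j => ?_) ?_ ?_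
  · rw [LinearMap.range_eq_map]
    exact (IsNoetherian.noetherian (⊤ : Submodule R (I ^ j : Ideal R))).map _
  · rw [eq_top_iff]
    rintro z -
    obtain ⟨p, rfl⟩ := Ideal.Quotient.mk_surjective z
    change π p ∈ _
    rw [sum_reesComponent I p, map_sum]
    exact sum_mem fun j _ => Submodule.mem_iSup_of_mem j ⟨_, rfl⟩
  · rintro j hj _ ⟨⟨c, hc⟩, rfl⟩
    obtain ⟨e, rfl⟩ := Nat.exists_eq_add_of_le hj
    exact key e l le_rfl c (hpow e ▸ hc) hc

/-- The Cohen-Macaulay property of `ℛ/Kℛ` follows from regularity in each degree. -/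
theorem isCohenMacaulay_reesQuotient [IsLocalRing R] [IsNoetherianRing R] (ha : ∀ s, a s ∈ I)
    {l t : ℕ} (hJ : I ^ (t + 1) = Ideal.span (a '' Set.Iio l) * I ^ t)
    (hK : maximalIdeal R ≤ K.radical)
    (hreg : ∀ j, ∀ i < l, IsRegularInDegree a I K i j) : IsCohenMacaulay (ReesQuotient I K) := by
  refine isCohenMacaulay_of_isRegularUpTo (R := R)
    (isGradingByComponents_reesQuotientComponent I K) (fun r => ?_) (fun s => ?_)
    (isRegularUpTo_reesQuotient K ha hreg) (isIntegral_reesQuotient K ha hJ) fun r hr => ?_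
  · change reesQuotientComponent I K 0 (Ideal.Quotient.mk _ (algebraMap R (reesAlgebra I) r)) =
      Ideal.Quotient.mk _ (algebraMap R (reesAlgebra I) r)
    rw [reesQuotientComponent_mk]
    congr 1
    refine reesAlgebra_ext I fun i => ?_
    rw [coeff_reesComponent]
    change (if 0 = i then (C r).coeff 0 else 0) = (C r).coeff i
    rw [coeff_C, coeff_C]
    by_cases h : i = 0 <;> simp [h, eq_comm]
  · rw [reesQuotientComponent_mk]
    congr 1
    refine reesAlgebra_ext I fun i => ?_
    rw [coeff_reesComponent, coe_reesDegreeOne, coeff_monomial, coeff_monomial]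
    simp
  · obtain ⟨N, hN⟩ := hK hr
    refine ⟨N, ?_⟩
    rw [← map_pow]
    exact Ideal.Quotient.eq_zero_iff_mem.mpr (Ideal.mem_map_of_mem (algebraMap R (reesAlgebra I)) hN)

end Rees

/-! ### Linear forms and linear changes of coordinates -/

open MvPolynomial in
/-- The linear form with the given coefficients. -/
noncomputable def linearForm {A : Type*} [CommRing A] {n : ℕ} :
    (Fin n → A) →ₗ[A] MvPolynomial (Fin n) A where
  toFun c := ∑ j, c j • X j
  map_add' c d := by simp [add_smul, Finset.sum_add_distrib]
  map_smul' r c := by simp [Finset.smul_sum, mul_smul]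

section LinearForms

open MvPolynomial

variable {A : Type*} [CommRing A] {n : ℕ}

theorem linearForm_apply (c : Fin n → A) : linearForm c = ∑ j, c j • X j := rfl

theorem isHomogeneous_linearForm (c : Fin n → A) : (linearForm c).IsHomogeneous 1 :=
  MvPolynomial.IsHomogeneous.sum _ _ _ fun j _ => by
    rw [smul_eq_C_mul]; exact (isHomogeneous_X A j).C_mul _

theorem constantCoeff_linearForm (c : Fin n → A) : constantCoeff (linearForm c) = 0 := by
  simp [linearForm_apply, map_sum, smul_eq_C_mul]

/-- The linear forms whose coefficients are the rows of a matrix. -/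
noncomputable def rowForm (M : Matrix (Fin n) (Fin n) A) (s : ℕ) : MvPolynomial (Fin n) A :=
  if h : s < n then linearForm (M ⟨s, h⟩) else 0

theorem rowForm_coe (M : Matrix (Fin n) (Fin n) A) (s : Fin n) :
    rowForm M s = linearForm (M s) := by
  simp [rowForm]

variable {M D : Matrix (Fin n) (Fin n) A}

theorem sum_smul_rowForm (hDM : D * M = 1) (j : Fin n) :
    ∑ s, D j s • linearForm (M s) = X j := by
  have : ∀ s, D j s • linearForm (M s) = linearForm (D j s • M s) := fun s => (map_smul _ _ _).symm
  simp only [this, ← map_sum]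
  have h1 : ∑ s, D j s • M s = (1 : Matrix (Fin n) (Fin n) A) j := by
    rw [← hDM]
    funext q
    simp [Matrix.mul_apply]
  rw [h1, linearForm_apply, Finset.sum_eq_single j]
  · simp
  · intro b _ hb
    simp [Matrix.one_apply_ne (Ne.symm hb)]
  · simp

/-- The endomorphism of the polynomial ring that sends the first `i` row forms of `M` to zero and
fixes the others, where `D` is the inverse of `M`. -/
noncomputable def killForms (M D : Matrix (Fin n) (Fin n) A) (i : ℕ) :
    MvPolynomial (Fin n) A →ₐ[A] MvPolynomial (Fin n) A :=
  aeval fun j => ∑ s : Fin n, if i ≤ (s : ℕ) then D j s • linearForm (M s) else 0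

theorem killForms_linearForm (hMD : M * D = 1) (i : ℕ) (q : Fin n) :
    killForms M D i (linearForm (M q)) = if i ≤ (q : ℕ) then linearForm (M q) else 0 := by
  rw [linearForm_apply (M q), map_sum]
  simp only [map_smul, killForms, aeval_X, Finset.smul_sum, smul_ite, smul_zero, smul_smul]
  rw [Finset.sum_comm]
  have : ∀ s : Fin n, (∑ j, if i ≤ (s : ℕ) then (M q j * D j s) • linearForm (M s) else 0) =
      if i ≤ (s : ℕ) then (1 : Matrix (Fin n) (Fin n) A) q s • linearForm (M s) else 0 := by
    intro s
    split_ifs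
    · rw [← Finset.sum_smul, ← hMD, Matrix.mul_apply]
    · simp
  simp only [this]
  rw [Finset.sum_eq_single q]
  · simp [linearForm_apply]
  · intro b _ hb
    rw [Matrix.one_apply_ne (Ne.symm hb), zero_smul, ite_self]
  · simp

theorem killForms_rowForm_of_le (hMD : M * D = 1) {i q : ℕ} (hq : i ≤ q) :
    killForms M D i (rowForm M q) = rowForm M q := by
  by_cases h : q < n
  · rw [show q = ((⟨q, h⟩ : Fin n) : ℕ) from rfl, rowForm_coe, killForms_linearForm hMD, if_pos hq]
  · simp [rowForm, h]

theorem killForms_rowForm_of_lt (hMD : M * D = 1) {i q : ℕ} (hq : q < i) :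
    killForms M D i (rowForm M q) = 0 := by
  by_cases h : q < n
  · rw [show q = ((⟨q, h⟩ : Fin n) : ℕ) from rfl, rowForm_coe, killForms_linearForm hMD,
      if_neg (by simpa using hq)]
  · simp [rowForm, h]

/-- With `killForms_eq_zero_of_mem`, this identifies the kernel of `killForms M D i`: reduction
modulo the first `i` forms becomes an endomorphism of the polynomial ring, where unique
factorization stays available. -/
theorem sub_killForms_mem (hDM : D * M = 1) (i : ℕ) (u : MvPolynomial (Fin n) A) :
    u - killForms M D i u ∈ Ideal.span (rowForm M '' Set.Iio i) := by
  rw [← Ideal.Quotient.mk_eq_mk_iff_sub_mem]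
  have : (Ideal.Quotient.mkₐ A (Ideal.span (rowForm M '' Set.Iio i))) =
      (Ideal.Quotient.mkₐ A (Ideal.span (rowForm M '' Set.Iio i))).comp (killForms M D i) := by
    refine MvPolynomial.algHom_ext fun j => ?_
    simp only [AlgHom.comp_apply, killForms, aeval_X, Ideal.Quotient.mkₐ_eq_mk]
    rw [Ideal.Quotient.mk_eq_mk_iff_sub_mem]
    nth_rw 1 [← sum_smul_rowForm hDM j]
    rw [← Finset.sum_sub_distrib]
    refine sum_mem fun s _ => ?_
    split_ifs with h
    · rw [sub_self]; exact zero_mem _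
    · rw [sub_zero, smul_eq_C_mul]
      refine Ideal.mul_mem_left _ _ (Ideal.subset_span ⟨s, by simpa using h, rowForm_coe M s⟩)
  exact AlgHom.congr_fun this u

theorem killForms_eq_zero_of_mem (hMD : M * D = 1) {i : ℕ} {u : MvPolynomial (Fin n) A}
    (hu : u ∈ Ideal.span (rowForm M '' Set.Iio i)) : killForms M D i u = 0 := by
  have : Ideal.span (rowForm M '' Set.Iio i) ≤ RingHom.ker (killForms M D i) := by
    rw [Ideal.span_le]
    rintro _ ⟨q, hq, rfl⟩
    exact killForms_rowForm_of_lt hMD hq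
  exact this hu

theorem isHomogeneous_killForms {i d : ℕ} {u : MvPolynomial (Fin n) A} (hu : u.IsHomogeneous d) :
    (killForms M D i u).IsHomogeneous d := by
  have := hu.aeval (n := 1) (fun j => ∑ s : Fin n, if i ≤ (s : ℕ) then D j s • linearForm (M s) else 0)
    fun j => MvPolynomial.IsHomogeneous.sum _ _ _ fun s _ => by
      split_ifs
      · rw [smul_eq_C_mul]; exact (isHomogeneous_linearForm _).C_mul _
      · exact isHomogeneous_zero _ _ _
  rwa [one_mul] at this

/-- The coordinate change given by `D` carries the form to a variable, which is a nonzerodivisor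
over any coefficient ring. -/
theorem eq_zero_of_rowForm_mul_eq_zero (hMD : M * D = 1) (hDM : D * M = 1) {i : ℕ} (hi : i < n)
    {u : MvPolynomial (Fin n) A} (hu : rowForm M i * u = 0) : u = 0 := by
  let φ : MvPolynomial (Fin n) A →ₐ[A] MvPolynomial (Fin n) A := aeval fun s => linearForm (M s)
  let ψ : MvPolynomial (Fin n) A →ₐ[A] MvPolynomial (Fin n) A := aeval fun j => linearForm (D j)
  have h1 : φ.comp ψ = AlgHom.id A _ := by
    refine MvPolynomial.algHom_ext fun j => ?_
    simp only [φ, ψ, AlgHom.comp_apply, aeval_X, AlgHom.id_apply]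
    rw [linearForm_apply (D j), map_sum]
    simp only [map_smul, aeval_X]
    exact sum_smul_rowForm hDM j
  have h2 : ψ (linearForm (M ⟨i, hi⟩)) = X ⟨i, hi⟩ := by
    rw [linearForm_apply, map_sum]
    simp only [ψ, map_smul, aeval_X]
    exact sum_smul_rowForm hMD ⟨i, hi⟩
  have h3 : X ⟨i, hi⟩ * ψ u = 0 := by
    rw [← h2, ← map_mul, show linearForm (M ⟨i, hi⟩) = rowForm M i by simp [rowForm, hi], hu,
      map_zero]
  have h4 : ψ u = 0 := by
    have := (MvPolynomial.isRegular_X (R := A) (n := (⟨i, hi⟩ : Fin n))).left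
    exact this (h3.trans (mul_zero _).symm)
  rw [← AlgHom.id_apply (R := A) u, ← h1, AlgHom.comp_apply, h4, map_zero]

theorem isRegularUpTo_rowForm (hMD : M * D = 1) (hDM : D * M = 1) :
    IsRegularUpTo (rowForm M) n := by
  intro i hi u hu
  have h0 := killForms_eq_zero_of_mem hMD hu
  rw [map_mul, killForms_rowForm_of_le hMD le_rfl] at h0
  have := sub_killForms_mem hDM i u
  rwa [eq_zero_of_rowForm_mul_eq_zero hMD hDM hi h0, sub_zero] at this

end LinearForms

/-! ### Two relations with a common factor -/

section CompleteIntersection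

open MvPolynomial

variable {k : Type*} [Field k] {n : ℕ} {M D : Matrix (Fin n) (Fin n) k}

/-- Coprimality makes `b` divide `x`, so all syzygies are Koszul. For `b = 0` the quotient is not
determined, but then `a` is a unit. -/
theorem IsRelPrime.exists_syzygy {A : Type*} [CommRing A] [IsDomain A] [DecompositionMonoid A]
    {a b x y : A} (hab : IsRelPrime a b) (h : x * a + y * b = 0) :
    ∃ z, x = z * b ∧ y = -(z * a) := by
  have hdvd : b ∣ a * x := ⟨-y, by linear_combination h⟩
  obtain ⟨z, hz⟩ := hab.symm.dvd_of_dvd_mul_left hdvd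
  by_cases hb : b = 0
  · subst hb
    rw [isRelPrime_zero_right] at hab
    obtain ⟨a', ha'⟩ := hab.exists_right_inv
    refine ⟨-(y * a'), by rw [hz]; ring, by linear_combination (-y) * ha'⟩
  · refine ⟨z, by rw [hz]; ring, mul_left_cancel₀ hb ?_⟩
    rw [hz] at h
    linear_combination h

/-- Linear forms remain regular modulo a pair of forms with a common factor, as long as the
coprime cofactors remain coprime, and the common factor nonzero, modulo the linear forms. -/
theorem mem_of_rowForm_mul_mem (hMD : M * D = 1) (hDM : D * M = 1) {i : ℕ} (hi : i < n)
    {d g h : MvPolynomial (Fin n) k} (hd : killForms M D (i + 1) d ≠ 0)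
    (hgh : IsRelPrime (killForms M D (i + 1) g) (killForms M D (i + 1) h))
    {u : MvPolynomial (Fin n) k}
    (hu : rowForm M i * u ∈ Ideal.span (rowForm M '' Set.Iio i) ⊔ Ideal.span {d * g, d * h}) :
    u ∈ Ideal.span (rowForm M '' Set.Iio i) ⊔ Ideal.span {d * g, d * h} := by
  set κ := killForms M D (i + 1) with hκ
  set N := Ideal.span (rowForm M '' Set.Iio i) with hN
  obtain ⟨ν, hν, w, hw, hsum⟩ := Submodule.mem_sup.mp hu
  obtain ⟨α, β, hw⟩ := Ideal.mem_span_pair.mp hw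
  have hκν : κ ν = 0 := killForms_eq_zero_of_mem hMD (span_Iio_mono _ (Nat.le_succ i) hν)
  -- Modulo the first `i + 1` forms the left side of `hsum` vanishes up to sign conventions, and the
  -- nonzero image of `d` cancels.
  have h0 : κ α * κ g + κ β * κ h = 0 := by
    refine mul_left_cancel₀ hd ?_
    have := congrArg κ hsum
    rw [← hw, map_mul, killForms_rowForm_of_lt hMD (Nat.lt_succ_self i), map_add, hκν] at this
    simp only [map_add, map_mul] at this
    linear_combination this
  obtain ⟨γ, h1, h2⟩ := hgh.exists_syzygy h0
  have hmem : ∀ v : MvPolynomial (Fin n) k, ∃ ν' ∈ N, ∃ v', v = κ v + ν' + v' * rowForm M i := by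
    intro v
    have := sub_killForms_mem hDM (i + 1) v
    rw [Ideal.span_image_Iio_succ] at this
    obtain ⟨ν', hν', y, hy, hvy⟩ := Submodule.mem_sup.mp this
    obtain ⟨v', rfl⟩ := Ideal.mem_span_singleton'.mp hy
    exact ⟨ν', hν', v', by linear_combination -hvy⟩
  obtain ⟨ν₁, hν₁, α', hα⟩ := hmem α
  obtain ⟨ν₂, hν₂, β', hβ⟩ := hmem β
  obtain ⟨ν₃, hν₃, g', hg⟩ := hmem g
  obtain ⟨ν₄, hν₄, h', hh⟩ := hmem h
  rw [h1] at hα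
  rw [h2] at hβ
  -- The Koszul syzygy with factor `γ` lifts to `g, h`. Subtracting it leaves coefficients that are
  -- multiples of `rowForm M i` modulo `N`, so that form can be cancelled using its regularity
  -- modulo `N`.
  have hkey : rowForm M i * (u - ((α' - γ * h') * (d * g) + (β' + γ * g') * (d * h))) ∈ N := by
    have : rowForm M i * (u - ((α' - γ * h') * (d * g) + (β' + γ * g') * (d * h))) =
        ν + ((d * g) * (ν₁ - γ * ν₄) + (d * h) * (ν₂ + γ * ν₃)) := by
      linear_combination -hsum - hw + d * g * hα + d * h * hβ - γ * d * g * hh + γ * d * h * hg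
    rw [this]
    exact add_mem hν (add_mem (N.mul_mem_left _ (sub_mem hν₁ (N.mul_mem_left _ hν₄)))
      (N.mul_mem_left _ (add_mem hν₂ (N.mul_mem_left _ hν₃))))
  have := isRegularUpTo_rowForm hMD hDM i hi _ hkey
  rw [← sub_add_cancel u ((α' - γ * h') * (d * g) + (β' + γ * g') * (d * h))]
  exact add_mem (Ideal.mem_sup_left this)
    (Ideal.mem_sup_right (Ideal.mem_span_pair.mpr ⟨_, _, rfl⟩))

end CompleteIntersection

/-! ### Dimension and linear forms -/

section Dimension

/-- Adding an element outside all minimal primes of an ideal lowers the dimension of the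
quotient. -/
theorem ringKrullDim_quotient_sup_span_succ_le {S : Type*} [CommRing S] (E : Ideal S) {x : S}
    (hx : ∀ p ∈ E.minimalPrimes, x ∉ p) :
    ringKrullDim (S ⧸ E ⊔ Ideal.span {x}) + 1 ≤ ringKrullDim (S ⧸ E) := by
  by_cases htop : E ⊔ Ideal.span {x} = ⊤
  · rw [htop, ringKrullDim_eq_bot_of_subsingleton]
    simp
  have h1 : Nonempty (PrimeSpectrum.zeroLocus (R := S) (E ⊔ Ideal.span {x} : Ideal S)) := by
    rwa [Set.nonempty_coe_sort, Set.nonempty_iff_ne_empty, ne_eq,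
      PrimeSpectrum.zeroLocus_empty_iff_eq_top]
  have h2 : Nonempty (PrimeSpectrum.zeroLocus (R := S) E) := by
    obtain ⟨p, hp⟩ := h1
    exact ⟨p, fun z hz => hp (Ideal.mem_sup_left hz)⟩
  rw [ringKrullDim_quotient, Order.krullDim_eq_iSup_length, ringKrullDim_quotient,
    Order.krullDim_eq_iSup_length, ← WithBot.coe_one, ← WithBot.coe_add,
    ENat.iSup_add, WithBot.coe_le_coe, iSup_le_iff]
  intro l
  have hl : ∀ p : PrimeSpectrum.zeroLocus (R := S) (E ⊔ Ideal.span {x} : Ideal S),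
      p.1 ∈ PrimeSpectrum.zeroLocus (R := S) E := fun p z hz => p.2 (Ideal.mem_sup_left hz)
  obtain ⟨p, hp, hp'⟩ := Ideal.exists_minimalPrimes_le (I := E) (J := l.head.1.asIdeal) (hl l.head)
  let p' : PrimeSpectrum.zeroLocus (R := S) E := ⟨⟨p, hp.1.1⟩, hp.1.2⟩
  let q : LTSeries (PrimeSpectrum.zeroLocus (R := S) E) :=
    l.map (fun p => ⟨p.1, hl p⟩) (fun _ _ h => h)
  have hlt : p' < q.head := lt_of_le_of_ne hp' fun h => hx p hp (by
    have : p = l.head.1.asIdeal := congrArg (fun z => z.1.asIdeal) h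
    rw [this]
    exact l.head.2 (Ideal.mem_sup_right (Ideal.mem_span_singleton_self x)))
  refine le_trans ?_ (le_iSup _ (q.cons p' hlt))
  simp only [Nat.cast_add, Nat.cast_one, RelSeries.cons_length]
  exact le_rfl

theorem WithBot.le_natCast_of_add_one_le {d : WithBot ℕ∞} {m : ℕ} (h : d + 1 ≤ (m + 1 : ℕ)) :
    d ≤ m := by
  induction d using WithBot.recBotCoe with
  | bot => exact bot_le
  | coe d =>
    have h1 : d + 1 ≤ ((m + 1 : ℕ) : ℕ∞) := by exact_mod_cast h
    have h2 : d ≤ (m : ℕ∞) := by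
      rw [Nat.cast_succ] at h1
      exact (ENat.add_le_add_iff_right ENat.one_ne_top).mp h1
    exact_mod_cast h2

end Dimension

/-! ### Homogeneous ideals and Noether normalization -/

section Graded

open MvPolynomial

variable {k : Type*} [Field k] {n : ℕ}

theorem mem_idealOfVars_iff {p : MvPolynomial (Fin n) k} :
    p ∈ idealOfVars (Fin n) k ↔ constantCoeff p = 0 := by
  have := mem_pow_idealOfVars_iff' (σ := Fin n) (R := k) 1 p
  rw [pow_one] at this
  rw [this]
  constructor
  · intro h; exact h 0 (by simp)
  · intro h x hx
    have : x = 0 := by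
      rw [Nat.lt_one_iff, Finsupp.degree_eq_zero_iff] at hx
      exact hx
    rw [this]; exact h

theorem idealOfVars_eq_ker : idealOfVars (Fin n) k = RingHom.ker (constantCoeff (R := k)) := by
  ext p
  rw [mem_idealOfVars_iff, RingHom.mem_ker]

instance isMaximal_idealOfVars : (idealOfVars (Fin n) k).IsMaximal := by
  rw [idealOfVars_eq_ker]
  exact RingHom.ker_isMaximal_of_surjective _ fun c => ⟨C c, constantCoeff_C _ c⟩

/-- The variables, as row forms of the identity matrix, are a regular sequence of length `n` in the
localization at the origin. -/
theorem le_height_idealOfVars : (n : ℕ∞) ≤ (idealOfVars (Fin n) k).height := by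
  have hreg : IsRegularUpTo (rowForm (1 : Matrix (Fin n) (Fin n) k)) n :=
    isRegularUpTo_rowForm (mul_one 1) (mul_one 1)
  have hmem : ∀ r ∈ (List.range n).map (rowForm (1 : Matrix (Fin n) (Fin n) k)),
      r ∈ idealOfVars (Fin n) k := by
    intro r hr
    obtain ⟨s, hs, rfl⟩ := List.mem_map.mp hr
    rw [mem_idealOfVars_iff]
    unfold rowForm
    split_ifs
    · exact constantCoeff_linearForm _
    · exact map_zero _
  have h1 := (isRegularUpTo_iff.mp hreg).isRegular_of_isLocalization_of_mem
    (Localization.AtPrime (idealOfVars (Fin n) k)) _ hmem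
  have h2 := ringKrullDim_add_length_eq_ringKrullDim_of_isRegular _ h1
  rw [IsLocalization.AtPrime.ringKrullDim_eq_height (idealOfVars (Fin n) k)
    (Localization.AtPrime (idealOfVars (Fin n) k))] at h2
  simp only [List.length_map, List.length_range] at h2
  have h3 : (n : WithBot ℕ∞) ≤ (idealOfVars (Fin n) k).height := by
    rw [← h2]
    refine le_add_of_nonneg_left ?_
    have : Nontrivial (Localization.AtPrime (idealOfVars (Fin n) k) ⧸ Ideal.ofList
        (((List.range n).map (rowForm (1 : Matrix (Fin n) (Fin n) k))).map (algebraMap _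
          (Localization.AtPrime (idealOfVars (Fin n) k))))) :=
      Ideal.Quotient.nontrivial_iff.mpr fun h0 => h1.top_ne_smul (by rw [h0]; simp)
    exact ringKrullDim_nonneg_of_nontrivial
  exact_mod_cast h3

/-- Fewer than `n` elements of the ideal of the `n` variables do not generate it up to radical. -/
theorem not_idealOfVars_le_radical_span {T : Set (MvPolynomial (Fin n) k)} (hT : T.Finite)
    (hT0 : ∀ f ∈ T, constantCoeff f = 0) (hcard : T.ncard < n) :
    ¬ idealOfVars (Fin n) k ≤ (Ideal.span T).radical := by
  intro hle
  have hmin : idealOfVars (Fin n) k ∈ (Ideal.span T).minimalPrimes := by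
    refine ⟨⟨inferInstance, Ideal.span_le.mpr fun f hf => mem_idealOfVars_iff.mpr (hT0 f hf)⟩, ?_⟩
    rintro q ⟨hq, hTq⟩ _
    exact hle.trans (hq.radical_le_iff.mpr hTq)
  have := le_height_idealOfVars.trans (Ideal.height_le_card_of_mem_minimalPrimes_span hT hmin)
  exact absurd (Nat.cast_le.mp this) (by omega)

theorem idealOfVars_pow_le {E : Ideal (MvPolynomial (Fin n) k)}
    (h : idealOfVars (Fin n) k ≤ E.radical) : ∃ N, idealOfVars (Fin n) k ^ N ≤ E :=
  Ideal.exists_pow_le_of_le_radical_of_fg h (idealOfVars_fg _ _)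

attribute [local instance] MvPolynomial.gradedAlgebra

/-- Minimal primes of homogeneous ideals are contained in the ideal of the variables. -/
theorem le_idealOfVars_of_mem_minimalPrimes {E p : Ideal (MvPolynomial (Fin n) k)}
    (hE : E.IsHomogeneous (homogeneousSubmodule (Fin n) k)) (hp : p ∈ E.minimalPrimes) :
    p ≤ idealOfVars (Fin n) k := by
  have hpp : p.IsPrime := hp.1.1
  have hcore := hpp.homogeneousCore (𝒜 := homogeneousSubmodule (Fin n) k)
  have hle := Ideal.toIdeal_homogeneousCore_le (homogeneousSubmodule (Fin n) k) p
  have hE' : E ≤ (p.homogeneousCore (homogeneousSubmodule (Fin n) k)).toIdeal := by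
    rw [← hE.toIdeal_homogeneousCore_eq_self]
    exact Ideal.homogeneousCore_mono _ hp.1.2
  have hpeq : (p.homogeneousCore (homogeneousSubmodule (Fin n) k)).toIdeal = p :=
    le_antisymm hle (hp.2 ⟨hcore, hE'⟩ hle)
  have hhom : p.IsHomogeneous (homogeneousSubmodule (Fin n) k) := by
    rw [← hpeq]; exact HomogeneousIdeal.isHomogeneous _
  intro f hf
  rw [mem_idealOfVars_iff]
  by_contra h0
  have h1 := homogeneousComponent_mem_of_mem hhom hf 0
  rw [homogeneousComponent_zero] at h1
  refine hpp.ne_top (Ideal.eq_top_of_isUnit_mem _ h1 ?_)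
  exact (isUnit_iff_ne_zero.mpr h0).map C

theorem isHomogeneous_span {T : Set (MvPolynomial (Fin n) k)}
    (hT : ∀ f ∈ T, ∃ d, f.IsHomogeneous d) :
    (Ideal.span T).IsHomogeneous (homogeneousSubmodule (Fin n) k) :=
  Ideal.homogeneous_span _ _ fun f hf => by
    obtain ⟨d, hd⟩ := hT f hf
    exact ⟨d, hd⟩

/-- All minimal primes of `E` lie in the ideal of the variables; once that ideal is itself minimal
over `E`, it is the only one. -/
theorem idealOfVars_le_radical {E p : Ideal (MvPolynomial (Fin n) k)}
    (hE : E.IsHomogeneous (homogeneousSubmodule (Fin n) k)) (hp : p ∈ E.minimalPrimes)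
    (hle : idealOfVars (Fin n) k ≤ p) : idealOfVars (Fin n) k ≤ E.radical := by
  rw [← Ideal.sInf_minimalPrimes]
  refine le_sInf fun q hq => ?_
  have hpv := le_antisymm (le_idealOfVars_of_mem_minimalPrimes hE hp) hle
  rw [← hpv]
  exact hp.2 hq.1 ((le_idealOfVars_of_mem_minimalPrimes hE hq).trans hle)

/-- Noether normalization by linear forms, over an infinite field. -/
theorem exists_linearForm_of_ringKrullDim_le [Infinite k] (m : ℕ)
    {E : Ideal (MvPolynomial (Fin n) k)} (hE : E.IsHomogeneous (homogeneousSubmodule (Fin n) k))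
    (hdim : ringKrullDim (MvPolynomial (Fin n) k ⧸ E) ≤ m) (V : Submodule k (Fin n → k))
    (hV : idealOfVars (Fin n) k ≤ (E ⊔ Ideal.span (linearForm '' (V : Set (Fin n → k)))).radical) :
    ∃ c : Fin m → Fin n → k, (∀ s, c s ∈ V) ∧
      idealOfVars (Fin n) k ≤ (E ⊔ Ideal.span (Set.range fun s => linearForm (c s))).radical := by
  induction m generalizing E with
  | zero =>
    rcases Classical.em (∃ p ∈ E.minimalPrimes, idealOfVars (Fin n) k ≤ p) with
      ⟨p, hp, hle⟩ | hmin
    · exact ⟨fun _ => 0, fun _ => V.zero_mem,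
        (idealOfVars_le_radical hE hp hle).trans (Ideal.radical_mono le_sup_left)⟩
    · push Not at hmin
      refine ⟨Fin.elim0, fun s => s.elim0, ?_⟩
      refine le_trans ?_ (Ideal.radical_mono le_sup_left)
      rw [← Ideal.sInf_minimalPrimes]
      refine le_sInf fun q hq => ?_
      exfalso
      have hqp : q.IsPrime := hq.1.1
      have hE1 : E ≠ ⊤ := fun h => hqp.ne_top (top_le_iff.mp (h ▸ hq.1.2))
      have : Nontrivial (MvPolynomial (Fin n) k ⧸ E) := Ideal.Quotient.nontrivial_iff.mpr hE1
      have h0 : Ring.KrullDimLE 0 (MvPolynomial (Fin n) k ⧸ E) :=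
        ringKrullDimZero_iff_ringKrullDim_eq_zero.mpr
          (le_antisymm (by simpa using hdim) ringKrullDim_nonneg_of_nontrivial)
      rw [Ideal.krullDimLE_zero_quotient_iff_forall_minimalPrimes_isMaximal] at h0
      refine hmin q hq ?_
      rw [(h0 q hq).eq_of_le isMaximal_idealOfVars.ne_top
        (le_idealOfVars_of_mem_minimalPrimes hE hq)]
  | succ m ih =>
    rcases Classical.em (∃ p ∈ E.minimalPrimes, idealOfVars (Fin n) k ≤ p) with
      ⟨p, hp, hle⟩ | hmin
    -- Nothing is left to cut down, so zero forms fill the remaining places.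
    · exact ⟨fun _ => 0, fun _ => V.zero_mem,
        (idealOfVars_le_radical hE hp hle).trans (Ideal.radical_mono le_sup_left)⟩
    · push Not at hmin
      -- an element of `V` outside all minimal primes
      obtain ⟨v, hvV, hv⟩ : ∃ v ∈ V, ∀ p ∈ E.minimalPrimes, linearForm v ∉ p := by
        have hfin : E.minimalPrimes.Finite := Ideal.finite_minimalPrimes_of_isNoetherianRing _ E
        have := hfin.to_subtype
        let W : E.minimalPrimes → Submodule k V := fun p =>
          (p.1.restrictScalars k).comap (linearForm ∘ₗ V.subtype)
        by_contra! hcon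
        have hcov : ⋃ p, (W p : Set V) = Set.univ := by
          refine Set.eq_univ_of_forall fun v => ?_
          obtain ⟨p, hp, hvp⟩ := hcon v v.2
          exact Set.mem_iUnion.mpr ⟨⟨p, hp⟩, hvp⟩
        -- Over an infinite field, finitely many proper subspaces do not cover `V`. So one minimal
        -- prime contains all forms from `V`, and `hV` puts the variables into it.
        obtain ⟨⟨p, hp⟩, hpW⟩ := Subspace.exists_eq_top_of_iUnion_eq_univ hcov
        have hpp : p.IsPrime := hp.1.1
        refine hmin p hp (hV.trans (hpp.radical_le_iff.mpr (sup_le hp.1.2 ?_)))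
        rw [Ideal.span_le]
        rintro _ ⟨v, hv, rfl⟩
        have : (⟨v, hv⟩ : V) ∈ W ⟨p, hp⟩ := by rw [hpW]; trivial
        exact this
      have hE' : (E ⊔ Ideal.span {linearForm v}).IsHomogeneous
          (homogeneousSubmodule (Fin n) k) := by
        refine hE.sup (isHomogeneous_span fun f hf => ?_)
        rw [Set.mem_singleton_iff.mp hf]
        exact ⟨1, isHomogeneous_linearForm v⟩
      have hdim' : ringKrullDim (MvPolynomial (Fin n) k ⧸ E ⊔ Ideal.span {linearForm v}) ≤ m := by
        exact WithBot.le_natCast_of_add_one_le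
          ((ringKrullDim_quotient_sup_span_succ_le E hv).trans hdim)
      have hV' : idealOfVars (Fin n) k ≤ (E ⊔ Ideal.span {linearForm v} ⊔
          Ideal.span (linearForm '' (V : Set (Fin n → k)))).radical :=
        hV.trans (Ideal.radical_mono (sup_le_sup_right le_sup_left _))
      obtain ⟨c, hcV, hc⟩ := ih hE' hdim' hV'
      refine ⟨Fin.cons v c, fun s => ?_, ?_⟩
      · refine Fin.cases hvV hcV s
      · refine hc.trans (Ideal.radical_mono ?_)
        rw [sup_assoc, ← Ideal.span_union]
        refine sup_le_sup_left (Ideal.span_mono ?_) _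
        rintro f (hf | ⟨s, rfl⟩)
        · exact ⟨0, by simpa using hf.symm⟩
        · exact ⟨s.succ, by simp⟩

end Graded

/-! ### Openness of generation by general linear forms -/

section Openness

open MvPolynomial

variable {k : Type*} [Field k] {n l : ℕ}

attribute [local instance] MvPolynomial.gradedAlgebra

/-- The linear forms given by a tuple of coefficients, together with a fixed homogeneous ideal,
contain all forms of degree `N` as soon as the coefficients avoid a hypersurface, if they do so for
one choice of the coefficients. -/
theorem exists_ne_zero_idealOfVars_pow_le {E : Ideal (MvPolynomial (Fin n) k)}
    (hE : E.IsHomogeneous (homogeneousSubmodule (Fin n) k)) (N : ℕ) (c₀ : Fin l → Fin n → k)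
    (h₀ : idealOfVars (Fin n) k ^ N ≤ E ⊔ Ideal.span (Set.range fun s => linearForm (c₀ s))) :
    ∃ p : MvPolynomial (Fin l × Fin n) k, p ≠ 0 ∧ ∀ c : Fin l → Fin n → k,
      eval (fun x => c x.1 x.2) p ≠ 0 →
        idealOfVars (Fin n) k ^ N ≤ E ⊔ Ideal.span (Set.range fun s => linearForm (c s)) := by
  classical
  let ι := {d : Fin n →₀ ℕ // d ∈ Finset.finsuppAntidiag Finset.univ N}
  let _ : Fintype ι := Finset.fintypeCoeSort _
  have hι : ∀ d : Fin n →₀ ℕ, d ∈ Finset.finsuppAntidiag Finset.univ N ↔ d.degree = N := by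
    intro d
    rw [Finset.mem_finsuppAntidiag]
    simp [Finsupp.degree_eq_sum]
  have hrep : ∀ d : ι, ∃ e ∈ E, ∃ w : Fin l → MvPolynomial (Fin n) k,
      monomial d.1 (1 : k) = e + ∑ s, w s * linearForm (c₀ s) := by
    intro d
    have hd : monomial d.1 (1 : k) ∈ idealOfVars (Fin n) k ^ N :=
      (monomial_mem_pow_idealOfVars_iff N d.1 one_ne_zero).mpr ((hι d.1).mp d.2).ge
    obtain ⟨e, he, f, hf, hsum⟩ := Submodule.mem_sup.mp (h₀ hd)
    obtain ⟨w, rfl⟩ := Ideal.mem_span_range_iff_exists_fun.mp hf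
    exact ⟨e, he, w, hsum.symm⟩
  choose e he w hw using hrep
  -- The multipliers `e d`, `w d` found for `c₀` are frozen while the linear forms vary. The
  -- coefficient matrix of the `v c d` on monomials of degree `N` is the identity at `c₀`, so its
  -- determinant is a nonzero polynomial in `c`.
  let v : (Fin l → Fin n → k) → ι → MvPolynomial (Fin n) k := fun c d =>
    e d + ∑ s, w d s * linearForm (c s)
  let P : Matrix ι ι (MvPolynomial (Fin l × Fin n) k) := Matrix.of fun d d' =>
    C (coeff d'.1 (e d)) + ∑ s, ∑ j, X (s, j) * C (coeff d'.1 (w d s * X j))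
  have hP : ∀ c : Fin l → Fin n → k, P.map (eval fun x => c x.1 x.2) =
      Matrix.of fun d d' => coeff d'.1 (v c d) := by
    intro c
    ext d d'
    simp only [P, v, Matrix.map_apply, Matrix.of_apply, map_add, map_sum, map_mul, eval_C, eval_X,
      coeff_add, coeff_sum, linearForm_apply, Finset.mul_sum, mul_smul_comm, coeff_smul,
      smul_eq_mul]
  have hdet : ∀ c : Fin l → Fin n → k, eval (fun x => c x.1 x.2) P.det =
      (Matrix.of fun d d' : ι => coeff d'.1 (v c d)).det := by
    intro c
    rw [RingHom.map_det, ← hP c]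
    rfl
  have hone : (Matrix.of fun d d' : ι => coeff d'.1 (v c₀ d)) = 1 := by
    ext d d'
    simp only [v, Matrix.of_apply, ← hw, coeff_monomial, Matrix.one_apply]
    exact if_congr Subtype.ext_iff.symm rfl rfl
  refine ⟨P.det, fun h => ?_, fun c hc => ?_⟩
  · have := hdet c₀
    rw [h, hone, Matrix.det_one, map_zero] at this
    exact zero_ne_one this
  · rw [hdet] at hc
    set B : Matrix ι ι k := Matrix.of fun d d' => coeff d'.1 (v c d) with hB
    have hinv : B⁻¹ * B = 1 := Matrix.nonsing_inv_mul _ (isUnit_iff_ne_zero.mpr hc)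
    have hE' : (E ⊔ Ideal.span (Set.range fun s => linearForm (c s))).IsHomogeneous
        (homogeneousSubmodule (Fin n) k) := by
      refine hE.sup (isHomogeneous_span ?_)
      rintro _ ⟨s, rfl⟩
      exact ⟨1, isHomogeneous_linearForm _⟩
    have hv : ∀ d, v c d ∈ E ⊔ Ideal.span (Set.range fun s => linearForm (c s)) := fun d =>
      add_mem (Ideal.mem_sup_left (he d)) (Ideal.mem_sup_right (sum_mem fun s _ =>
        Ideal.mul_mem_left _ _ (Ideal.subset_span ⟨s, rfl⟩)))
    rw [pow_idealOfVars_eq_span, Ideal.span_le]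
    rintro _ ⟨d, hd, rfl⟩
    let d₁ : ι := ⟨d, (hι d).mpr hd⟩
    have hcomp : homogeneousComponent N (∑ d', B⁻¹ d₁ d' • v c d') = monomial d 1 := by
      ext x
      rw [coeff_homogeneousComponent, coeff_monomial]
      by_cases hx : x.degree = N
      · rw [if_pos hx, coeff_sum]
        simp only [coeff_smul, smul_eq_mul]
        have := congrFun (congrFun hinv d₁) ⟨x, (hι x).mpr hx⟩
        rw [Matrix.mul_apply, Matrix.one_apply] at this
        rw [if_congr Subtype.ext_iff rfl rfl] at this
        exact this
      · rw [if_neg hx, if_neg]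
        rintro rfl
        exact hx hd
    change monomial d (1 : k) ∈ _
    rw [← hcomp]
    refine homogeneousComponent_mem_of_mem hE' (sum_mem fun d' _ => ?_) N
    rw [smul_eq_C_mul]
    exact Ideal.mul_mem_left _ _ (hv d')

/-- The matrix with the given first rows, completed by rows of the identity matrix. -/
def completedMatrix {A : Type*} [CommRing A] (c : Fin l → Fin n → A) : Matrix (Fin n) (Fin n) A :=
  Matrix.of fun s j => if h : (s : ℕ) < l then c ⟨s, h⟩ j else (1 : Matrix (Fin n) (Fin n) A) s j

theorem completedMatrix_map {A B : Type*} [CommRing A] [CommRing B] (φ : A →+* B)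
    (c : Fin l → Fin n → A) :
    (completedMatrix c).map φ = completedMatrix fun s j => φ (c s j) := by
  ext s j
  simp only [completedMatrix, Matrix.map_apply, Matrix.of_apply]
  split_ifs
  · rfl
  · simp [Matrix.one_apply, apply_ite φ]

theorem det_completedMatrix_map {A B : Type*} [CommRing A] [CommRing B] (φ : A →+* B)
    (c : Fin l → Fin n → A) :
    φ (completedMatrix c).det = (completedMatrix fun s j => φ (c s j)).det := by
  rw [RingHom.map_det, ← completedMatrix_map]
  rfl

/-- The generic determinant is nonzero because it equals `1` at the first `l` rows of the identity.
-/
theorem exists_ne_zero_det_completedMatrix (k : Type*) [CommRing k] [Nontrivial k] (hl : l ≤ n) :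
    ∃ p : MvPolynomial (Fin l × Fin n) k, p ≠ 0 ∧ ∀ c : Fin l → Fin n → k,
      eval (fun x => c x.1 x.2) p ≠ 0 → (completedMatrix c).det ≠ 0 := by
  have hp : ∀ c : Fin l → Fin n → k, eval (fun x => c x.1 x.2)
      (completedMatrix fun (s : Fin l) (j : Fin n) =>
        (X (s, j) : MvPolynomial (Fin l × Fin n) k)).det = (completedMatrix c).det := by
    intro c
    rw [det_completedMatrix_map]
    simp
  refine ⟨_, fun h => ?_, fun c hc => by rwa [hp] at hc⟩
  have h1 := hp fun s j => (1 : Matrix (Fin n) (Fin n) k) (Fin.castLE hl s) j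
  have h2 : (completedMatrix fun (s : Fin l) j => (1 : Matrix (Fin n) (Fin n) k)
      (Fin.castLE hl s) j) = 1 := by
    ext s j
    simp only [completedMatrix, Matrix.of_apply]
    split_ifs
    · rfl
    · rfl
  rw [h, h2, map_zero, Matrix.det_one] at h1
  exact zero_ne_one h1

end Openness

/-! ### Factors of homogeneous polynomials -/

section Factors

open MvPolynomial

/-- The embedding of a polynomial ring into the polynomials in one more variable that records the
degree. -/
noncomputable def degreeHom {σ A : Type*} [CommRing A] :
    MvPolynomial σ A →ₐ[A] Polynomial (MvPolynomial σ A) :=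
  aeval fun i => Polynomial.monomial 1 (X i)

theorem degreeHom_monomial {σ A : Type*} [CommRing A] (d : σ →₀ ℕ) (a : A) :
    degreeHom (monomial d a) = Polynomial.monomial d.degree (monomial d a) := by
  have h1 : degreeHom (monomial d (1 : A)) = Polynomial.monomial d.degree (monomial d 1) := by
    induction d using Finsupp.induction_linear with
    | zero => simp
    | add d e hd he =>
      have : monomial (d + e) (1 : A) = monomial d 1 * monomial e 1 := by
        rw [monomial_mul, one_mul]
      rw [this, map_mul, hd, he, Polynomial.monomial_mul_monomial, map_add]
    | single i m =>
      rw [← X_pow_eq_monomial, map_pow, degreeHom, aeval_X, Polynomial.monomial_pow,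
        Finsupp.degree_single, one_mul]
  have h2 : monomial d a = a • monomial d (1 : A) := by rw [smul_monomial, smul_eq_mul, mul_one]
  rw [h2, map_smul, h1, Polynomial.smul_monomial]

theorem coeff_degreeHom {σ A : Type*} [CommRing A] (f : MvPolynomial σ A) (j : ℕ) :
    (degreeHom f).coeff j = homogeneousComponent j f := by
  induction f using MvPolynomial.induction_on' with
  | monomial d a =>
    rw [degreeHom_monomial, Polynomial.coeff_monomial,
      homogeneousComponent_of_mem (isHomogeneous_monomial a rfl)]
    exact if_congr eq_comm rfl rfl
  | add p q hp hq => rw [map_add, Polynomial.coeff_add, hp, hq, map_add]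

/-- Factors of nonzero homogeneous polynomials are homogeneous. -/
theorem MvPolynomial.IsHomogeneous.exists_of_dvd {σ A : Type*} [CommRing A] [IsDomain A]
    {f g : MvPolynomial σ A} {d : ℕ} (hg : g.IsHomogeneous d) (hg0 : g ≠ 0) (hfg : f ∣ g) :
    ∃ e, f.IsHomogeneous e := by
  obtain ⟨h, rfl⟩ := hfg
  have hne : ∀ f : MvPolynomial σ A, f ≠ 0 → degreeHom f ≠ 0 := fun f hf h0 => hf (by
    rw [← sum_homogeneousComponent f]
    exact Finset.sum_eq_zero fun j _ => by rw [← coeff_degreeHom, h0, Polynomial.coeff_zero])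
  have hf := hne f (left_ne_zero_of_mul hg0)
  have hh := hne h (right_ne_zero_of_mul hg0)
  have hmul : degreeHom f * degreeHom h = Polynomial.monomial d (f * h) := by
    rw [← map_mul]
    ext1 j
    rw [coeff_degreeHom, Polynomial.coeff_monomial, homogeneousComponent_of_mem hg]
    exact if_congr eq_comm rfl rfl
  -- Highest and lowest degrees add up under multiplication and agree for the product, so they agree
  -- for each factor.
  have h1 := Polynomial.natDegree_mul hf hh
  have h2 := Polynomial.natTrailingDegree_mul hf hh
  rw [hmul, Polynomial.natDegree_monomial_eq _ hg0] at h1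
  rw [hmul, Polynomial.natTrailingDegree_monomial hg0] at h2
  have h3 := Polynomial.natTrailingDegree_le_natDegree (degreeHom f)
  have h4 := Polynomial.natTrailingDegree_le_natDegree (degreeHom h)
  refine ⟨(degreeHom f).natDegree, ?_⟩
  have : homogeneousComponent (degreeHom f).natDegree f = f := by
    conv_rhs => rw [← sum_homogeneousComponent f]
    symm
    refine Finset.sum_eq_single _ (fun j _ hj => ?_) fun hj => ?_
    · rw [← coeff_degreeHom]
      rcases lt_or_gt_of_ne hj with hj | hj
      · exact Polynomial.coeff_eq_zero_of_lt_natTrailingDegree (by omega)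
      · exact Polynomial.coeff_eq_zero_of_natDegree_lt hj
    · exact homogeneousComponent_eq_zero _ _ (by simpa using hj)
  have h5 := homogeneousComponent_isHomogeneous (degreeHom f).natDegree f
  rwa [this] at h5

end Factors

/-! ### General linear forms modulo two relations -/

section GeneralForms

open MvPolynomial

variable {k : Type*} [Field k] {n l : ℕ}

attribute [local instance] MvPolynomial.gradedAlgebra

theorem span_rowForm_completedMatrix_le {A : Type*} [CommRing A] (hln : l ≤ n)
    (c : Fin l → Fin n → A) {i : ℕ} (hi : i ≤ l) :
    Ideal.span (rowForm (completedMatrix c) '' Set.Iio i) ≤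
      Ideal.span (Set.range fun s => linearForm (c s)) := by
  refine Ideal.span_mono ?_
  rintro _ ⟨q, hq, rfl⟩
  have hql : q < l := lt_of_lt_of_le hq hi
  refine ⟨⟨q, hql⟩, ?_⟩
  rw [rowForm, dif_pos (hql.trans_le hln)]
  refine congrArg _ (funext fun j => ?_)
  simp [completedMatrix, hql]

theorem idealOfVars_le_span_linearForm :
    idealOfVars (Fin n) k ≤
      Ideal.span (linearForm '' ((⊤ : Submodule k (Fin n → k)) : Set (Fin n → k))) := by
  rw [idealOfVars, Ideal.span_le]
  rintro _ ⟨j, rfl⟩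
  exact Ideal.subset_span ⟨Pi.single j 1, trivial, by simp [linearForm_apply, Pi.single_apply]⟩

/-- If `S / E` has dimension at most `l + e`, then `e` suitable linear forms and `l` general ones
generate a primary ideal for the ideal of the variables in `S / E`. -/
theorem exists_ne_zero_idealOfVars_pow_le_of_ringKrullDim_le [Infinite k] {e : ℕ}
    {E : Ideal (MvPolynomial (Fin n) k)} (hE : E.IsHomogeneous (homogeneousSubmodule (Fin n) k))
    (hdim : ringKrullDim (MvPolynomial (Fin n) k ⧸ E) ≤ (l + e : ℕ)) :
    ∃ (N : ℕ) (b : Fin e → Fin n → k) (p : MvPolynomial (Fin l × Fin n) k), p ≠ 0 ∧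
      ∀ c : Fin l → Fin n → k, eval (fun x => c x.1 x.2) p ≠ 0 →
        idealOfVars (Fin n) k ^ N ≤ (E ⊔ Ideal.span (Set.range fun s => linearForm (b s))) ⊔
          Ideal.span (Set.range fun s => linearForm (c s)) := by
  obtain ⟨c₁, -, hc₁⟩ := exists_linearForm_of_ringKrullDim_le (l + e) hE hdim ⊤
    (idealOfVars_le_span_linearForm.trans (le_sup_right.trans Ideal.le_radical))
  obtain ⟨N, hN⟩ := idealOfVars_pow_le hc₁
  have hEX : (E ⊔ Ideal.span (Set.range fun s => linearForm (c₁ (Fin.natAdd l s)))).IsHomogeneous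
      (homogeneousSubmodule (Fin n) k) := by
    refine hE.sup (isHomogeneous_span ?_)
    rintro _ ⟨s, rfl⟩
    exact ⟨1, isHomogeneous_linearForm _⟩
  refine ⟨N, fun s => c₁ (Fin.natAdd l s),
    exists_ne_zero_idealOfVars_pow_le hEX N (fun s => c₁ (Fin.castAdd e s)) (hN.trans ?_)⟩
  rw [sup_assoc]
  refine sup_le_sup_left (Ideal.span_le.mpr ?_) E
  rintro _ ⟨s, rfl⟩
  refine Fin.addCases (fun s => ?_) (fun s => ?_) s
  · exact Ideal.mem_sup_right (Ideal.subset_span ⟨s, rfl⟩)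
  · exact Ideal.mem_sup_left (Ideal.subset_span ⟨s, rfl⟩)

theorem ncard_range_le {α : Type*} {e : ℕ} (b : Fin e → α) : (Set.range b).ncard ≤ e := by
  rw [← Set.image_univ]
  exact (Set.ncard_image_le Set.finite_univ).trans (by simp [Set.ncard_univ])

/-- Otherwise fewer than `n` elements without constant term would generate the ideal of the
variables up to radical, against Krull's height theorem. -/
theorem not_le_span_of_idealOfVars_pow_le {E : Ideal (MvPolynomial (Fin n) k)} {N : ℕ}
    {X Y Z : Set (MvPolynomial (Fin n) k)}
    (h : idealOfVars (Fin n) k ^ N ≤ (E ⊔ Ideal.span X) ⊔ Ideal.span Y)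
    (hfin : (Z ∪ Y ∪ X).Finite) (h0 : ∀ f ∈ Z ∪ Y ∪ X, constantCoeff f = 0)
    (hcard : Z.ncard + Y.ncard + X.ncard < n) : ¬ E ≤ Ideal.span Z ⊔ Ideal.span Y := by
  intro hle
  have hspan : (E ⊔ Ideal.span X) ⊔ Ideal.span Y ≤ Ideal.span (Z ∪ Y ∪ X) := by
    rw [Ideal.span_union, Ideal.span_union]
    exact sup_le (sup_le (hle.trans le_sup_left) le_sup_right) (le_sup_right.trans le_sup_left)
  refine not_idealOfVars_le_radical_span hfin h0 (lt_of_le_of_lt ?_ hcard)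
    fun x hx => ⟨N, hspan (h (Ideal.pow_mem_pow hx N))⟩
  exact (Set.ncard_union_le _ _).trans (Nat.add_le_add_right (Set.ncard_union_le _ _) _)

/-- If `S / E` has dimension at most `m`, then `E` is not contained in the ideal generated by
general linear forms and too few further polynomials without constant term. -/
theorem exists_ne_zero_not_le_span [Infinite k] {m : ℕ} (hlm : l ≤ m)
    {E : Ideal (MvPolynomial (Fin n) k)} (hE : E.IsHomogeneous (homogeneousSubmodule (Fin n) k))
    (hdim : ringKrullDim (MvPolynomial (Fin n) k ⧸ E) ≤ m) :
    ∃ p : MvPolynomial (Fin l × Fin n) k, p ≠ 0 ∧ ∀ c : Fin l → Fin n → k,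
      eval (fun x => c x.1 x.2) p ≠ 0 → ∀ Z : Set (MvPolynomial (Fin n) k), Z.Finite →
        (∀ z ∈ Z, constantCoeff z = 0) → Z.ncard + m < n →
          ¬ E ≤ Ideal.span Z ⊔ Ideal.span (Set.range fun s => linearForm (c s)) := by
  obtain ⟨e, rfl⟩ := Nat.exists_eq_add_of_le hlm
  obtain ⟨N, b, p, hp0, hp⟩ := exists_ne_zero_idealOfVars_pow_le_of_ringKrullDim_le hE hdim
  refine ⟨p, hp0, fun c hc Z hZf hZ0 hZ => not_le_span_of_idealOfVars_pow_le (hp c hc)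
    ((hZf.union (Set.finite_range _)).union (Set.finite_range _)) ?_ ?_⟩
  · rintro f ((hf | ⟨s, rfl⟩) | ⟨s, rfl⟩)
    exacts [hZ0 f hf, constantCoeff_linearForm _, constantCoeff_linearForm _]
  · refine lt_of_le_of_lt ?_ hZ
    rw [← add_assoc]
    exact Nat.add_le_add (Nat.add_le_add_left (ncard_range_le _) _) (ncard_range_le _)

theorem ringKrullDim_quotient_span_singleton_add_one_le {d : MvPolynomial (Fin n) k} (hd : d ≠ 0) :
    ringKrullDim (MvPolynomial (Fin n) k ⧸ Ideal.span {d}) + 1 ≤ n := by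
  have h := ringKrullDim_quotient_sup_span_succ_le (⊥ : Ideal (MvPolynomial (Fin n) k)) (x := d)
    fun p hp hdp => hd (by
      have h0 : p ∈ minimalPrimes (MvPolynomial (Fin n) k) := hp
      rw [IsDomain.minimalPrimes_eq_singleton_bot] at h0
      rwa [Set.mem_singleton_iff.mp h0] at hdp)
  rw [bot_sup_eq] at h
  refine h.trans ?_
  rw [ringKrullDim_eq_of_ringEquiv (RingEquiv.quotientBot _),
    MvPolynomial.ringKrullDim_of_isNoetherianRing, ringKrullDim_eq_zero_of_field]
  simp

theorem ringKrullDim_quotient_span_singleton_le {d : MvPolynomial (Fin n) k} (hd : d ≠ 0) {m : ℕ}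
    (hm : m + 1 = n) : ringKrullDim (MvPolynomial (Fin n) k ⧸ Ideal.span {d}) ≤ m :=
  WithBot.le_natCast_of_add_one_le (by
    rw [hm]
    exact ringKrullDim_quotient_span_singleton_add_one_le hd)

/-- A minimal prime of `(g)` is generated by a prime factor of `g`, so by coprimality it does not
contain `h`. -/
theorem ringKrullDim_quotient_span_pair_le {g h : MvPolynomial (Fin n) k} (hg : g ≠ 0)
    (hgh : IsRelPrime g h) {m : ℕ} (hm : m + 2 = n) :
    ringKrullDim (MvPolynomial (Fin n) k ⧸ Ideal.span {g, h}) ≤ m := by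
  refine WithBot.le_natCast_of_add_one_le ?_
  rw [Ideal.span_insert]
  refine le_trans (ringKrullDim_quotient_sup_span_succ_le _ fun p hp hhp => ?_)
    (ringKrullDim_quotient_span_singleton_le hg (by omega))
  have hpp : p.IsPrime := hp.1.1
  have hgp : g ∈ p := hp.1.2 (Ideal.mem_span_singleton_self g)
  obtain ⟨u, hu⟩ := UniqueFactorizationMonoid.factors_prod hg
  have hprod : (UniqueFactorizationMonoid.factors g).prod ∈ p := by
    rw [← hu] at hgp
    exact (hpp.mem_or_mem hgp).resolve_right fun hup =>
      hpp.ne_top (p.eq_top_of_isUnit_mem hup u.isUnit)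
  obtain ⟨π, hπ, hπp⟩ := (hpp.multiset_prod_mem_iff_exists_mem _).mp hprod
  have hπprime := UniqueFactorizationMonoid.prime_of_factor π hπ
  have hπg : π ∣ g := UniqueFactorizationMonoid.dvd_of_mem_factors hπ
  have hle : Ideal.span {π} ≤ p := (Ideal.span_singleton_le_iff_mem _).mpr hπp
  have hpi := hp.2 ⟨(Ideal.span_singleton_prime hπprime.ne_zero).mpr hπprime,
    Ideal.span_singleton_le_span_singleton.mpr hπg⟩ hle
  exact hπprime.not_isUnit (hgh hπg (Ideal.mem_span_singleton.mp (hpi hhp)))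

theorem isUnit_of_isHomogeneous {e : MvPolynomial (Fin n) k} {m : ℕ} (he : e.IsHomogeneous m)
    (he0 : constantCoeff e ≠ 0) : IsUnit e := by
  have hm : m = 0 := by
    by_contra hm
    exact he0 (he.coeff_eq_zero (by simpa using Ne.symm hm))
  subst hm
  rw [(totalDegree_eq_zero_iff_eq_C (p := e)).mp (Nat.le_zero.mp he.totalDegree_le)]
  exact (isUnit_iff_ne_zero.mpr he0).map C

/-- If `d` died modulo the forms, the hypersurface ideal `(d)` would lie in an ideal of at most `n -
1` general linear forms, against the dimension count with `Z = ∅`. -/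
theorem exists_ne_zero_killForms_ne_zero [Infinite k] (hl : l + 1 ≤ n)
    {d : MvPolynomial (Fin n) k} (hd : d ≠ 0) {m : ℕ} (hdm : d.IsHomogeneous m) :
    ∃ p : MvPolynomial (Fin l × Fin n) k, p ≠ 0 ∧ ∀ c : Fin l → Fin n → k,
      eval (fun x => c x.1 x.2) p ≠ 0 → ∀ D : Matrix (Fin n) (Fin n) k,
        D * completedMatrix c = 1 → ∀ i ≤ l, killForms (completedMatrix c) D i d ≠ 0 := by
  obtain ⟨p, hp0, hp⟩ := exists_ne_zero_not_le_span (n := n) (l := l) (m := n - 1) (by omega)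
    (isHomogeneous_span (T := {d}) (by rintro _ rfl; exact ⟨m, hdm⟩))
    (ringKrullDim_quotient_span_singleton_le hd (by omega))
  refine ⟨p, hp0, fun c hc D hD i hi h0 => hp c hc ∅ Set.finite_empty (by simp) (by simp; omega) ?_⟩
  rw [Ideal.span_singleton_le_iff_mem]
  have := sub_killForms_mem hD i d
  rw [h0, sub_zero] at this
  exact Ideal.mem_sup_right (span_rowForm_completedMatrix_le (by omega) c hi this)

/-- A common factor `e` without constant term would place `g, h` in the ideal of `e` and the linear
forms; since `1 + (n - 2) < n`, the dimension count with `Z = {e}` forbids this. Any other common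
factor divides a nonzero form, hence is homogeneous with nonzero constant term, a unit. -/
theorem exists_ne_zero_isRelPrime_killForms [Infinite k] (hl : l + 2 ≤ n)
    {g h : MvPolynomial (Fin n) k} (hg : g ≠ 0) (hgh : IsRelPrime g h) {m m' : ℕ}
    (hgm : g.IsHomogeneous m) (hhm : h.IsHomogeneous m') :
    ∃ p : MvPolynomial (Fin l × Fin n) k, p ≠ 0 ∧ ∀ c : Fin l → Fin n → k,
      eval (fun x => c x.1 x.2) p ≠ 0 → ∀ D : Matrix (Fin n) (Fin n) k,
        D * completedMatrix c = 1 → ∀ i ≤ l,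
          IsRelPrime (killForms (completedMatrix c) D i g) (killForms (completedMatrix c) D i h) := by
  obtain ⟨p, hp0, hp⟩ := exists_ne_zero_not_le_span (n := n) (l := l) (m := n - 2) (by omega)
    (isHomogeneous_span (T := {g, h}) (by
      rintro _ (rfl | rfl)
      exacts [⟨m, hgm⟩, ⟨m', hhm⟩]))
    (ringKrullDim_quotient_span_pair_le hg hgh (by omega))
  refine ⟨p, hp0, fun c hc D hD i hi => ?_⟩
  have key : ∀ e : MvPolynomial (Fin n) k, e ∣ killForms (completedMatrix c) D i g →
      e ∣ killForms (completedMatrix c) D i h → constantCoeff e ≠ 0 := by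
    intro e heg heh he0
    refine hp c hc {e} (Set.finite_singleton e) (by simpa using he0) (by simp; omega) ?_
    have hmem : ∀ q : MvPolynomial (Fin n) k, e ∣ killForms (completedMatrix c) D i q →
        q ∈ Ideal.span {e} ⊔
          Ideal.span (Set.range fun s => linearForm (c s)) := by
      intro q hq
      rw [← add_sub_cancel (killForms (completedMatrix c) D i q) q]
      refine add_mem (Ideal.mem_sup_left ?_) (Ideal.mem_sup_right
        (span_rowForm_completedMatrix_le (by omega) c hi (sub_killForms_mem hD i q)))
      simpa [Ideal.mem_span_singleton] using hq
    rw [Ideal.span_le]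
    rintro _ (rfl | rfl)
    exacts [hmem _ heg, hmem _ heh]
  intro e heg heh
  have hne := key e heg heh
  by_cases hg0 : killForms (completedMatrix c) D i g = 0
  · by_cases hh0 : killForms (completedMatrix c) D i h = 0
    · exact absurd (map_zero constantCoeff) (key 0 (by rw [hg0]) (by rw [hh0]))
    · obtain ⟨q, hq⟩ := (isHomogeneous_killForms hhm).exists_of_dvd hh0 heh
      exact isUnit_of_isHomogeneous hq hne
  · obtain ⟨q, hq⟩ := (isHomogeneous_killForms hgm).exists_of_dvd hg0 heg
    exact isUnit_of_isHomogeneous hq hne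

/-- General linear forms `L₀, …, L_{l-1}` form a regular sequence modulo the ideal generated by
two homogeneous relations, if there are enough variables. -/
theorem exists_ne_zero_rowForm_regular_of_ne_zero [Infinite k] {g h : MvPolynomial (Fin n) k}
    (hg : g ≠ 0) {m m' : ℕ} (hgm : g.IsHomogeneous m) (hhm : h.IsHomogeneous m')
    (hl : l + 2 ≤ n ∨ l + 1 ≤ n ∧ h = 0) :
    ∃ p : MvPolynomial (Fin l × Fin n) k, p ≠ 0 ∧ ∀ c : Fin l → Fin n → k,
      eval (fun x => c x.1 x.2) p ≠ 0 → ∀ i < l, ∀ u : MvPolynomial (Fin n) k,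
        rowForm (completedMatrix c) i * u ∈
            Ideal.span (rowForm (completedMatrix c) '' Set.Iio i) ⊔ Ideal.span {g, h} →
          u ∈ Ideal.span (rowForm (completedMatrix c) '' Set.Iio i) ⊔ Ideal.span {g, h} := by
  obtain ⟨g', h', d, hrel, rfl, rfl⟩ := UniqueFactorizationMonoid.exists_reduced_factors g hg h
  have hd := left_ne_zero_of_mul hg
  obtain ⟨md, hdm⟩ := hgm.exists_of_dvd hg (Dvd.intro _ rfl)
  obtain ⟨mg, hgm'⟩ := hgm.exists_of_dvd hg (Dvd.intro_left _ rfl)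
  have hh' : ∃ mh, h'.IsHomogeneous mh := by
    by_cases h0 : h' = 0
    · exact ⟨0, h0 ▸ isHomogeneous_zero _ _ _⟩
    · exact hhm.exists_of_dvd (mul_ne_zero hd h0) (Dvd.intro_left _ rfl)
  obtain ⟨mh, hhm'⟩ := hh'
  have hl1 : l + 1 ≤ n := by omega
  obtain ⟨p₁, hp₁0, hp₁⟩ := exists_ne_zero_det_completedMatrix k (n := n) (l := l) (by omega)
  obtain ⟨p₂, hp₂0, hp₂⟩ := exists_ne_zero_killForms_ne_zero hl1 hd hdm
  have h3 : ∃ p : MvPolynomial (Fin l × Fin n) k, p ≠ 0 ∧ ∀ c : Fin l → Fin n → k,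
      eval (fun x => c x.1 x.2) p ≠ 0 → ∀ D : Matrix (Fin n) (Fin n) k,
        D * completedMatrix c = 1 → ∀ i ≤ l, IsRelPrime (killForms (completedMatrix c) D i g')
          (killForms (completedMatrix c) D i h') := by
    rcases hl with hl | ⟨-, h0⟩
    · exact exists_ne_zero_isRelPrime_killForms hl (right_ne_zero_of_mul hg) hrel hgm' hhm'
    -- With a single relation the whole relation is absorbed in `d`, and coprimality costs no
    -- further variable.
    · have hu : IsUnit g' := by
        have h0' : h' = 0 := (mul_eq_zero.mp h0).resolve_left hd
        exact hrel dvd_rfl (h0' ▸ dvd_zero g')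
      exact ⟨1, one_ne_zero, fun c _ D _ i _ => (hu.map (killForms (completedMatrix c) D i)).isRelPrime_left⟩
  obtain ⟨p₃, hp₃0, hp₃⟩ := h3
  refine ⟨p₁ * p₂ * p₃, mul_ne_zero (mul_ne_zero hp₁0 hp₂0) hp₃0, fun c hc i hi u hu => ?_⟩
  rw [map_mul, map_mul] at hc
  have hdet := isUnit_iff_ne_zero.mpr (hp₁ c (left_ne_zero_of_mul (left_ne_zero_of_mul hc)))
  have hDM := Matrix.nonsing_inv_mul _ hdet
  exact mem_of_rowForm_mul_mem (Matrix.mul_nonsing_inv _ hdet) hDM (by omega)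
    (hp₂ c (right_ne_zero_of_mul (left_ne_zero_of_mul hc)) _ hDM (i + 1) hi)
    (hp₃ c (right_ne_zero_of_mul hc) _ hDM (i + 1) hi) hu

theorem exists_ne_zero_rowForm_regular [Infinite k] {g h : MvPolynomial (Fin n) k}
    {m m' : ℕ} (hgm : g.IsHomogeneous m) (hhm : h.IsHomogeneous m')
    (hl : l + 2 ≤ n ∨ l + 1 ≤ n ∧ h = 0 ∨ l ≤ n ∧ g = 0 ∧ h = 0) :
    ∃ p : MvPolynomial (Fin l × Fin n) k, p ≠ 0 ∧ ∀ c : Fin l → Fin n → k,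
      eval (fun x => c x.1 x.2) p ≠ 0 → ∀ i < l, ∀ u : MvPolynomial (Fin n) k,
        rowForm (completedMatrix c) i * u ∈
            Ideal.span (rowForm (completedMatrix c) '' Set.Iio i) ⊔ Ideal.span {g, h} →
          u ∈ Ideal.span (rowForm (completedMatrix c) '' Set.Iio i) ⊔ Ideal.span {g, h} := by
  by_cases hg : g = 0
  · by_cases hh : h = 0
    · obtain ⟨p, hp0, hp⟩ := exists_ne_zero_det_completedMatrix k (n := n) (l := l) (by omega)
      refine ⟨p, hp0, fun c hc i hi u hu => ?_⟩
      have hdet := isUnit_iff_ne_zero.mpr (hp c hc)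
      have hbot : Ideal.span {g, h} = ⊥ := by simp [hg, hh]
      rw [hbot, sup_bot_eq] at hu ⊢
      exact isRegularUpTo_rowForm (Matrix.mul_nonsing_inv _ hdet) (Matrix.nonsing_inv_mul _ hdet)
        i (by omega) u hu
    · rw [Set.pair_comm]
      refine exists_ne_zero_rowForm_regular_of_ne_zero hh hhm hgm (Or.inl ?_)
      rcases hl with hl | ⟨-, h0⟩ | ⟨-, -, h0⟩
      exacts [hl, absurd h0 hh, absurd h0 hh]
  · refine exists_ne_zero_rowForm_regular_of_ne_zero hg hgm hhm ?_
    rcases hl with hl | hl | ⟨-, h0, -⟩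
    exacts [Or.inl hl, Or.inr hl, absurd h0 hg]

end GeneralForms

/-! ### Forms evaluated at the generators of an ideal -/

section Evaluation

open MvPolynomial

variable {R : Type*} [CommRing R] {n : ℕ} {f : Fin n → R}

theorem degreeHom_of_isHomogeneous {σ A : Type*} [CommRing A] {q : MvPolynomial σ A} {d : ℕ}
    (hq : q.IsHomogeneous d) : degreeHom q = Polynomial.monomial d q := by
  ext1 j
  rw [coeff_degreeHom, Polynomial.coeff_monomial, homogeneousComponent_of_mem hq]
  exact if_congr eq_comm rfl rfl

theorem homogeneousComponent_succ_mul {σ A : Type*} [CommRing A] {q : MvPolynomial σ A}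
    (hq : q.IsHomogeneous 1) (p : MvPolynomial σ A) (j : ℕ) :
    homogeneousComponent (j + 1) (q * p) = q * homogeneousComponent j p := by
  rw [← coeff_degreeHom, map_mul, degreeHom_of_isHomogeneous hq, Polynomial.coeff_monomial_mul,
    coeff_degreeHom]

theorem homogeneousComponent_zero_mul {σ A : Type*} [CommRing A] {q : MvPolynomial σ A}
    (hq : q.IsHomogeneous 1) (p : MvPolynomial σ A) : homogeneousComponent 0 (q * p) = 0 := by
  rw [← coeff_degreeHom, map_mul, degreeHom_of_isHomogeneous hq, Polynomial.mul_coeff_zero,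
    Polynomial.coeff_monomial, if_neg one_ne_zero, zero_mul]

theorem homogeneousComponent_map {σ A B : Type*} [CommRing A] [CommRing B] (φ : A →+* B) (j : ℕ)
    (p : MvPolynomial σ A) :
    homogeneousComponent j (map φ p) = map φ (homogeneousComponent j p) := by
  ext d
  rw [coeff_homogeneousComponent, coeff_map, coeff_map, coeff_homogeneousComponent]
  split_ifs
  · rfl
  · rw [map_zero]

theorem aeval_monomial_one_eq (f : Fin n → R) (p : MvPolynomial (Fin n) R) :
    aeval (R := R) (fun i => Polynomial.monomial 1 (f i)) p = (degreeHom p).map (eval f) := by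
  have : (aeval (R := R) fun i => Polynomial.monomial 1 (f i) :
      MvPolynomial (Fin n) R →ₐ[R] Polynomial R) =
      (Polynomial.mapAlgHom (aeval f)).comp (degreeHom (σ := Fin n) (A := R)) := by
    refine MvPolynomial.algHom_ext fun i => ?_
    simp [degreeHom]
  rw [this]
  rfl

theorem coeff_aeval_monomial_one (f : Fin n → R) (p : MvPolynomial (Fin n) R) (j : ℕ) :
    (aeval (R := R) (fun i => Polynomial.monomial 1 (f i)) p).coeff j =
      eval f (homogeneousComponent j p) := by
  rw [aeval_monomial_one_eq, Polynomial.coeff_map, coeff_degreeHom]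

theorem mem_reesRelations_iff {p : MvPolynomial (Fin n) R} :
    p ∈ reesRelations f ↔ ∀ j, eval f (homogeneousComponent j p) = 0 := by
  rw [reesRelations, RingHom.mem_ker, Polynomial.ext_iff]
  refine forall_congr' fun j => ?_
  rw [coeff_aeval_monomial_one, Polynomial.coeff_zero]

theorem mem_mul_span_pow_iff {B : Ideal R} {j : ℕ} {u : R} :
    u ∈ B * Ideal.span (Set.range f) ^ j ↔ ∃ p : MvPolynomial (Fin n) R,
      p.IsHomogeneous j ∧ (∀ d, coeff d p ∈ B) ∧ eval f p = u := by
  constructor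
  · intro hu
    induction hu using Submodule.mul_induction_on' with
    | mem_mul_mem b hb v hv =>
      obtain ⟨p, hp, rfl⟩ := (Ideal.mem_span_pow_iff_exists_isHomogeneous f v).mp hv
      refine ⟨C b * p, hp.C_mul b, fun d => ?_, by simp⟩
      rw [coeff_C_mul]
      exact B.mul_mem_right _ hb
    | add x _ y _ hx hy =>
      obtain ⟨p, hp, hpB, rfl⟩ := hx
      obtain ⟨q, hq, hqB, rfl⟩ := hy
      exact ⟨p + q, hp.add hq, fun d => by rw [coeff_add]; exact add_mem (hpB d) (hqB d), by simp⟩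
  · rintro ⟨p, hp, hpB, rfl⟩
    rw [p.as_sum, map_sum]
    refine sum_mem fun d hd => ?_
    have : monomial d (coeff d p) = C (coeff d p) * monomial d 1 := by rw [C_mul_monomial, mul_one]
    rw [this, map_mul, eval_C]
    refine Ideal.mul_mem_mul (hpB d) ((Ideal.mem_span_pow_iff_exists_isHomogeneous f _).mpr
      ⟨_, isHomogeneous_monomial 1 ?_, rfl⟩)
    rw [Finsupp.degree_eq_weight_one]
    exact hp (mem_support_iff.mp hd)

variable {K : Ideal R}

theorem map_mk_eq_zero_iff {p : MvPolynomial (Fin n) R} :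
    map (Ideal.Quotient.mk K) p = 0 ↔ ∀ d, coeff d p ∈ K := by
  rw [MvPolynomial.ext_iff]
  refine forall_congr' fun d => ?_
  rw [coeff_map, coeff_zero, Ideal.Quotient.eq_zero_iff_mem]

/-- A form with value in `K * I ^ j` becomes a true relation over `R` after subtracting a form with
coefficients in `K`, which does not change its image over `R ⧸ K`. -/
theorem map_mem_relationIdeal_iff {p : MvPolynomial (Fin n) R} :
    map (Ideal.Quotient.mk K) p ∈ relationIdeal f K ↔
      ∀ j, eval f (homogeneousComponent j p) ∈ K * Ideal.span (Set.range f) ^ j := by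
  constructor
  · intro hp j
    obtain ⟨q, hq, hqp⟩ := (Ideal.mem_map_iff_of_surjective _
      (map_surjective _ Ideal.Quotient.mk_surjective)).mp hp
    have h0 : ∀ d, coeff d (p - q) ∈ K := map_mk_eq_zero_iff.mp (by rw [map_sub, hqp, sub_self])
    refine mem_mul_span_pow_iff.mpr ⟨homogeneousComponent j (p - q),
      homogeneousComponent_isHomogeneous _ _, fun d => ?_, ?_⟩
    · rw [coeff_homogeneousComponent]
      split_ifs
      exacts [h0 d, zero_mem K]
    · rw [map_sub, map_sub, mem_reesRelations_iff.mp hq j, sub_zero]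
  · intro h
    rw [← sum_homogeneousComponent p, map_sum]
    refine sum_mem fun j _ => ?_
    obtain ⟨q, hq, hqK, hqp⟩ := mem_mul_span_pow_iff.mp (h j)
    have : map (Ideal.Quotient.mk K) (homogeneousComponent j p) =
        map (Ideal.Quotient.mk K) (homogeneousComponent j p - q) := by
      rw [map_sub, map_mk_eq_zero_iff.mpr hqK, sub_zero]
    rw [this]
    refine Ideal.mem_map_of_mem _ (mem_reesRelations_iff.mpr fun i => ?_)
    rw [homogeneousComponent_of_mem ((homogeneousComponent_isHomogeneous j p).sub hq)]
    split_ifs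
    · rw [map_sub, hqp, sub_self]
    · rw [map_zero]

theorem map_mem_relationIdeal_iff_of_isHomogeneous {p : MvPolynomial (Fin n) R} {j : ℕ}
    (hp : p.IsHomogeneous j) : map (Ideal.Quotient.mk K) p ∈ relationIdeal f K ↔
      eval f p ∈ K * Ideal.span (Set.range f) ^ j := by
  rw [map_mem_relationIdeal_iff]
  constructor
  · intro h
    simpa [homogeneousComponent_of_mem hp] using h j
  · intro h i
    rw [homogeneousComponent_of_mem hp]
    split_ifs with hij
    · rwa [hij]
    · rw [map_zero]
      exact zero_mem _

theorem homogeneousComponent_mem_relationIdeal {q : MvPolynomial (Fin n) (R ⧸ K)}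
    (hq : q ∈ relationIdeal f K) (j : ℕ) : homogeneousComponent j q ∈ relationIdeal f K := by
  obtain ⟨p, rfl⟩ := map_surjective _ Ideal.Quotient.mk_surjective q
  rw [homogeneousComponent_map, map_mem_relationIdeal_iff_of_isHomogeneous
    (homogeneousComponent_isHomogeneous j p)]
  exact map_mem_relationIdeal_iff.mp hq j

theorem exists_isHomogeneous_map_eq {q : MvPolynomial (Fin n) (R ⧸ K)} {j : ℕ}
    (hq : q.IsHomogeneous j) :
    ∃ p : MvPolynomial (Fin n) R, p.IsHomogeneous j ∧ map (Ideal.Quotient.mk K) p = q := by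
  obtain ⟨p, rfl⟩ := map_surjective _ Ideal.Quotient.mk_surjective q
  refine ⟨homogeneousComponent j p, homogeneousComponent_isHomogeneous _ _, ?_⟩
  rw [← homogeneousComponent_map, homogeneousComponent_of_mem hq, if_pos rfl]

theorem mem_span_image_Iio_mul_iff {A : Type*} [CommRing A] {x : ℕ → A} {B : Ideal A} {i : ℕ}
    {u : A} : u ∈ Ideal.span (x '' Set.Iio i) * B ↔
      ∃ w : ℕ → A, (∀ s, w s ∈ B) ∧ ∑ s ∈ Finset.range i, x s * w s = u := by
  constructor
  · induction i generalizing u with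
    | zero => intro hu; exact ⟨0, fun _ => zero_mem _, by simpa [eq_comm] using hu⟩
    | succ i ih =>
      intro hu
      rw [Ideal.span_image_Iio_succ, Ideal.sup_mul] at hu
      obtain ⟨y, hy, z, hz, rfl⟩ := Submodule.mem_sup.mp hu
      obtain ⟨w, hw, rfl⟩ := ih hy
      obtain ⟨b, hb, rfl⟩ := Ideal.mem_span_singleton_mul.mp hz
      refine ⟨Function.update w i b, fun s => ?_, ?_⟩
      · by_cases hs : s = i
        · simpa [hs] using hb
        · simpa [hs] using hw s
      · rw [Finset.sum_range_succ, Function.update_self]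
        refine congrArg (· + _) (Finset.sum_congr rfl fun s hs => ?_)
        rw [Function.update_of_ne (Finset.mem_range.mp hs).ne]
  · rintro ⟨w, hw, rfl⟩
    exact sum_mem fun s hs => Ideal.mul_mem_mul
      (Ideal.subset_span ⟨s, Finset.mem_range.mp hs, rfl⟩) (hw s)

theorem map_rowForm {A B : Type*} [CommRing A] [CommRing B] (φ : A →+* B)
    (M : Matrix (Fin n) (Fin n) A) (s : ℕ) : map φ (rowForm M s) = rowForm (M.map φ) s := by
  rw [rowForm, rowForm]
  split_ifs
  · simp [linearForm_apply, smul_eq_C_mul]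
  · rw [map_zero]

theorem isHomogeneous_rowForm {A : Type*} [CommRing A] (M : Matrix (Fin n) (Fin n) A) (s : ℕ) :
    (rowForm M s).IsHomogeneous 1 := by
  rw [rowForm]
  split_ifs
  · exact isHomogeneous_linearForm _
  · exact isHomogeneous_zero _ _ _

/-- Regularity of linear forms modulo the relations of small degree implies regularity in small
degrees of the corresponding elements of the Rees algebra. -/
theorem isRegularInDegree_of_rowForm {I : Ideal R} (hf : Ideal.span (Set.range f) = I)
    (M : Matrix (Fin n) (Fin n) R) {G : Ideal (MvPolynomial (Fin n) (R ⧸ K))}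
    (hG : G ≤ relationIdeal f K) {i j : ℕ}
    (hdeg : ∀ q ∈ relationIdeal f K, q.IsHomogeneous (j + 1) → q ∈ G)
    (hreg : ∀ u, rowForm (M.map (Ideal.Quotient.mk K)) i * u ∈
        Ideal.span (rowForm (M.map (Ideal.Quotient.mk K)) '' Set.Iio i) ⊔ G →
      u ∈ Ideal.span (rowForm (M.map (Ideal.Quotient.mk K)) '' Set.Iio i) ⊔ G) :
    IsRegularInDegree (fun s => eval f (rowForm M s)) I K i j := by
  subst hf
  intro u hu hau
  obtain ⟨p, hp, rfl⟩ := (Ideal.mem_span_pow_iff_exists_isHomogeneous f u).mp hu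
  obtain ⟨y, hy, z, hz, hyz⟩ := Submodule.mem_sup.mp hau
  obtain ⟨w, hw, rfl⟩ := mem_span_image_Iio_mul_iff.mp hy
  choose W hW hWw using fun s => (Ideal.mem_span_pow_iff_exists_isHomogeneous f (w s)).mp (hw s)
  have h1 : (rowForm M i * p - ∑ s ∈ Finset.range i, rowForm M s * W s).IsHomogeneous (j + 1) := by
    rw [add_comm]
    exact ((isHomogeneous_rowForm M i).mul hp).sub (IsHomogeneous.sum _ _ _ fun s _ =>
      (isHomogeneous_rowForm M s).mul (hW s))
  -- Degree `j` of the Rees quotient thus involves relations of degree `j + 1`, which is why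
  -- regularity below `t` needs relations up to `t`.
  have h2 := hdeg _ ((map_mem_relationIdeal_iff_of_isHomogeneous (f := f) (K := K) h1).mpr (by
    rw [map_sub, map_sum]
    simp only [map_mul, hWw]
    rwa [← hyz, add_sub_cancel_left])) (h1.map _)
  have h3 : map (Ideal.Quotient.mk K) p ∈
      Ideal.span (rowForm (M.map (Ideal.Quotient.mk K)) '' Set.Iio i) ⊔ G := by
    refine hreg _ ?_
    rw [map_sub, map_sum] at h2
    simp only [map_mul, map_rowForm] at h2
    rw [← add_sub_cancel (∑ s ∈ Finset.range i, rowForm (M.map (Ideal.Quotient.mk K)) s *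
      map (Ideal.Quotient.mk K) (W s)) (rowForm (M.map (Ideal.Quotient.mk K)) i * _)]
    refine add_mem (Ideal.mem_sup_left (sum_mem fun s hs => Ideal.mul_mem_right _ _
      (Ideal.subset_span ⟨s, Finset.mem_range.mp hs, rfl⟩))) (Ideal.mem_sup_right h2)
  obtain ⟨y', hy', q, hq, hyq⟩ := Submodule.mem_sup.mp h3
  rw [← Ideal.mul_top (Ideal.span _)] at hy'
  obtain ⟨U, -, rfl⟩ := mem_span_image_Iio_mul_iff.mp hy'
  -- The multipliers `U s` need not be homogeneous; only their components of degree `j - 1` matter,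
  -- and none do if `j = 0`.
  have h4 := homogeneousComponent_mem_relationIdeal (hG hq) j
  rw [← eq_sub_iff_add_eq'] at hyq
  rw [hyq, map_sub, homogeneousComponent_of_mem (hp.map _), if_pos rfl, map_sum] at h4
  cases j with
  | zero =>
    rw [Finset.sum_eq_zero fun s _ => homogeneousComponent_zero_mul (isHomogeneous_rowForm _ s) _,
      sub_zero, map_mem_relationIdeal_iff_of_isHomogeneous hp] at h4
    exact Ideal.mem_sup_right h4
  | succ j =>
    choose V hV hVU using fun s => exists_isHomogeneous_map_eq
      (homogeneousComponent_isHomogeneous j (U s))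
    have h5 : (p - ∑ s ∈ Finset.range i, rowForm M s * V s).IsHomogeneous (j + 1) := by
      refine hp.sub (IsHomogeneous.sum _ _ _ fun s _ => ?_)
      rw [add_comm]
      exact (isHomogeneous_rowForm M s).mul (hV s)
    have h6 : map (Ideal.Quotient.mk K) (p - ∑ s ∈ Finset.range i, rowForm M s * V s) ∈
        relationIdeal f K := by
      rw [map_sub, map_sum]
      simp only [map_mul, map_rowForm, hVU]
      rwa [Finset.sum_congr rfl fun s _ => homogeneousComponent_succ_mul
        (isHomogeneous_rowForm _ s) (U s) j] at h4
    rw [map_mem_relationIdeal_iff_of_isHomogeneous h5, map_sub, map_sum] at h6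
    simp only [map_mul] at h6
    rw [← add_sub_cancel (∑ s ∈ Finset.range i, eval f (rowForm M s) * eval f (V s)) (eval f p)]
    refine add_mem (Ideal.mem_sup_left (mem_span_image_Iio_mul_iff.mpr
      ⟨fun s => eval f (V s), fun s => ?_, rfl⟩)) (Ideal.mem_sup_right h6)
    exact (Ideal.mem_span_pow_iff_exists_isHomogeneous f _).mpr ⟨V s, hV s, rfl⟩

end Evaluation

/-! ### Relations of `ℛ/Kℛ` -/

section Presentation

open MvPolynomial

variable {R : Type u} [CommRing R] {n : ℕ} {I : Ideal R} {f : Fin n → R}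

/-- The presentation of the Rees algebra by generators of the ideal. -/
noncomputable def reesPresentation (hfI : ∀ i, f i ∈ I) : MvPolynomial (Fin n) R →ₐ[R] reesAlgebra I :=
  aeval fun i => reesMonomial I 1 ⟨f i, by simpa using hfI i⟩

theorem coeff_reesPresentation (hfI : ∀ i, f i ∈ I) (p : MvPolynomial (Fin n) R) (j : ℕ) :
    (reesPresentation hfI p : Polynomial R).coeff j = eval f (homogeneousComponent j p) := by
  rw [← coeff_aeval_monomial_one]
  have : (reesAlgebra I).val.comp (reesPresentation hfI) =
      aeval (R := R) fun i => Polynomial.monomial 1 (f i) := by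
    refine MvPolynomial.algHom_ext fun i => ?_
    simp [reesPresentation, coe_reesMonomial]
  rw [← this]
  rfl

theorem reesPresentation_surjective (hf : Ideal.span (Set.range f) = I) (hfI : ∀ i, f i ∈ I) :
    Function.Surjective (reesPresentation hfI) := by
  intro q
  have hq : ∀ j, (q : Polynomial R).coeff j ∈ Ideal.span (Set.range f) ^ j := fun j => by
    rw [hf]
    exact q.2 j
  choose p hp hpq using fun j => (Ideal.mem_span_pow_iff_exists_isHomogeneous f _).mp (hq j)
  refine ⟨∑ j ∈ Finset.range ((q : Polynomial R).natDegree + 1), p j, reesAlgebra_ext I fun i => ?_⟩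
  rw [coeff_reesPresentation, map_sum, map_sum]
  have h1 : ∀ j, eval f (homogeneousComponent i (p j)) =
      if i = j then (q : Polynomial R).coeff j else 0 := fun j => by
    rw [homogeneousComponent_of_mem (hp j)]
    split_ifs
    · exact hpq j
    · rw [map_zero]
  simp only [h1, Finset.sum_ite_eq, Finset.mem_range]
  split_ifs with hi
  · rfl
  · exact (Polynomial.coeff_eq_zero_of_natDegree_lt (by omega)).symm

/-- `ℛ/Kℛ` is the polynomial ring over `R/K` modulo the ideal of relations. -/
theorem ringKrullDim_quotient_relationIdeal (hf : Ideal.span (Set.range f) = I) (K : Ideal R) :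
    ringKrullDim (MvPolynomial (Fin n) (R ⧸ K) ⧸ relationIdeal f K) =
      ringKrullDim (ReesQuotient I K) := by
  have hfI : ∀ i, f i ∈ I := fun i => hf ▸ Ideal.subset_span ⟨i, rfl⟩
  let α : MvPolynomial (Fin n) R →+* ReesQuotient I K :=
    (Ideal.Quotient.mk _).comp (reesPresentation hfI : MvPolynomial (Fin n) R →+* reesAlgebra I)
  let β : MvPolynomial (Fin n) R →+* MvPolynomial (Fin n) (R ⧸ K) ⧸ relationIdeal f K :=
    (Ideal.Quotient.mk _).comp (map (Ideal.Quotient.mk K))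
  have hα : Function.Surjective α :=
    Ideal.Quotient.mk_surjective.comp (reesPresentation_surjective hf hfI)
  have hβ : Function.Surjective β :=
    Ideal.Quotient.mk_surjective.comp (map_surjective _ Ideal.Quotient.mk_surjective)
  have hker : RingHom.ker β = RingHom.ker α := by
    ext p
    rw [RingHom.mem_ker, RingHom.mem_ker, RingHom.comp_apply, RingHom.comp_apply,
      Ideal.Quotient.eq_zero_iff_mem, Ideal.Quotient.eq_zero_iff_mem, map_mem_relationIdeal_iff,
      mem_map_algebraMap_reesAlgebra_iff, hf]
    exact forall_congr' fun j => by rw [← coeff_reesPresentation hfI]; rfl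
  exact ringKrullDim_eq_of_ringEquiv ((RingHom.quotientKerEquivOfSurjective hβ).symm.trans
    ((Ideal.quotEquivOfEq hker).trans (RingHom.quotientKerEquivOfSurjective hα)))

theorem span_isHomogeneous_relationIdeal (f : Fin n → R) (K : Ideal R) :
    Ideal.span {q | q ∈ relationIdeal f K ∧ ∃ d, q.IsHomogeneous d} = relationIdeal f K := by
  refine le_antisymm (Ideal.span_le.mpr fun q hq => hq.1) fun q hq => ?_
  rw [← sum_homogeneousComponent q]
  exact sum_mem fun j _ => Ideal.subset_span ⟨homogeneousComponent_mem_relationIdeal hq j,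
    j, homogeneousComponent_isHomogeneous _ _⟩

end Presentation

/-! ### Reductions and linear forms -/

section Reductions

open MvPolynomial

variable {R : Type u} [CommRing R] {n : ℕ} {I : Ideal R} {f : Fin n → R}

/-- The residue classes of the coefficients of the elements of `J`. -/
noncomputable def coefficientSpace (f : Fin n → R) (J K : Ideal R) : Submodule (R ⧸ K) (Fin n → R ⧸ K) where
  carrier := {v | ∃ c : Fin n → R, (∀ j, Ideal.Quotient.mk K (c j) = v j) ∧ ∑ j, c j * f j ∈ J}
  zero_mem' := ⟨0, by simp, by simp⟩
  add_mem' := by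
    rintro v w ⟨c, hc, hcJ⟩ ⟨d, hd, hdJ⟩
    refine ⟨c + d, fun j => by simp [hc, hd], ?_⟩
    simpa [add_mul, Finset.sum_add_distrib] using add_mem hcJ hdJ
  smul_mem' := by
    rintro r v ⟨c, hc, hcJ⟩
    obtain ⟨r, rfl⟩ := Ideal.Quotient.mk_surjective r
    refine ⟨r • c, fun j => by simp [hc], ?_⟩
    have : ∑ j, (r • c) j * f j = r * ∑ j, c j * f j := by
      simp [Finset.mul_sum, mul_assoc]
    rw [this]
    exact J.mul_mem_left _ hcJ

theorem mem_coefficientSpace {J K : Ideal R} {v : Fin n → R ⧸ K} :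
    v ∈ coefficientSpace f J K ↔
      ∃ c : Fin n → R, (∀ j, Ideal.Quotient.mk K (c j) = v j) ∧ ∑ j, c j * f j ∈ J := Iff.rfl

theorem coefficientSpace_mono {J J' : Ideal R} (h : J ≤ J') (K : Ideal R) :
    coefficientSpace f J K ≤ coefficientSpace f J' K :=
  fun _ ⟨c, hc, hcJ⟩ => ⟨c, hc, h hcJ⟩

theorem map_linearForm {A B : Type*} [CommRing A] [CommRing B] (φ : A →+* B) (c : Fin n → A) :
    map φ (linearForm c) = linearForm fun j => φ (c j) := by
  simp [linearForm_apply, smul_eq_C_mul]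

theorem eval_linearForm {A : Type*} [CommRing A] (f c : Fin n → A) :
    eval f (linearForm c) = ∑ j, c j * f j := by
  simp [linearForm_apply]

theorem exists_eq_sum_mul {x : R} (hx : x ∈ Ideal.span (Set.range f)) :
    ∃ c : Fin n → R, ∑ j, c j * f j = x :=
  Ideal.mem_span_range_iff_exists_fun.mp hx

/-- The value of a monomial of degree `N + 1` is also the value of a form in the ideal of linear
forms coming from `J`; the two differ by a relation. -/
theorem idealOfVars_pow_le_of_pow_le (hf : Ideal.span (Set.range f) = I) {J : Ideal R}
    (hJI : J ≤ I) (K : Ideal R) {N : ℕ} (h : I ^ (N + 1) ≤ J * I ^ N) :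
    idealOfVars (Fin n) (R ⧸ K) ^ (N + 1) ≤
      relationIdeal f K ⊔ Ideal.span (linearForm '' (coefficientSpace f J K : Set _)) := by
  subst hf
  have key : ∀ u ∈ J * Ideal.span (Set.range f) ^ N, ∃ p : MvPolynomial (Fin n) R,
      p.IsHomogeneous (N + 1) ∧ eval f p = u ∧ map (Ideal.Quotient.mk K) p ∈
        Ideal.span (linearForm '' (coefficientSpace f J K : Set (Fin n → R ⧸ K))) := by
    intro u hu
    induction hu using Submodule.mul_induction_on' with
    | mem_mul_mem b hb v hv =>
      obtain ⟨p, hp, rfl⟩ := (Ideal.mem_span_pow_iff_exists_isHomogeneous f v).mp hv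
      obtain ⟨c, rfl⟩ := exists_eq_sum_mul (hJI hb)
      refine ⟨linearForm c * p, ?_, ?_, ?_⟩
      · rw [add_comm]
        exact (isHomogeneous_linearForm c).mul hp
      · rw [map_mul, eval_linearForm]
      · rw [map_mul, map_linearForm]
        exact Ideal.mul_mem_right _ _ (Ideal.subset_span ⟨_, ⟨c, fun j => rfl, hb⟩, rfl⟩)
    | add x _ y _ hx hy =>
      obtain ⟨p, hp, rfl, hpm⟩ := hx
      obtain ⟨q, hq, rfl, hqm⟩ := hy
      exact ⟨p + q, hp.add hq, map_add _ _ _, by rw [map_add]; exact add_mem hpm hqm⟩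
  rw [pow_idealOfVars_eq_span, Ideal.span_le]
  rintro _ ⟨d, hd, rfl⟩
  have hd' : (monomial d (1 : R)).IsHomogeneous (N + 1) := isHomogeneous_monomial 1 hd
  obtain ⟨p, hp, hpu, hpm⟩ := key _ (h
    ((Ideal.mem_span_pow_iff_exists_isHomogeneous f _).mpr ⟨_, hd', rfl⟩))
  have h1 : map (Ideal.Quotient.mk K) (monomial d 1 - p) ∈ relationIdeal f K := by
    rw [map_mem_relationIdeal_iff_of_isHomogeneous (hd'.sub hp), map_sub, hpu, sub_self]
    exact zero_mem _
  have h2 : monomial d (1 : R ⧸ K) =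
      map (Ideal.Quotient.mk K) (monomial d 1 - p) + map (Ideal.Quotient.mk K) p := by
    rw [← map_add, sub_add_cancel, map_monomial, map_one (Ideal.Quotient.mk K)]
  change monomial d (1 : R ⧸ K) ∈ _
  rw [h2]
  exact add_mem (Ideal.mem_sup_left h1) (Ideal.mem_sup_right hpm)

/-- Components of degree `N + 1` give `I^(N+1) ⊆ J I^N + K I^(N+1)`, and Nakayama removes the last
term. -/
theorem pow_le_of_idealOfVars_pow_le [IsLocalRing R] [IsNoetherianRing R]
    (hf : Ideal.span (Set.range f) = I) {J K : Ideal R} (hK : K ≤ maximalIdeal R) {N : ℕ}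
    (h : idealOfVars (Fin n) (R ⧸ K) ^ (N + 1) ≤
      relationIdeal f K ⊔ Ideal.span (linearForm '' (coefficientSpace f J K : Set _))) :
    I ^ (N + 1) ≤ J * I ^ N := by
  refine Submodule.le_of_le_smul_of_le_jacobson_bot (I := K) (IsNoetherian.noetherian _)
    (hK.trans (IsLocalRing.jacobson_eq_maximalIdeal _ bot_ne_top).ge) fun u hu => ?_
  subst hf
  rw [smul_eq_mul]
  obtain ⟨p, hp, rfl⟩ := (Ideal.mem_span_pow_iff_exists_isHomogeneous f u).mp hu
  have hmem : map (Ideal.Quotient.mk K) p ∈ idealOfVars (Fin n) (R ⧸ K) ^ (N + 1) := by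
    rw [mem_pow_idealOfVars_iff]
    intro d hd
    rw [Finsupp.degree_eq_weight_one]
    exact ((hp.map _) (mem_support_iff.mp hd)).ge
  obtain ⟨q, hq, y, hy, hqy⟩ := Submodule.mem_sup.mp (h hmem)
  obtain ⟨m, U, L, rfl⟩ := Submodule.mem_span_set'.mp hy
  choose v hv hvL using fun i => (L i).2
  choose c hc hcJ using hv
  choose V hV hVU using fun i => exists_isHomogeneous_map_eq
    (homogeneousComponent_isHomogeneous N (U i))
  have h4 := homogeneousComponent_mem_relationIdeal hq (N + 1)
  rw [← eq_sub_iff_add_eq] at hqy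
  rw [hqy, map_sub, homogeneousComponent_of_mem (hp.map _), if_pos rfl, map_sum] at h4
  have h5 : (p - ∑ i, linearForm (c i) * V i).IsHomogeneous (N + 1) := by
    refine hp.sub (IsHomogeneous.sum _ _ _ fun s _ => ?_)
    rw [add_comm]
    exact (isHomogeneous_linearForm _).mul (hV s)
  have h6 : map (Ideal.Quotient.mk K) (p - ∑ i, linearForm (c i) * V i) ∈
      relationIdeal f K := by
    rw [map_sub, map_sum]
    simp only [map_mul, map_linearForm, hVU, hc]
    rwa [Finset.sum_congr rfl fun i _ => by
      rw [smul_eq_mul, mul_comm, ← hvL i,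
        homogeneousComponent_succ_mul (isHomogeneous_linearForm _)]] at h4
  rw [map_mem_relationIdeal_iff_of_isHomogeneous h5, map_sub, map_sum] at h6
  simp only [map_mul, eval_linearForm] at h6
  rw [← add_sub_cancel (∑ i, (∑ j, c i j * f j) * eval f (V i)) (eval f p)]
  refine add_mem (Ideal.mem_sup_left (sum_mem fun i _ => Ideal.mul_mem_mul (hcJ i) ?_))
    (Ideal.mem_sup_right h6)
  exact (Ideal.mem_span_pow_iff_exists_isHomogeneous f _).mpr ⟨V i, hV i, rfl⟩

theorem sum_mul_mem {K : Ideal R} (hf : Ideal.span (Set.range f) = I) {c : Fin n → R}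
    (hc : ∀ j, c j ∈ K) : ∑ j, c j * f j ∈ K * I :=
  sum_mem fun j _ => Ideal.mul_mem_mul (hc j) (hf ▸ Ideal.subset_span ⟨j, rfl⟩)

/-- Coefficient vectors of an element are not unique, but two of them differ by a relation of degree
one. -/
theorem span_linearForm_coefficientSpace_le {l : ℕ} (f : Fin n → R)
    (c : Fin l → Fin n → R) (K : Ideal R) :
    Ideal.span (linearForm '' (coefficientSpace f
        (Ideal.span (Set.range fun s => ∑ j, c s j * f j)) K : Set (Fin n → R ⧸ K))) ≤
      relationIdeal f K ⊔
        Ideal.span (Set.range fun s => linearForm fun j => Ideal.Quotient.mk K (c s j)) := by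
  rw [Ideal.span_le]
  rintro _ ⟨v, ⟨d, hd, hdJ⟩, rfl⟩
  obtain ⟨r, hr⟩ := Ideal.mem_span_range_iff_exists_fun.mp hdJ
  have h1 : map (Ideal.Quotient.mk K) (linearForm (d - ∑ s, r s • c s)) ∈ relationIdeal f K := by
    rw [map_mem_relationIdeal_iff_of_isHomogeneous (isHomogeneous_linearForm _), map_sub, map_sum,
      map_sub, map_sum]
    simp only [map_smul, smul_eval, eval_linearForm, ← hr, sub_self, zero_mem]
  have hv : v = fun j => Ideal.Quotient.mk K (d j) := funext fun j => (hd j).symm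
  have h2 : linearForm v = map (Ideal.Quotient.mk K) (linearForm (d - ∑ s, r s • c s)) +
      ∑ s, C (Ideal.Quotient.mk K (r s)) * linearForm fun j => Ideal.Quotient.mk K (c s j) := by
    simp only [hv, ← map_linearForm, ← map_C, ← map_mul, ← map_sum, ← map_add]
    congr 1
    simp only [map_sub, map_sum, map_smul, smul_eq_C_mul, sub_add_cancel]
  rw [SetLike.mem_coe, h2]
  exact add_mem (Ideal.mem_sup_left h1) (Ideal.mem_sup_right (sum_mem fun s _ =>
    Ideal.mul_mem_left _ _ (Ideal.subset_span ⟨s, rfl⟩)))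

end Reductions

/-! ### Minimal reductions and general reductions -/

section MinimalReductions

open MvPolynomial

attribute [local instance] MvPolynomial.gradedAlgebra

variable {R : Type u} [CommRing R] [IsLocalRing R] [IsNoetherianRing R] {n : ℕ} {I : Ideal R}
  {f : Fin n → R}

theorem pow_succ_eq_mul_pow_iff (hf : Ideal.span (Set.range f) = I) {J : Ideal R} (hJI : J ≤ I)
    {N : ℕ} : I ^ (N + 1) = J * I ^ N ↔
      idealOfVars (Fin n) (R ⧸ maximalIdeal R) ^ (N + 1) ≤ relationIdeal f (maximalIdeal R) ⊔
        Ideal.span (linearForm '' (coefficientSpace f J (maximalIdeal R) : Set _)) := by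
  refine ⟨fun h => idealOfVars_pow_le_of_pow_le hf hJI _ h.le, fun h => le_antisymm
    (pow_le_of_idealOfVars_pow_le hf le_rfl h) ?_⟩
  rw [pow_succ']
  exact Ideal.mul_mono_left hJI

theorem pow_succ_eq_mul_pow_of_coefficientSpace_le (hf : Ideal.span (Set.range f) = I)
    {J J' : Ideal R} (hJI : J ≤ I) (hJI' : J' ≤ I)
    (hle : coefficientSpace f J (maximalIdeal R) ≤ coefficientSpace f J' (maximalIdeal R))
    {N : ℕ} (h : I ^ (N + 1) = J * I ^ N) : I ^ (N + 1) = J' * I ^ N :=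
  (pow_succ_eq_mul_pow_iff hf hJI').mpr (((pow_succ_eq_mul_pow_iff hf hJI).mp h).trans
    (sup_le_sup_left (Ideal.span_mono (Set.image_mono hle)) _))

/-- Coefficients of relations between minimal generators modulo `𝔪I` lie in `𝔪`. -/
theorem mem_maximalIdeal_of_sum_mem (hf : Ideal.span (Set.range f) = I)
    (hn : Submodule.spanFinrank I = n) {c : Fin n → R}
    (hc : ∑ j, c j * f j ∈ maximalIdeal R * I) (i : Fin n) : c i ∈ maximalIdeal R := by
  by_contra hi
  obtain ⟨v, hv⟩ := (notMem_maximalIdeal.mp hi).exists_left_inv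
  have hle : I ≤ Ideal.span (f '' {i}ᶜ) := by
    refine Submodule.le_of_le_smul_of_le_jacobson_bot (I := maximalIdeal R)
      (IsNoetherian.noetherian _) (IsLocalRing.jacobson_eq_maximalIdeal _ bot_ne_top).ge ?_
    rw [smul_eq_mul]
    conv_lhs => rw [← hf]
    rw [Ideal.span_le]
    rintro _ ⟨j, rfl⟩
    have hne : ∀ j, j ≠ i → f j ∈ Ideal.span (f '' {i}ᶜ) := fun j hj =>
      Ideal.subset_span ⟨j, hj, rfl⟩
    by_cases hj : j = i
    · subst hj
      have hsum := Finset.add_sum_erase Finset.univ (fun j => c j * f j) (Finset.mem_univ j)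
      have h1 : f j = v * (∑ j, c j * f j) - v * ∑ x ∈ Finset.univ.erase j, c x * f x := by
        rw [← hsum]
        linear_combination (-f j) * hv
      rw [SetLike.mem_coe, h1]
      refine sub_mem (Ideal.mem_sup_right (Ideal.mul_mem_left _ _ hc)) (Ideal.mem_sup_left
        (Ideal.mul_mem_left _ _ (sum_mem fun x hx => Ideal.mul_mem_left _ _
          (hne x (Finset.ne_of_mem_erase hx)))))
    · exact Ideal.mem_sup_left (hne j hj)
  have hge : Ideal.span (f '' {i}ᶜ) ≤ I := hf ▸ Ideal.span_mono (Set.image_subset_range _ _)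
  have h1 := Submodule.spanFinrank_span_le_ncard_of_finite (R := R)
    (Set.toFinite (f '' ({i}ᶜ : Set (Fin n))))
  have h2 := Set.ncard_image_le (f := f) (Set.toFinite ({i}ᶜ : Set (Fin n)))
  have h3 : ({i}ᶜ : Set (Fin n)).ncard < n := by
    have := Set.ncard_add_ncard_compl ({i} : Set (Fin n))
    rw [Set.ncard_singleton, Nat.card_eq_fintype_card, Fintype.card_fin] at this
    omega
  have h4 : Submodule.span R (f '' ({i}ᶜ : Set (Fin n))) = I := le_antisymm hge hle
  rw [h4, hn] at h1
  omega

/-- Take a reduction whose image in `I/𝔪I` has least dimension and lift a basis of that image to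
elements `e i`. They generate a reduction. A reduction `L` inside it has the same image, and
independence of the basis turns congruence modulo `𝔪I` into congruence modulo `𝔪(e)`, so Nakayama
gives equality. -/
theorem exists_isMinimalReductionOf (hf : Ideal.span (Set.range f) = I)
    (hn : Submodule.spanFinrank I = n) : ∃ J, IsMinimalReductionOf J I := by
  let _ := Ideal.Quotient.field (maximalIdeal R)
  obtain ⟨J, hJ, hmin⟩ := exists_minimalFor_of_wellFoundedLT (fun J => IsReductionOf J I)
    (fun J => Module.finrank (R ⧸ maximalIdeal R) (coefficientSpace f J (maximalIdeal R)))
    ⟨I, le_rfl, 0, by rw [zero_add, pow_one, pow_zero, mul_one]⟩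
  obtain ⟨hJI, N, hN⟩ := hJ
  let b := Module.finBasis (R ⧸ maximalIdeal R) (coefficientSpace f J (maximalIdeal R))
  choose c hc hcJ using fun i => mem_coefficientSpace.mp (b i).2
  set e := fun i => ∑ j, c i j * f j with he
  have hle : Ideal.span (Set.range e) ≤ J := by
    rw [Ideal.span_le]
    rintro _ ⟨i, rfl⟩
    exact hcJ i
  have hV : coefficientSpace f J (maximalIdeal R) ≤
      coefficientSpace f (Ideal.span (Set.range e)) (maximalIdeal R) := by
    intro v hv
    have h1 := congrArg Subtype.val (b.sum_repr ⟨v, hv⟩)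
    rw [AddSubmonoidClass.coe_finsetSum] at h1
    rw [show v = _ from h1.symm]
    refine sum_mem fun i _ => Submodule.smul_mem _ _ ?_
    exact ⟨c i, hc i, Ideal.subset_span ⟨i, rfl⟩⟩
  refine ⟨Ideal.span (Set.range e), ⟨hle.trans hJI, N,
    pow_succ_eq_mul_pow_of_coefficientSpace_le hf hJI (hle.trans hJI) hV hN⟩, ?_⟩
  rintro L ⟨hLI, N', hN'⟩ hL
  have hVL : coefficientSpace f L (maximalIdeal R) = coefficientSpace f J (maximalIdeal R) := by
    have h1 : coefficientSpace f L (maximalIdeal R) ≤ coefficientSpace f J (maximalIdeal R) :=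
      coefficientSpace_mono (hL.trans hle) _
    exact Submodule.eq_of_le_of_finrank_le h1 (hmin ⟨hLI, N', hN'⟩ (Submodule.finrank_mono h1))
  refine Submodule.le_of_le_smul_of_le_jacobson_bot (I := maximalIdeal R)
    (IsNoetherian.noetherian _) (IsLocalRing.jacobson_eq_maximalIdeal _ bot_ne_top).ge ?_
  rw [smul_eq_mul]
  conv_lhs => rw [Ideal.span]
  rw [Submodule.span_le]
  rintro _ ⟨i, rfl⟩
  have hi : (b i : Fin n → R ⧸ maximalIdeal R) ∈ coefficientSpace f L (maximalIdeal R) := by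
    rw [hVL]
    exact (b i).2
  obtain ⟨d, hd, hdL⟩ := hi
  have hx : e i - ∑ j, d j * f j ∈ maximalIdeal R * I := by
    have : e i - ∑ j, d j * f j = ∑ j, (c i j - d j) * f j := by
      simp only [he, sub_mul, Finset.sum_sub_distrib]
    rw [this]
    exact sum_mul_mem hf fun j => Ideal.Quotient.eq.mp ((hc i j).trans (hd j).symm)
  have hx' : e i - ∑ j, d j * f j ∈ Ideal.span (Set.range e) :=
    sub_mem (Ideal.subset_span ⟨i, rfl⟩) (hL hdL)
  obtain ⟨r, hr⟩ := Ideal.mem_span_range_iff_exists_fun.mp hx'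
  have hr0 : ∀ s, r s ∈ maximalIdeal R := by
    have h1 : ∑ j, (∑ s, r s * c s j) * f j ∈ maximalIdeal R * I := by
      have : ∑ j, (∑ s, r s * c s j) * f j = e i - ∑ j, d j * f j := by
        rw [← hr]
        simp only [he, Finset.sum_mul, Finset.mul_sum]
        rw [Finset.sum_comm]
        simp only [mul_assoc]
      rwa [this]
    have h2 := mem_maximalIdeal_of_sum_mem hf hn h1
    have h3 : ∑ s, Ideal.Quotient.mk (maximalIdeal R) (r s) • b s = 0 := by
      apply Subtype.ext
      rw [AddSubmonoidClass.coe_finsetSum]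
      funext j
      rw [Finset.sum_apply]
      have := Ideal.Quotient.eq_zero_iff_mem.mpr (h2 j)
      rw [map_sum] at this
      simpa [hc] using this
    intro s
    exact Ideal.Quotient.eq_zero_iff_mem.mp
      (Fintype.linearIndependent_iff.mp b.linearIndependent _ h3 s)
  rw [SetLike.mem_coe, ← add_sub_cancel (∑ j, d j * f j) (e i), ← hr]
  exact add_mem (Ideal.mem_sup_left hdL) (Ideal.mem_sup_right (sum_mem fun s _ =>
    Ideal.mul_mem_mul (hr0 s) (Ideal.subset_span ⟨s, rfl⟩)))

/-- Existence of a minimal reduction ensures that the infimum in `reductionNumber` is attained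
rather than the default `0` of an empty set. -/
theorem exists_isMinimalReductionOf_pow_succ_eq (hf : Ideal.span (Set.range f) = I)
    (hn : Submodule.spanFinrank I = n) {t : ℕ} (hr : reductionNumber I ≤ t) :
    ∃ J, IsMinimalReductionOf J I ∧ I ^ (t + 1) = J * I ^ t := by
  obtain ⟨J₀, hJ₀⟩ := exists_isMinimalReductionOf hf hn
  obtain ⟨J, hJ, hJr⟩ : reductionNumber I ∈
      {r : ℕ | ∃ J : Ideal R, IsMinimalReductionOf J I ∧ reductionNumberWrt J I = r} :=
    Nat.sInf_mem ⟨_, J₀, hJ₀, rfl⟩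
  have hmem : I ^ (reductionNumberWrt J I + 1) = J * I ^ reductionNumberWrt J I :=
    Nat.sInf_mem (s := {r : ℕ | I ^ (r + 1) = J * I ^ r}) hJ.1.2
  rw [← hJr] at hr
  obtain ⟨e, rfl⟩ := Nat.exists_eq_add_of_le hr
  refine ⟨J, hJ, ?_⟩
  rw [add_right_comm, pow_add, hmem, mul_assoc, ← pow_add]

theorem idealOfVars_pow_le_iff {l : ℕ} (hf : Ideal.span (Set.range f) = I)
    (c : Fin l → Fin n → R) {N : ℕ} :
    idealOfVars (Fin n) (R ⧸ maximalIdeal R) ^ (N + 1) ≤ relationIdeal f (maximalIdeal R) ⊔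
        Ideal.span (Set.range fun s => linearForm fun j =>
          Ideal.Quotient.mk (maximalIdeal R) (c s j)) ↔
      I ^ (N + 1) = Ideal.span (Set.range fun s => ∑ j, c s j * f j) * I ^ N := by
  have hle : Ideal.span (Set.range fun s => ∑ j, c s j * f j) ≤ I := by
    rw [Ideal.span_le, ← hf]
    rintro _ ⟨s, rfl⟩
    exact sum_mem fun j _ => Ideal.mul_mem_left _ _ (Ideal.subset_span ⟨j, rfl⟩)
  rw [pow_succ_eq_mul_pow_iff hf hle]
  have h1 := span_linearForm_coefficientSpace_le f c (maximalIdeal R)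
  have h2 : (Set.range fun s => linearForm fun j => Ideal.Quotient.mk (maximalIdeal R) (c s j)) ⊆
      linearForm '' (coefficientSpace f (Ideal.span (Set.range fun s => ∑ j, c s j * f j))
        (maximalIdeal R) : Set (Fin n → R ⧸ maximalIdeal R)) := by
    rintro _ ⟨s, rfl⟩
    exact ⟨_, ⟨c s, fun j => rfl, Ideal.subset_span ⟨s, rfl⟩⟩, rfl⟩
  exact ⟨fun h => h.trans (sup_le_sup_left (Ideal.span_mono h2) _),
    fun h => h.trans (sup_le le_sup_left h1)⟩

/-- General elements generate a reduction with reduction number at most `t`. -/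
theorem exists_ne_zero_pow_succ_eq [Infinite (R ⧸ maximalIdeal R)]
    (hf : Ideal.span (Set.range f) = I) (hn : Submodule.spanFinrank I = n) {l t : ℕ}
    (hl : HasAnalyticSpread I l) (hr : reductionNumber I ≤ t) :
    ∃ p : MvPolynomial (Fin l × Fin n) (R ⧸ maximalIdeal R), p ≠ 0 ∧ ∀ c : Fin l → Fin n → R,
      eval (fun x => Ideal.Quotient.mk (maximalIdeal R) (c x.1 x.2)) p ≠ 0 →
        I ^ (t + 1) = Ideal.span (Set.range fun s => ∑ j, c s j * f j) * I ^ t := by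
  let _ := Ideal.Quotient.field (maximalIdeal R)
  obtain ⟨J, hJ, hJt⟩ := exists_isMinimalReductionOf_pow_succ_eq hf hn hr
  have hE : (relationIdeal f (maximalIdeal R)).IsHomogeneous
      (homogeneousSubmodule (Fin n) (R ⧸ maximalIdeal R)) := by
    rw [← span_isHomogeneous_relationIdeal]
    exact isHomogeneous_span fun q hq => hq.2
  have hdim : ringKrullDim (MvPolynomial (Fin n) (R ⧸ maximalIdeal R) ⧸
      relationIdeal f (maximalIdeal R)) ≤ l :=
    ((ringKrullDim_quotient_relationIdeal hf _).trans hl).le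
  have h1 := (pow_succ_eq_mul_pow_iff hf hJ.1.1).mp hJt
  -- Normalizing inside the coefficient space of `J` yields `l` elements of `J` generating a
  -- reduction. By minimality they generate `J`, so the exponent `t` of `J` is available for the
  -- openness argument.
  obtain ⟨c, hcV, hc⟩ := exists_linearForm_of_ringKrullDim_le l hE hdim
    (coefficientSpace f J (maximalIdeal R)) fun x hx => ⟨t + 1, h1 (Ideal.pow_mem_pow hx _)⟩
  obtain ⟨N, hN⟩ := idealOfVars_pow_le hc
  choose d hd hdJ using hcV
  obtain rfl : (fun s j => Ideal.Quotient.mk (maximalIdeal R) (d s j)) = c :=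
    funext fun s => funext fun j => hd s j
  have hle : Ideal.span (Set.range fun s => ∑ j, d s j * f j) ≤ J := by
    rw [Ideal.span_le]
    rintro _ ⟨s, rfl⟩
    exact hdJ s
  have hred : IsReductionOf (Ideal.span (Set.range fun s => ∑ j, d s j * f j)) I :=
    ⟨hle.trans hJ.1.1, N, (idealOfVars_pow_le_iff hf d).mp
      ((Ideal.pow_le_pow_right N.le_succ).trans hN)⟩
  have hJd := le_antisymm hle (hJ.2 hred hle)
  rw [← hJd] at hJt
  obtain ⟨p, hp0, hp⟩ := exists_ne_zero_idealOfVars_pow_le hE (t + 1) _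
    ((idealOfVars_pow_le_iff hf d).mpr hJt)
  exact ⟨p, hp0, fun c hc => (idealOfVars_pow_le_iff hf c).mp (hp _ hc)⟩

end MinimalReductions

/-! ### Relations of small degree -/

section SmallDegree

open MvPolynomial

theorem homogeneousComponent_mul_of_isHomogeneous {σ A : Type*} [CommRing A]
    {g : MvPolynomial σ A} {e : ℕ} (hg : g.IsHomogeneous e) (p : MvPolynomial σ A) (d : ℕ) :
    homogeneousComponent d (p * g) =
      if e ≤ d then homogeneousComponent (d - e) p * g else 0 := by
  rw [← coeff_degreeHom, map_mul, degreeHom_of_isHomogeneous hg, ← Polynomial.C_mul_X_pow_eq_monomial,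
    ← mul_assoc, Polynomial.coeff_mul_X_pow', Polynomial.coeff_mul_C, coeff_degreeHom]

/-- In the component of degree `d` of a representation of `q`, generators of degree above `d` drop
out. -/
theorem mem_span_totalDegree_le {A : Type*} [CommRing A] {n t d : ℕ}
    {G : Set (MvPolynomial (Fin n) A)} (hG : ∀ g ∈ G, ∃ e, g.IsHomogeneous e)
    {q : MvPolynomial (Fin n) A} (hq : q ∈ Ideal.span G) (hd : q.IsHomogeneous d) (hdt : d ≤ t) :
    q ∈ Ideal.span {g ∈ G | g.totalDegree ≤ t} := by
  obtain ⟨m, U, g, hqU⟩ := Submodule.mem_span_set'.mp hq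
  have h1 := homogeneousComponent_of_mem hd (m := d)
  rw [if_pos rfl, ← hqU, map_sum] at h1
  rw [← hqU, ← h1]
  refine sum_mem fun i _ => ?_
  obtain ⟨e, he⟩ := hG _ (g i).2
  rw [smul_eq_mul, homogeneousComponent_mul_of_isHomogeneous he]
  split_ifs with hed
  · exact Ideal.mul_mem_left _ _ (Ideal.subset_span ⟨(g i).2, he.totalDegree_le.trans (hed.trans hdt)⟩)
  · exact zero_mem _

theorem Set.exists_subset_pair_zero_of_encard_le_one {α : Type*} [Zero α] {T : Set α}
    (hT : T.encard ≤ 1) : ∃ x, (x ∈ T ∨ x = 0) ∧ T ⊆ {x, 0} := by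
  rcases Set.encard_le_one_iff_eq.mp hT with rfl | ⟨x, rfl⟩
  · exact ⟨0, Or.inr rfl, Set.empty_subset _⟩
  · exact ⟨x, Or.inl rfl, by simp⟩

theorem Set.exists_subset_pair_of_encard_le_two {α : Type*} [Zero α] {T : Set α}
    (hT : T.encard ≤ 2) : ∃ x y, (x ∈ T ∨ x = 0) ∧ (y ∈ T ∨ y = 0) ∧ T ⊆ {x, y} := by
  rcases hT.lt_or_eq with hT | hT
  · obtain ⟨x, hx, hxT⟩ := Set.exists_subset_pair_zero_of_encard_le_one
      (Order.le_of_lt_add_one (hT.trans_eq one_add_one_eq_two.symm))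
    exact ⟨x, 0, hx, Or.inr rfl, hxT⟩
  · obtain ⟨x, y, -, rfl⟩ := Set.encard_eq_two.mp hT
    exact ⟨x, y, Or.inl (by simp), Or.inl (by simp), le_rfl⟩

variable {R : Type u} [CommRing R] {n : ℕ} {f : Fin n → R} {K : Ideal R}

theorem HasAtMostGeneratingRelations.exists_pair {t N : ℕ}
    (h : HasAtMostGeneratingRelations f K t N) (hN : N ≤ 2) :
    ∃ g h : MvPolynomial (Fin n) (R ⧸ K), (∃ d, g.IsHomogeneous d) ∧ (∃ d, h.IsHomogeneous d) ∧
      (N ≤ 1 → h = 0) ∧ Ideal.span {g, h} ≤ relationIdeal f K ∧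
      ∀ q ∈ relationIdeal f K, ∀ d ≤ t, q.IsHomogeneous d → q ∈ Ideal.span {g, h} := by
  obtain ⟨G, ⟨⟨hGhom, hGspan⟩, -⟩, hcard⟩ := h
  have key : ∀ x, x ∈ {g ∈ G | g.totalDegree ≤ t} ∨ x = 0 →
      (∃ d, x.IsHomogeneous d) ∧ x ∈ relationIdeal f K := by
    rintro x (hx | rfl)
    · exact ⟨hGhom x hx.1, hGspan ▸ Ideal.subset_span hx.1⟩
    · exact ⟨⟨0, isHomogeneous_zero _ _ _⟩, zero_mem _⟩
  obtain ⟨g, h, hg, hh, hN1, hsub⟩ : ∃ g h, (g ∈ {g ∈ G | g.totalDegree ≤ t} ∨ g = 0) ∧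
      (h ∈ {g ∈ G | g.totalDegree ≤ t} ∨ h = 0) ∧ (N ≤ 1 → h = 0) ∧
      {g ∈ G | g.totalDegree ≤ t} ⊆ {g, h} := by
    by_cases h1 : N ≤ 1
    · obtain ⟨x, hx, hxT⟩ := Set.exists_subset_pair_zero_of_encard_le_one
        (hcard.trans (by exact_mod_cast h1))
      exact ⟨x, 0, hx, Or.inr rfl, fun _ => rfl, hxT⟩
    · obtain ⟨x, y, hx, hy, hT⟩ := Set.exists_subset_pair_of_encard_le_two
        (hcard.trans (by exact_mod_cast hN))
      exact ⟨x, y, hx, hy, fun h => absurd h h1, hT⟩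
  refine ⟨g, h, (key g hg).1, (key h hh).1, hN1, ?_, fun q hq d hd hqd => ?_⟩
  · rw [Ideal.span_le]
    rintro _ (rfl | rfl)
    exacts [(key _ hg).2, (key _ hh).2]
  · exact Ideal.span_mono hsub (mem_span_totalDegree_le hGhom (hGspan ▸ hq) hqd hd)

variable [IsLocalRing R]

theorem le_of_hasAnalyticSpread {I : Ideal R} (hf : Ideal.span (Set.range f) = I) {l : ℕ}
    (hl : HasAnalyticSpread I l) : l ≤ n := by
  let _ := Ideal.Quotient.field (maximalIdeal R)
  have h1 := ringKrullDim_quotient_le (relationIdeal f (maximalIdeal R))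
  rw [ringKrullDim_quotient_relationIdeal hf, hl, MvPolynomial.ringKrullDim_of_isNoetherianRing,
    ringKrullDim_eq_zero_of_field] at h1
  simpa using h1

/-- A nonzero relation would make the dimension of the special fiber ring smaller than `n`. -/
theorem relationIdeal_eq_bot_of_hasAnalyticSpread {I : Ideal R}
    (hf : Ideal.span (Set.range f) = I) (hl : HasAnalyticSpread I n) :
    relationIdeal f (maximalIdeal R) = ⊥ := by
  let _ := Ideal.Quotient.field (maximalIdeal R)
  rw [eq_bot_iff]
  intro q hq
  by_contra hq0
  have h1 := ringKrullDim_quotient_span_singleton_add_one_le (d := q) hq0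
  have h2 : ringKrullDim (MvPolynomial (Fin n) (R ⧸ maximalIdeal R) ⧸
      relationIdeal f (maximalIdeal R)) ≤
      ringKrullDim (MvPolynomial (Fin n) (R ⧸ maximalIdeal R) ⧸ Ideal.span {q}) :=
    ringKrullDim_le_of_surjective _ (Ideal.Quotient.factor_surjective
      ((Ideal.span_singleton_le_iff_mem _).mpr hq))
  rw [ringKrullDim_quotient_relationIdeal hf, hl] at h2
  have h3 : ((n + 1 : ℕ) : WithBot ℕ∞) ≤ n := by
    refine le_trans ?_ h1
    push_cast
    gcongr
  exact absurd (by exact_mod_cast h3) (Nat.not_succ_le_self n)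

theorem exists_pair_of_hasAtMostGeneratingRelations
    {I : Ideal R} (hf : Ideal.span (Set.range f) = I) {l t : ℕ} (hl : HasAnalyticSpread I l)
    (hb₁ : l + 2 ≤ n → HasAtMostGeneratingRelations f (maximalIdeal R) t 2)
    (hb₂ : n = l + 1 → HasAtMostGeneratingRelations f (maximalIdeal R) t 1) :
    ∃ g h : MvPolynomial (Fin n) (R ⧸ maximalIdeal R), (∃ d, g.IsHomogeneous d) ∧
      (∃ d, h.IsHomogeneous d) ∧ (l + 2 ≤ n ∨ l + 1 ≤ n ∧ h = 0 ∨ l ≤ n ∧ g = 0 ∧ h = 0) ∧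
      Ideal.span {g, h} ≤ relationIdeal f (maximalIdeal R) ∧
      ∀ q ∈ relationIdeal f (maximalIdeal R), ∀ d ≤ t, q.IsHomogeneous d →
        q ∈ Ideal.span {g, h} := by
  have hln := le_of_hasAnalyticSpread hf hl
  rcases (by omega : l + 2 ≤ n ∨ n = l + 1 ∨ n = l) with h2 | h1 | h0
  · obtain ⟨g, h, hg, hh, -, hle, hdeg⟩ := (hb₁ h2).exists_pair le_rfl
    exact ⟨g, h, hg, hh, Or.inl h2, hle, hdeg⟩
  · obtain ⟨g, h, hg, hh, h0, hle, hdeg⟩ := (hb₂ h1).exists_pair one_le_two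
    exact ⟨g, h, hg, hh, Or.inr (Or.inl ⟨h1.ge, h0 le_rfl⟩), hle, hdeg⟩
  · subst h0
    have hbot := relationIdeal_eq_bot_of_hasAnalyticSpread hf hl
    refine ⟨0, 0, ⟨0, isHomogeneous_zero _ _ _⟩, ⟨0, isHomogeneous_zero _ _ _⟩,
      Or.inr (Or.inr ⟨le_rfl, rfl, rfl⟩), ?_, fun q hq _ _ _ => ?_⟩
    · simp
    · rw [hbot] at hq
      rw [Ideal.mem_bot.mp hq]
      exact zero_mem _

/-- The elements with general coefficients, followed by some of the generators, are regular in
small degrees on the special fiber ring. -/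
theorem exists_ne_zero_isRegularInDegree_maximalIdeal [Infinite (R ⧸ maximalIdeal R)]
    {I : Ideal R} (hf : Ideal.span (Set.range f) = I) {l t : ℕ} (hl : HasAnalyticSpread I l)
    (hb₁ : l + 2 ≤ n → HasAtMostGeneratingRelations f (maximalIdeal R) t 2)
    (hb₂ : n = l + 1 → HasAtMostGeneratingRelations f (maximalIdeal R) t 1) :
    ∃ p : MvPolynomial (Fin l × Fin n) (R ⧸ maximalIdeal R), p ≠ 0 ∧ ∀ c : Fin l → Fin n → R,
      eval (fun x => Ideal.Quotient.mk (maximalIdeal R) (c x.1 x.2)) p ≠ 0 →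
        ∀ i < l, ∀ j < t,
          IsRegularInDegree (fun s => eval f (rowForm (completedMatrix c) s)) I (maximalIdeal R) i j := by
  obtain ⟨g, h, ⟨dg, hg⟩, ⟨dh, hh⟩, hcond, hle, hdeg⟩ :=
    exists_pair_of_hasAtMostGeneratingRelations hf hl hb₁ hb₂
  let _ := Ideal.Quotient.field (maximalIdeal R)
  obtain ⟨p, hp0, hp⟩ := exists_ne_zero_rowForm_regular (l := l) hg hh hcond
  refine ⟨p, hp0, fun c hc i hi j hj => isRegularInDegree_of_rowForm hf _ hle
    (fun q hq hqd => hdeg q hq (j + 1) hj hqd) ?_⟩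
  rw [completedMatrix_map]
  exact hp (fun s j => Ideal.Quotient.mk (maximalIdeal R) (c s j)) hc i hi

/-- Without relations it suffices that the completed matrix is invertible over `R ⧸ K`. Its
determinant over `R` is a unit as soon as it is nonzero in the residue field. -/
theorem exists_ne_zero_isRegularInDegree_of_hasNoRelations
    {I : Ideal R} (hf : Ideal.span (Set.range f) = I) {l t : ℕ} (hln : l ≤ n)
    (hb : HasNoRelations f K t) :
    ∃ p : MvPolynomial (Fin l × Fin n) (R ⧸ maximalIdeal R), p ≠ 0 ∧ ∀ c : Fin l → Fin n → R,
      eval (fun x => Ideal.Quotient.mk (maximalIdeal R) (c x.1 x.2)) p ≠ 0 →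
        ∀ i < l, ∀ j < t,
          IsRegularInDegree (fun s => eval f (rowForm (completedMatrix c) s)) I K i j := by
  obtain ⟨p, hp0, hp⟩ := exists_ne_zero_det_completedMatrix (R ⧸ maximalIdeal R) hln
  refine ⟨p, hp0, fun c hc i hi j hj => isRegularInDegree_of_rowForm (G := ⊥) hf _ bot_le
    (fun q hq hqd => Ideal.mem_bot.mpr (hb q hq (j + 1) hj hqd)) fun u hu => ?_⟩
  have h1 : IsUnit (completedMatrix c).det := by
    rw [← notMem_maximalIdeal]
    intro hmem
    refine hp (fun s j => Ideal.Quotient.mk (maximalIdeal R) (c s j)) hc ?_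
    rw [← det_completedMatrix_map (Ideal.Quotient.mk (maximalIdeal R))]
    exact Ideal.Quotient.eq_zero_iff_mem.mpr hmem
  have h2 : IsUnit ((completedMatrix c).map (Ideal.Quotient.mk K)).det := by
    rw [completedMatrix_map, ← det_completedMatrix_map]
    exact h1.map _
  rw [sup_bot_eq] at hu ⊢
  exact isRegularUpTo_rowForm (Matrix.mul_nonsing_inv _ h2) (Matrix.nonsing_inv_mul _ h2) i
    (hi.trans_le hln) u hu

end SmallDegree

/-! ### Assembling the theorem -/

section Main

variable {R : Type u} [CommRing R] {l n : ℕ}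

theorem eval_rowForm_completedMatrix (hln : l ≤ n) (f : Fin n → R) (c : Fin l → Fin n → R)
    (i : Fin l) : MvPolynomial.eval f (rowForm (completedMatrix c) i) = ∑ j, c i j * f j := by
  rw [rowForm, dif_pos (i.2.trans_le hln), eval_linearForm]
  simp [completedMatrix]

theorem initialIdeal_eq_span_image_Iio {a : Fin l → R} {b : ℕ → R} (hab : ∀ i : Fin l, b i = a i)
    {i : ℕ} (hi : i ≤ l) : initialIdeal a i = Ideal.span (b '' Set.Iio i) := by
  refine congrArg Ideal.span (Set.ext fun x => ⟨?_, ?_⟩)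
  · rintro ⟨j, hj, rfl⟩
    exact ⟨j, hj, hab j⟩
  · rintro ⟨j, hj, rfl⟩
    exact ⟨⟨j, lt_of_lt_of_le hj hi⟩, hj, hab ⟨j, lt_of_lt_of_le hj hi⟩⟩

theorem initialIdeal_eq_span_range (a : Fin l → R) :
    initialIdeal a l = Ideal.span (Set.range a) := by
  refine congrArg Ideal.span (Set.ext fun x => ⟨?_, ?_⟩)
  · rintro ⟨j, -, rfl⟩
    exact ⟨j, rfl⟩
  · rintro ⟨j, rfl⟩
    exact ⟨j, j.2, rfl⟩

end Main

theorem mainTheorem1 {R : Type u} [CommRing R] [IsLocalRing R] [IsNoetherianRing R]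
    [Infinite (ResidueField R)]
    (I : Ideal R) (l n t : ℕ)
    (hl : HasAnalyticSpread I l)
    (hn : Submodule.spanFinrank I = n)
    (f : Fin n → R) (hf : Ideal.span (Set.range f) = I)
    (ht : 0 < t) (hr : reductionNumber I ≤ t)
    (K : Ideal R) (hK : K.IsPrimary ∧ K.radical = maximalIdeal R)
    (hb₁ : K = maximalIdeal R → l + 2 ≤ n → HasAtMostGeneratingRelations f K t 2)
    (hb₂ : K = maximalIdeal R → n = l + 1 → HasAtMostGeneratingRelations f K t 1)
    (hb₃ : K ≠ maximalIdeal R → HasNoRelations f K t) :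
    HoldsForGeneralElements f l (fun a : Fin l → R =>
      (∀ i : Fin l,
        (initialIdeal a i * I ^ (t - 1)).colon {a i} ⊓ I ^ t = initialIdeal a i * I ^ (t - 1)) →
      IsCohenMacaulay (ReesQuotient I K)) := by
  have hinf : Infinite (R ⧸ maximalIdeal R) := ‹Infinite (ResidueField R)›
  have hln := le_of_hasAnalyticSpread hf hl
  obtain ⟨p₁, hp₁0, hp₁⟩ := exists_ne_zero_pow_succ_eq hf hn hl hr
  obtain ⟨p₂, hp₂0, hp₂⟩ : ∃ p : MvPolynomial (Fin l × Fin n) (R ⧸ maximalIdeal R), p ≠ 0 ∧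
      ∀ c : Fin l → Fin n → R,
        MvPolynomial.eval (fun x => Ideal.Quotient.mk (maximalIdeal R) (c x.1 x.2)) p ≠ 0 →
          ∀ i < l, ∀ j < t, IsRegularInDegree
            (fun s => MvPolynomial.eval f (rowForm (completedMatrix c) s)) I K i j := by
    by_cases hKm : K = maximalIdeal R
    · subst hKm
      exact exists_ne_zero_isRegularInDegree_maximalIdeal hf hl (hb₁ rfl) (hb₂ rfl)
    · exact exists_ne_zero_isRegularInDegree_of_hasNoRelations hf hln (hb₃ hKm)
  have hp0 : p₁ * p₂ ≠ 0 := mul_ne_zero hp₁0 hp₂0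
  refine ⟨p₁ * p₂, hp0, fun c hc ha => ?_⟩
  have hc' : MvPolynomial.eval (fun x => Ideal.Quotient.mk (maximalIdeal R) (c x.1 x.2)) p₁ *
      MvPolynomial.eval (fun x => Ideal.Quotient.mk (maximalIdeal R) (c x.1 x.2)) p₂ ≠ 0 := by
    rw [← map_mul]
    exact hc
  -- With `t = τ + 1`, the relations cover degrees `j ≤ τ` and condition (a) starts the induction at
  -- degree `τ + 1`.
  obtain ⟨τ, rfl⟩ := Nat.exists_eq_add_of_lt ht
  rw [zero_add] at *
  set b : ℕ → R := fun s => MvPolynomial.eval f (rowForm (completedMatrix c) s) with hb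
  have hba : ∀ i : Fin l, b i = ∑ j, c i j * f j := eval_rowForm_completedMatrix hln f c
  have hbI : ∀ s, b s ∈ I := fun s => by
    have := (Ideal.mem_span_pow_iff_exists_isHomogeneous f (b s)).mpr
      ⟨_, isHomogeneous_rowForm (completedMatrix c) s, rfl⟩
    rwa [pow_one, hf] at this
  have hJ : I ^ (τ + 1 + 1) = Ideal.span (b '' Set.Iio l) * I ^ (τ + 1) := by
    rw [← initialIdeal_eq_span_image_Iio hba le_rfl, initialIdeal_eq_span_range]
    exact hp₁ c (left_ne_zero_of_mul hc')
  have hC : ∀ i < l, ∀ u ∈ I ^ (τ + 1), b i * u ∈ Ideal.span (b '' Set.Iio i) * I ^ τ →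
      u ∈ Ideal.span (b '' Set.Iio i) * I ^ τ := by
    intro i hi u hu hbu
    have h1 := ha ⟨i, hi⟩
    rw [initialIdeal_eq_span_image_Iio hba hi.le, Nat.add_sub_cancel] at h1
    rw [← h1]
    refine ⟨Submodule.mem_colon_singleton.mpr ?_, hu⟩
    have h2 := hba ⟨i, hi⟩
    dsimp only at h2 ⊢
    rwa [← h2, smul_eq_mul, mul_comm u]
  have hreg := isRegularInDegree_of_le hbI hJ hC fun i hi j hj =>
    hp₂ c (right_ne_zero_of_mul hc') i hi j (Nat.lt_succ_of_le hj)
  exact isCohenMacaulay_reesQuotient K hbI hJ hK.2.ge hreg
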